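/- **Setting.** Fix integers $1\le K\le N$, $d\ge 1$ and a space $\mathcal X$ of query contexts; a context $x$ has a feature vector $x_{-j}\in\mathbb R^d$ for each server $j\in[N]$ (measurable in $x$). Let $\mathcal C=\{S\subseteq[N]:|S|=K\}$. For $\theta\in\mathbb R^d$, $S\in\mathcal C$ put $$p_j(x,S,\theta)=\frac{e^{x_{-j}^\top\theta}}{1+\sum_{k\in S}e^{x_{-k}^\top\theta}}\ (j\in S),\qquad p_0(x,S,\theta)=\frac{1}{1+\sum_{k\in S}e^{x_{-k}^\top\theta}},\qquad R(x,S,\theta)=\sum_{j\in S}p_j(x,S,\theta).$$ In round $t=1,2,\dots$ the agent serves a query with context $x_t$ from the finite queue $\mathcal X_t$ (if it is nonempty) with an assortment $S_t\in\mathcal C$; given the past, the samples and the action, the user chooses $j\in S_t\cup\{0\}$ with probability $p_j(x_t,S_t,\theta^*)$, and $y_{tj}\in\{0,1\}$ indicates whether $j$ is chosen. The query leaves the queue iff the choice is not $0$. If $A(t)=1$, where $A(t)\in\{0,1\}$ has mean $\lambda$, a new query with context $x^{(t)}$ joins the queue; the $x^{(t)}$ are i.i.d. with law $\mathcal D$.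 **Assumptions.** $\|x_{-j}\|_2\le 1$ and $\|\theta^*\|_2\le 1$; $\Theta\subseteq\mathbb R^d$ is a closed convex set of candidate parameters with $\theta^*\in\Theta$ ($\Theta=\mathbb R^d$ is allowed), and $p_j(x,S,\theta)\,p_0(x,S,\theta)\ge 1/\kappa$ for all $x\in\mathcal X$, $S\in\mathcal C$, $j\in S$, $\theta\in\Theta$, where $\kappa>0$; $\lambda_{\min}\big(\mathbb E_{x\sim\mathcal D}[\frac1N\sum_{j}x_{-j}x_{-j}^\top]\big)\ge\sigma_0^2$ for some $\sigma_0>0$; and there is $\epsilon>0$ such that every $x\in\mathcal X$ admits $S\in\mathcal C$ with $R(x,S,\theta^*)-\lambda\ge\epsilon$. **Algorithm (ACQB)** with parameters $\lambda_0,c_1>0$. Let $\eta(t)=\min\{1,c_1(t+1)^{-1/2}\}$, $M=\lceil 1-\log K/\log(1-\frac1{4\sqrt{e\pi}})\rceil$, $\alpha_l=\frac\kappa2\sqrt{d\log(1+\frac{lK}{d\lambda_0})+4\log l}+\kappa\sqrt{\lambda_0}$ (with $\alpha_0=\kappa\sqrt{\lambda_0}$), $V_t=\lambda_0 I+\sum_{i\le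 t}\sum_{j\in S_i}x_{ij}x_{ij}^\top$, where $x_{ij}$ is the feature vector of $x_i$ for $j$, and let $\hat\theta_t$ minimize over $\Theta$ $$\mathcal L_t(\theta)=\tfrac{\lambda_0}2\|\theta\|_2^2-\sum_{i\le t}\sum_{j\in S_i\cup\{0\}}y_{ij}\log p_j(x_i,S_i,\theta);$$ rounds with an empty queue are left out of both sums. A coin $E(t-1)\sim\mathrm{Bern}(\eta(t-1))$, independent of the past (including the arrival at $t-1$), is tossed for round $t$. If $A(t-1)=E(t-1)=1$, then $x_t=x^{(t-1)}$ and $S_t$ is the next element of $\mathcal C$ in round-robin order. Otherwise $\tilde\theta^{(1)},\dots,\tilde\theta^{(M)}$ are drawn, given the past, independently from $\mathcal N(\hat\theta_{t-1},\alpha_{t-1}^2V_{t-1}^{-1})$, and $(x_t,S_t)$ maximizes $\sum_{k\in S}\frac{e^{\tilde u_k(x)}}{1+\sum_{j\in S}e^{\tilde u_j(x)}}$ over $\mathcal X_t\times\mathcal C$, where $\tilde u_j(x)=\max_i x_{-j}^\top\tilde\theta^{(i)}$. (The queue at the start of round 1 is an arbitrary finite one; a query may or may not arrive just before round 1.) **Theorem.**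 There are an absolute constant $p$ and a constant $C$ depending only on $K,\kappa,\lambda_0,c_1$ such that, for every instance as above and every $t\ge1$, $$\sum_{i=1}^t\mathbb E\big[\max_{S\in\mathcal C}R(x_i,S,\theta^*)-R(x_i,S_i,\theta^*)\big]\le C\,d^{3/2}\sqrt t\,(1+\log t)^p ,$$ and also, for the stronger regret, $$\sum_{i=1}^t\mathbb E\big[\max_{x\in\mathcal X_i,\,S\in\mathcal C}R(x,S,\theta^*)-R(x_i,S_i,\theta^*)\big]\le C\,d^{3/2}\sqrt t\,(1+\log t)^p ,$$ where the bracket is taken to be $0$ in a round in which the queue is empty. In particular, both cumulative regrets are $\tilde O(d^{3/2}\sqrt t)$. -/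

import Mathlib

open MeasureTheory ProbabilityTheory

namespace ACQB

noncomputable section

/-- A contextual queueing bandit with multinomial-logit feedback: `N` servers, query contexts in
`X`, features in `ℝ^d`. -/
structure Model (d N : ℕ) (X : Type*) [MeasurableSpace X] where
  /-- `feat x j` is the feature vector of the context `x` for the server `j`. -/
  feat : X → Fin N → EuclideanSpace ℝ (Fin d)
  /-- The unknown parameter. -/
  θstar : EuclideanSpace ℝ (Fin d)
  /-- The set of candidate parameters (the whole space is allowed). -/
  Θ : Set (EuclideanSpace ℝ (Fin d))
  /-- The mean of the arrival indicators. -/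
  arrivalRate : ℝ
  /-- The law of the context of a newly arriving query. -/
  ctxLaw : Measure X

namespace Model

variable {d N : ℕ} {X : Type*} [MeasurableSpace X] (mdl : Model d N X)

/-- The choice probabilities: `none` is the outside option (dissatisfaction), `some j` is the
choice of the server `j` of the assortment `S`. -/
def choiceProb (x : X) (S : Finset (Fin N)) (θ : EuclideanSpace ℝ (Fin d)) :
    Option (Fin N) → ℝ
  | none => 1 / (1 + ∑ i ∈ S, Real.exp (inner ℝ (mdl.feat x i) θ))
  | some j =>
    if j ∈ S then
      Real.exp (inner ℝ (mdl.feat x j) θ) / (1 + ∑ i ∈ S, Real.exp (inner ℝ (mdl.feat x i) θ))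
    else 0

/-- The departure rate `R(x, S, θ)`. -/
def rate (x : X) (S : Finset (Fin N)) (θ : EuclideanSpace ℝ (Fin d)) : ℝ :=
  ∑ j ∈ S, mdl.choiceProb x S θ (some j)

/-- The matrix `E_{x ∼ D} [(1/N) ∑_j x_{-j} x_{-j}ᵀ]`. -/
def secondMoment : Matrix (Fin d) (Fin d) ℝ :=
  Matrix.of fun a b => ∫ x, (1 / (N : ℝ)) * ∑ j, mdl.feat x j a * mdl.feat x j b ∂mdl.ctxLaw

/-- The standing assumptions on the model, with assortments of size `K` and curvature
constant `κ`. -/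
structure Assumptions (K : ℕ) (κ : ℝ) : Prop where
  measurable_feat : ∀ j, Measurable fun x => mdl.feat x j
  isProbabilityMeasure_ctxLaw : IsProbabilityMeasure mdl.ctxLaw
  isClosed_Θ : IsClosed mdl.Θ
  convex_Θ : Convex ℝ mdl.Θ
  θstar_mem : mdl.θstar ∈ mdl.Θ
  /-- Features and the true parameter lie in the unit ball. -/
  norm_feat_le : ∀ x j, ‖mdl.feat x j‖ ≤ 1
  norm_θstar_le : ‖mdl.θstar‖ ≤ 1
  /-- `inf p_j p_0 ≥ 1 / κ` over the candidate parameters. -/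
  curvature : ∀ x, ∀ S : Finset (Fin N), S.card = K → ∀ j ∈ S, ∀ θ ∈ mdl.Θ,
    1 / κ ≤ mdl.choiceProb x S θ (some j) * mdl.choiceProb x S θ none
  /-- The least eigenvalue of the second moment matrix is at least `σ₀² > 0`. -/
  diversity : ∃ σ₀ : ℝ, 0 < σ₀ ∧
    (mdl.secondMoment - σ₀ ^ 2 • (1 : Matrix (Fin d) (Fin d) ℝ)).PosSemidef
  /-- Traffic slackness. -/
  slackness : ∃ ε : ℝ, 0 < ε ∧ ∀ x, ∃ S : Finset (Fin N), S.card = K ∧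
    ε ≤ mdl.rate x S mdl.θstar - mdl.arrivalRate

/-- The largest departure rate of the query context `x` over all assortments of size `K`. -/
def bestRate (K : ℕ) (x : X) : ℝ :=
  sSup {r | ∃ S : Finset (Fin N), S.card = K ∧ r = mdl.rate x S mdl.θstar}

/-- The largest departure rate over all pairs of a query in the queue `Q` (with contexts `ctx`)
and an assortment of size `K`. -/
def bestRateQueue (K : ℕ) (ctx : ℤ → X) (Q : Finset ℤ) : ℝ :=
  sSup {r | ∃ q ∈ Q, ∃ S : Finset (Fin N), S.card = K ∧ r = mdl.rate (ctx q) S mdl.θstar}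

end Model

/-- The number `M` of Thompson samples per round. -/
def sampleSize (K : ℕ) : ℕ :=
  ⌈1 - Real.log K / Real.log (1 - 1 / (4 * √(Real.exp 1 * Real.pi)))⌉₊

/-- The exploration probability `η(t)`. -/
def exploreProb (c₁ : ℝ) (t : ℕ) : ℝ :=
  min 1 (c₁ / √((t : ℝ) + 1))

/-- The confidence radius `α_l` (for `l = 0` the term `log l` is read as `0`). -/
def radius (d K : ℕ) (κ lam₀ : ℝ) (l : ℕ) : ℝ :=
  κ / 2 * √(d * Real.log (1 + l * K / (d * lam₀)) + 4 * Real.log l) + κ * √lam₀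

/-- The random quantities of a run on the sample space `Ω`; rounds are numbered from `1`.
Queries carry labels in `ℤ`: the label `s ≥ 1` belongs to the query which arrives in round `s` (if
one arrives), labels `≤ 0` belong to the queries that are present at the beginning of round `1`, of
which the label `0` belongs to the one (if any) which arrived just before. Labels distinguish
queries with equal contexts. -/
structure Run (d N K : ℕ) (X Ω : Type*) where
  /-- `arr t` is `A(t)`. -/
  arr : ℕ → Ω → Bool
  /-- `coin t` is `E(t)`. -/
  coin : ℕ → Ω → Bool
  /-- The context of the query with a given label. -/
  ctx : ℤ → Ω → X
  /-- The labels of the queries pending at the beginning of round `t`. -/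
  queue : ℕ → Ω → Finset ℤ
  /-- `sample t` is the family of the parameters sampled in round `t`. -/
  sample : ℕ → Ω → Fin (sampleSize K) → EuclideanSpace ℝ (Fin d)
  /-- The label of the query served in round `t` (meaningless if the queue is empty). -/
  job : ℕ → Ω → ℤ
  /-- The assortment `S_t`. -/
  asst : ℕ → Ω → Finset (Fin N)
  /-- The choice of the user in round `t`, `none` being the outside option. -/
  choice : ℕ → Ω → Option (Fin N)
  /-- `est t` is the estimator computed at the end of round `t`. -/
  est : ℕ → Ω → EuclideanSpace ℝ (Fin d)
  /-- The information at the beginning of round `t`: it contains the past and the queue, but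
  neither the coin `E(t-1)` nor the samples of round `t`. -/
  pre : ℕ → MeasurableSpace Ω
  /-- The information in round `t` after the action has been chosen. -/
  mid : ℕ → MeasurableSpace Ω

namespace Run

variable {d N K : ℕ} {X Ω : Type*} [MeasurableSpace X]

/-- The context of the query served in round `t`. -/
def query (run : Run d N K X Ω) (t : ℕ) (ω : Ω) : X :=
  run.ctx (run.job t ω) ω

/-- Round `t` is a forced exploration round. -/
def Explores (run : Run d N K X Ω) (t : ℕ) (ω : Ω) : Prop :=
  run.arr (t - 1) ω = true ∧ run.coin (t - 1) ω = true

open Classical in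
/-- The number of forced exploration rounds among the rounds `1, …, t - 1`. -/
def exploreCount (run : Run d N K X Ω) (t : ℕ) (ω : Ω) : ℕ :=
  ((Finset.Ico 1 t).filter fun s => run.Explores s ω).card

/-- The design matrix `V_t`; rounds with an empty queue do not contribute. -/
def design (mdl : Model d N X) (lam₀ : ℝ) (run : Run d N K X Ω) (t : ℕ) (ω : Ω) :
    Matrix (Fin d) (Fin d) ℝ :=
  lam₀ • (1 : Matrix (Fin d) (Fin d) ℝ) + ∑ i ∈ Finset.Icc 1 t,
    if run.queue i ω = ∅ then 0
    else ∑ j ∈ run.asst i ω, Matrix.vecMulVec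
      (fun a => mdl.feat (run.query i ω) j a) (fun a => mdl.feat (run.query i ω) j a)

/-- The regularized cross-entropy loss `L_t`; rounds with an empty queue do not contribute. -/
def loss (mdl : Model d N X) (lam₀ : ℝ) (run : Run d N K X Ω) (t : ℕ) (ω : Ω)
    (θ : EuclideanSpace ℝ (Fin d)) : ℝ :=
  lam₀ / 2 * ‖θ‖ ^ 2 - ∑ i ∈ Finset.Icc 1 t,
    if run.queue i ω = ∅ then 0
    else Real.log (mdl.choiceProb (run.query i ω) (run.asst i ω) θ (run.choice i ω))

/-- The optimistic utility of the server `j` for the context `x` in round `t`. -/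
def optUtility (mdl : Model d N X) (run : Run d N K X Ω) (t : ℕ) (ω : Ω) (x : X) (j : Fin N) : ℝ :=
  ⨆ i, inner ℝ (mdl.feat x j) (run.sample t ω i)

/-- The optimistic departure rate of the pair `(x, S)` in round `t`. -/
def optRate (mdl : Model d N X) (run : Run d N K X Ω) (t : ℕ) (ω : Ω) (x : X)
    (S : Finset (Fin N)) : ℝ :=
  ∑ k ∈ S, Real.exp (run.optUtility mdl t ω x k) /
    (1 + ∑ j ∈ S, Real.exp (run.optUtility mdl t ω x j))

/-- `run` is a run of ACQB on the model `mdl`, with curvature constant `κ`, regularization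
`lam₀`, exploration constant `c₁`, and `enum 0, enum 1, …, enum (N.choose K - 1)` as the
enumeration of all assortments. Ties in the maximization of the optimistic rate are broken
arbitrarily. -/
structure IsACQB [MeasurableSpace Ω] (P : Measure Ω) (mdl : Model d N X) (κ lam₀ c₁ : ℝ)
    (enum : ℕ → Finset (Fin N)) (run : Run d N K X Ω) : Prop where
  enum_bijOn : Set.BijOn enum (Set.Iio (N.choose K)) {S | S.card = K}
  -- the information structure
  pre_le_mid : ∀ t, 1 ≤ t → run.pre t ≤ run.mid t
  mid_le_pre : ∀ t, 1 ≤ t → run.mid t ≤ run.pre (t + 1)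
  pre_le : ∀ t, 1 ≤ t → run.pre t ≤ ‹MeasurableSpace Ω›
  measurable_arr : ∀ t, Measurable[run.pre (t + 1)] (run.arr t)
  measurable_coin : ∀ t, Measurable[run.mid (t + 1)] (run.coin t)
  measurable_ctx : ∀ (k : ℤ) (t : ℕ), 1 ≤ t → k < t → Measurable[run.pre t] (run.ctx k)
  measurable_queue : ∀ t, 1 ≤ t → ∀ Q, MeasurableSet[run.pre t] {ω | run.queue t ω = Q}
  measurable_sample : ∀ t, 1 ≤ t → Measurable[run.mid t] (run.sample t)
  measurable_job : ∀ t, 1 ≤ t → Measurable[run.mid t] (run.job t)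
  measurable_asst : ∀ t, 1 ≤ t → ∀ S, MeasurableSet[run.mid t] {ω | run.asst t ω = S}
  measurable_choice : ∀ t, 1 ≤ t → ∀ y, MeasurableSet[run.pre (t + 1)] {ω | run.choice t ω = y}
  measurable_est : ∀ t, Measurable[run.pre (t + 1)] (run.est t)
  -- arrivals
  arr_mean : ∀ t, 1 ≤ t → P.real {ω | run.arr t ω = true} = mdl.arrivalRate
  ctx_indep : iIndepFun (fun (s : ℕ) => run.ctx ((s : ℤ) + 1)) P
  ctx_law : ∀ s : ℕ, P.map (run.ctx ((s : ℤ) + 1)) = mdl.ctxLaw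
  -- the queue
  queue_one_le : ∀ ω, ∀ k ∈ run.queue 1 ω, k ≤ 0
  queue_one_arr : ∀ ω, run.arr 0 ω = true → (0 : ℤ) ∈ run.queue 1 ω
  queue_succ : ∀ t, 1 ≤ t → ∀ ω, run.queue (t + 1) ω =
    (if run.choice t ω = none then run.queue t ω else (run.queue t ω).erase (run.job t ω)) ∪
      (if run.arr t ω = true then {(t : ℤ)} else ∅)
  -- user feedback
  choice_law : ∀ t, 1 ≤ t → ∀ y, ∀ᵐ ω ∂P, run.queue t ω ≠ ∅ →
    (P⟦{ω' | run.choice t ω' = y} | run.mid t⟧) ω =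
      mdl.choiceProb (run.query t ω) (run.asst t ω) mdl.θstar y
  -- the exploration coin
  coin_law : ∀ t, 1 ≤ t → ∀ᵐ ω ∂P,
    (P⟦{ω' | run.coin (t - 1) ω' = true} | run.pre t⟧) ω = exploreProb c₁ (t - 1)
  -- forced exploration: serve the new query, assortments in round-robin order
  explore_job : ∀ t, 1 ≤ t → ∀ ω, run.Explores t ω → run.job t ω = (t : ℤ) - 1
  explore_asst : ∀ t, 1 ≤ t → ∀ ω, run.Explores t ω →
    run.asst t ω = enum (run.exploreCount t ω % N.choose K)
  -- otherwise: independent Gaussian samples, then the optimistic choice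
  sample_law : ∀ t, 1 ≤ t → ∀ B : Set (Fin (sampleSize K) → EuclideanSpace ℝ (Fin d)),
    MeasurableSet B → ∀ᵐ ω ∂P, ¬ run.Explores t ω →
      (P⟦run.sample t ⁻¹' B | run.pre t ⊔ MeasurableSpace.comap (run.coin (t - 1)) ⊤⟧) ω =
        (Measure.pi fun _ : Fin (sampleSize K) => multivariateGaussian (run.est (t - 1) ω)
          (radius d K κ lam₀ (t - 1) ^ 2 • (run.design mdl lam₀ (t - 1) ω)⁻¹)).real B
  opt_job : ∀ t, 1 ≤ t → ∀ ω, ¬ run.Explores t ω → run.queue t ω ≠ ∅ →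
    run.job t ω ∈ run.queue t ω
  opt_asst : ∀ t, 1 ≤ t → ∀ ω, ¬ run.Explores t ω → run.queue t ω ≠ ∅ → (run.asst t ω).card = K
  opt_max : ∀ t, 1 ≤ t → ∀ ω, ¬ run.Explores t ω → ∀ q ∈ run.queue t ω,
    ∀ S : Finset (Fin N), S.card = K →
      run.optRate mdl t ω (run.ctx q ω) S ≤ run.optRate mdl t ω (run.query t ω) (run.asst t ω)
  -- the estimator
  est_mem : ∀ t ω, run.est t ω ∈ mdl.Θ
  est_min : ∀ t ω, IsMinOn (run.loss mdl lam₀ t ω) mdl.Θ (run.est t ω)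

/-- The routing regret of round `i`: the comparator is the best assortment for the served query.
In a round with an empty queue no query is routed and the regret is `0`. -/
def routingRegret (mdl : Model d N X) (run : Run d N K X Ω) (i : ℕ) (ω : Ω) : ℝ :=
  if run.queue i ω = ∅ then 0
  else mdl.bestRate K (run.query i ω) - mdl.rate (run.query i ω) (run.asst i ω) mdl.θstar

/-- The regret of round `i` against the best pair of a query in the current queue and an
assortment; `0` if the queue is empty. -/
def queueRegret (mdl : Model d N X) (run : Run d N K X Ω) (i : ℕ) (ω : Ω) : ℝ :=
  if run.queue i ω = ∅ then 0
  else mdl.bestRateQueue K (fun q => run.ctx q ω) (run.queue i ω) -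
    mdl.rate (run.query i ω) (run.asst i ω) mdl.θstar

end Run

end

end ACQB

/-! The served query lies in the queue, so the routing regret of a round is at most its regret
against the best pair in the queue; only the latter has to be bounded. It never exceeds 1. Hence the
forced exploration rounds, of probability at most `c₁ / √t` in round `t`, and the rounds whose
estimator lies outside its confidence ellipsoid cost `O(√t)` in total.

The ellipsoid: by Hoeffding's lemma the centred choices form an exponential supermartingale
(`lintegral_exp_noise_le`), and the method of mixtures bounds the `V⁻¹`-norm of their sum
(`measure_selfNormalized_le`). The log-likelihood has curvature at least `1 / κ` on the segment from
`θ*` to the estimator, so minimality of the loss alone turns this into an error of at most four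
radii (`sqrt_quad_error_le`, `measure_error_le`).

In the remaining rounds let `R` be the best true rate, `φ` the maximal optimistic rate and `ρ` the
true rate of the action, and split `R - ρ = (R - φ) + (φ - ρ)`. By convexity of `exp`, `φ ≥ R` as
soon as one sample falls in a certain half-space. This has conditional probability at least
`P(N(0,1) ≥ 4)` on the ellipsoid, a constant free of `K` and `d`. Moreover `φ` exceeds its
conditional mean by little: under fresh samples the action just played would again have an
optimistic rate close to its rate at the estimator. A value that reaches `R` with probability `q`
and rarely exceeds its mean by much has a mean not far below `R` (`mul_setIntegral_sub_le`). The
term `φ - ρ` is bounded by Lipschitz continuity of the rate.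

Both errors have the form (spread of the samples plus radius) times (sum of the `V⁻¹`-norms of the
features). The inequality of the means with a weight `b` separates the factors
(`setIntegral_regret_le`): the first has second moment of order `M d α²`, with `α² = O(d log t)`,
and the squares of the second sum to `O(d log t)` by the growth of the log-determinant. The choice
`b = √(t d)` balances the two and gives `d^(3/2) √t log t`. -/

namespace ACQB

open Matrix

/-! ### Quadratic forms, their duals, and log-determinants -/

section LinearAlgebra

variable {n : ℕ} {V B : Matrix (Fin n) (Fin n) ℝ}

lemma quad_nonneg (hV : V.PosSemidef) (x : Fin n → ℝ) : 0 ≤ x ⬝ᵥ V *ᵥ x := by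
  simpa using hV.dotProduct_mulVec_nonneg x

lemma quad_inv_nonneg (hV : V.PosDef) (x : Fin n → ℝ) : 0 ≤ x ⬝ᵥ V⁻¹ *ᵥ x :=
  quad_nonneg hV.inv.posSemidef x

lemma dotProduct_mulVec_swap (hV : V.IsHermitian) (x y : Fin n → ℝ) :
    x ⬝ᵥ V *ᵥ y = y ⬝ᵥ V *ᵥ x := by
  have h : Vᵀ = V := by rw [← conjTranspose_eq_transpose_of_trivial]; exact hV
  rw [dotProduct_mulVec, ← mulVec_transpose, h, dotProduct_comm]

lemma quad_add_smul (hV : V.IsHermitian) (x y : Fin n → ℝ) (s : ℝ) :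
    (y + s • x) ⬝ᵥ V *ᵥ (y + s • x) =
      y ⬝ᵥ V *ᵥ y + 2 * s * (x ⬝ᵥ V *ᵥ y) + s ^ 2 * (x ⬝ᵥ V *ᵥ x) := by
  simp only [mulVec_add, mulVec_smul, dotProduct_add, add_dotProduct, smul_dotProduct,
    dotProduct_smul, smul_eq_mul, dotProduct_mulVec_swap hV y x]
  ring

lemma mulVec_inv_mulVec (hV : V.PosDef) (x : Fin n → ℝ) : V *ᵥ V⁻¹ *ᵥ x = x := by
  rw [mulVec_mulVec, mul_nonsing_inv _ hV.det_pos.ne'.isUnit, one_mulVec]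

/-- Cauchy–Schwarz for the dual pair of norms given by `V⁻¹` and `V`. -/
lemma dotProduct_sq_le (hV : V.PosDef) (x y : Fin n → ℝ) :
    (x ⬝ᵥ y) ^ 2 ≤ (x ⬝ᵥ V⁻¹ *ᵥ x) * (y ⬝ᵥ V *ᵥ y) := by
  have h (s : ℝ) : 0 ≤ (x ⬝ᵥ V⁻¹ *ᵥ x) * (s * s) + (2 * (x ⬝ᵥ y)) * s + y ⬝ᵥ V *ᵥ y := by
    have h0 := quad_nonneg hV.posSemidef (y + s • (V⁻¹ *ᵥ x))
    rw [quad_add_smul hV.isHermitian, mulVec_inv_mulVec hV,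
      dotProduct_mulVec_swap hV.isHermitian (V⁻¹ *ᵥ x), mulVec_inv_mulVec hV,
      dotProduct_comm y x, dotProduct_comm (V⁻¹ *ᵥ x) x] at h0
    linarith
  have := discrim_le_zero h
  rw [discrim] at this
  nlinarith

lemma abs_dotProduct_le (hV : V.PosDef) (x y : Fin n → ℝ) :
    |x ⬝ᵥ y| ≤ √(x ⬝ᵥ V⁻¹ *ᵥ x) * √(y ⬝ᵥ V *ᵥ y) := by
  rw [← Real.sqrt_mul (quad_inv_nonneg hV x)]
  exact Real.abs_le_sqrt (dotProduct_sq_le hV x y)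

/-- Inversion reverses the order of positive definite forms; Cauchy–Schwarz for the pair `B⁻¹`, `B`,
tested at `y = V⁻¹ x`, gives this without square roots of matrices. -/
lemma quad_inv_le_of_quad_le (hV : V.PosDef) (hB : B.PosDef) {c : ℝ} (hc : 0 ≤ c)
    (h : ∀ y, y ⬝ᵥ B *ᵥ y ≤ c * (y ⬝ᵥ V *ᵥ y)) (x : Fin n → ℝ) :
    x ⬝ᵥ V⁻¹ *ᵥ x ≤ c * (x ⬝ᵥ B⁻¹ *ᵥ x) := by
  have h1 := dotProduct_sq_le hB x (V⁻¹ *ᵥ x)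
  have h2 := h (V⁻¹ *ᵥ x)
  rw [mulVec_inv_mulVec hV, dotProduct_comm (V⁻¹ *ᵥ x) x] at h2
  have h3 := quad_inv_nonneg hV x
  have h4 := quad_inv_nonneg hB x
  set a := x ⬝ᵥ V⁻¹ *ᵥ x
  set b := x ⬝ᵥ B⁻¹ *ᵥ x
  rcases h3.eq_or_lt with h0 | h0
  · rw [← h0]; positivity
  · have : a * a ≤ (c * b) * a := by nlinarith [mul_le_mul_of_nonneg_left h2 h4]
    exact le_of_mul_le_mul_right this h0

lemma quad_vecMulVec (x y : Fin n → ℝ) : y ⬝ᵥ vecMulVec x x *ᵥ y = (x ⬝ᵥ y) ^ 2 := by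
  rw [vecMulVec_mulVec]
  simp [dotProduct_comm y x, sq]

lemma posSemidef_vecMulVec (x : Fin n → ℝ) : (vecMulVec x x).PosSemidef := by
  simpa using posSemidef_vecMulVec_self_star x

lemma det_add_vecMulVec (hV : V.PosDef) (x : Fin n → ℝ) :
    (V + vecMulVec x x).det = V.det * (1 + x ⬝ᵥ V⁻¹ *ᵥ x) := by
  have h := det_add_replicateCol_mul_replicateRow (ι := Unit) (A := V) hV.det_pos.ne'.isUnit x x
  rw [← vecMulVec_eq] at h
  rw [h]
  congr 1
  rw [det_unique]
  simp [Matrix.add_apply, Matrix.mul_apply, dotProduct, mulVec, Finset.sum_mul, Finset.mul_sum]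
  rw [Finset.sum_comm]
  exact Finset.sum_congr rfl fun i _ => Finset.sum_congr rfl fun j _ => by ring

lemma posDef_add_sum {ι : Type*} (hV : V.PosDef) (f : ι → Fin n → ℝ) (S : Finset ι) :
    (V + ∑ j ∈ S, vecMulVec (f j) (f j)).PosDef :=
  hV.add_posSemidef (posSemidef_sum _ fun _ _ => posSemidef_vecMulVec _)

lemma quad_add_sum {ι : Type*} (f : ι → Fin n → ℝ) (S : Finset ι) (y : Fin n → ℝ) :
    y ⬝ᵥ (V + ∑ j ∈ S, vecMulVec (f j) (f j)) *ᵥ y =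
      y ⬝ᵥ V *ᵥ y + ∑ j ∈ S, (f j ⬝ᵥ y) ^ 2 := by
  rw [add_mulVec, dotProduct_add, sum_mulVec, dotProduct_sum]
  simp [quad_vecMulVec]

/-- Growth of the log-determinant under the addition of several rank one terms. -/
lemma sum_log_le_log_det_add_sum {ι : Type*} [DecidableEq ι] (hV : V.PosDef) {c : ℝ} (hc : 0 < c)
    (f : ι → Fin n → ℝ) (S : Finset ι)
    (h : ∀ y, y ⬝ᵥ V *ᵥ y + ∑ j ∈ S, (f j ⬝ᵥ y) ^ 2 ≤ c * (y ⬝ᵥ V *ᵥ y)) :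
    Real.log V.det + ∑ j ∈ S, Real.log (1 + (f j ⬝ᵥ V⁻¹ *ᵥ f j) / c) ≤
      Real.log (V + ∑ j ∈ S, vecMulVec (f j) (f j)).det := by
  induction S using Finset.induction_on with
  | empty => simp
  | insert a S ha ih =>
    have hB := posDef_add_sum hV f S
    have h' (y : Fin n → ℝ) : y ⬝ᵥ V *ᵥ y + ∑ j ∈ S, (f j ⬝ᵥ y) ^ 2 ≤ c * (y ⬝ᵥ V *ᵥ y) := by
      have := h y
      rw [Finset.sum_insert ha] at this
      nlinarith [sq_nonneg (f a ⬝ᵥ y)]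
    -- Every partial sum stays below `c V`. Adding the rank one terms one by one therefore shrinks
    -- each dual norm by a factor of at most `c`, and all norms can be taken with respect to the
    -- initial `V`.
    have h1 : (f a ⬝ᵥ V⁻¹ *ᵥ f a) ≤
        c * (f a ⬝ᵥ (V + ∑ j ∈ S, vecMulVec (f j) (f j))⁻¹ *ᵥ f a) :=
      quad_inv_le_of_quad_le hV hB hc.le (fun y => by rw [quad_add_sum]; exact h' y) _
    have h0 := quad_inv_nonneg hV (f a)
    rw [Finset.sum_insert ha, Finset.sum_insert ha, add_comm (vecMulVec (f a) _) (∑ j ∈ S, _), ← add_assoc V,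
      det_add_vecMulVec hB, Real.log_mul hB.det_pos.ne'
      (by have := quad_inv_nonneg hB (f a); positivity)]
    have : Real.log (1 + (f a ⬝ᵥ V⁻¹ *ᵥ f a) / c) ≤
        Real.log (1 + f a ⬝ᵥ (V + ∑ j ∈ S, vecMulVec (f j) (f j))⁻¹ *ᵥ f a) := by
      refine Real.log_le_log (by positivity) ?_
      gcongr
      rw [div_le_iff₀ hc]; linarith
    linarith [ih h']

/-- The arithmetic-geometric mean inequality for the eigenvalues: the tangent line of `log` at their
average is summed. -/
lemma log_det_le (hn : 0 < n) (hV : V.PosDef) :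
    Real.log V.det ≤ n * Real.log (V.trace / n) := by
  have hn' : (0 : ℝ) < n := by exact_mod_cast hn
  have hpos := hV.eigenvalues_pos
  have : Nonempty (Fin n) := ⟨⟨0, hn⟩⟩
  have htr : V.trace = ∑ i, hV.isHermitian.eigenvalues i := by
    simpa using hV.isHermitian.trace_eq_sum_eigenvalues
  have hdet : V.det = ∏ i, hV.isHermitian.eigenvalues i := by
    simpa using hV.isHermitian.det_eq_prod_eigenvalues
  have htrpos : 0 < V.trace := by rw [htr]; exact Finset.sum_pos (fun i _ => hpos i) (by simp)
  rw [hdet, Real.log_prod fun i _ => (hpos i).ne']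
  set c := V.trace / n with hc
  have hcpos : 0 < c := by positivity
  have h (i : Fin n) : Real.log (hV.isHermitian.eigenvalues i) ≤
      hV.isHermitian.eigenvalues i / c - 1 + Real.log c := by
    have := Real.log_le_sub_one_of_pos (div_pos (hpos i) hcpos)
    rw [Real.log_div (hpos i).ne' hcpos.ne'] at this
    linarith
  refine (Finset.sum_le_sum fun i _ => h i).trans ?_
  rw [Finset.sum_add_distrib, Finset.sum_sub_distrib, ← Finset.sum_div, ← htr]
  have : V.trace / c = n := by rw [hc]; field_simp
  simp [this]

end LinearAlgebra

/-! ### Method of mixtures for self-normalized sums -/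

section SelfNormalized

variable {n : ℕ} {V : Matrix (Fin n) (Fin n) ℝ}

open scoped MatrixOrder Matrix.Norms.L2Operator in
lemma exists_transpose_mul_self (hV : V.PosDef) :
    ∃ B : Matrix (Fin n) (Fin n) ℝ, V = Bᵀ * B ∧ B.det ≠ 0 ∧ |B.det| = √V.det := by
  obtain ⟨B, hB⟩ := CStarAlgebra.nonneg_iff_eq_star_mul_self.1 hV.posSemidef.nonneg
  rw [star_eq_conjTranspose, conjTranspose_eq_transpose_of_trivial] at hB
  have hdet : V.det = B.det ^ 2 := by rw [hB, det_mul, det_transpose, sq]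
  refine ⟨B, hB, fun h => hV.det_pos.ne' (by rw [hdet, h]; simp), ?_⟩
  rw [hdet, Real.sqrt_sq_eq_abs]

/-- The substitution `u ↦ B u` with `V = Bᵀ B`. The standard integral stays unevaluated: it cancels
later, so only its finiteness and positivity matter. -/
lemma lintegral_exp_neg_quad (hV : V.PosDef) :
    ∫⁻ u : Fin n → ℝ, ENNReal.ofReal (Real.exp (-(u ⬝ᵥ V *ᵥ u) / 2)) =
      ENNReal.ofReal (√V.det)⁻¹ *
        ∫⁻ u : Fin n → ℝ, ENNReal.ofReal (Real.exp (-(u ⬝ᵥ u) / 2)) := by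
  obtain ⟨B, hB, hdet, habs⟩ := exists_transpose_mul_self hV
  have h := Real.map_matrix_volume_pi_eq_smul_volume_pi hdet
  have hm : Measurable (toLin' B) := (toLin' B).continuous_of_finiteDimensional.measurable
  rw [← habs, ← abs_inv, ← smul_eq_mul, ← lintegral_smul_measure, ← h, lintegral_map _ hm]
  · refine lintegral_congr fun u => ?_
    rw [toLin'_apply, hB, ← mulVec_mulVec, dotProduct_mulVec, vecMul_transpose]
  · unfold dotProduct
    fun_prop

lemma lintegral_exp_neg_dotProduct_ne_top :
    ∫⁻ u : Fin n → ℝ, ENNReal.ofReal (Real.exp (-(u ⬝ᵥ u) / 2)) ≠ ⊤ := by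
  have h : Integrable fun u : Fin n → ℝ => ∏ i, Real.exp (-(1 / 2) * (u i) ^ 2) :=
    Integrable.fintype_prod (f := fun _ x => Real.exp (-(1 / 2) * x ^ 2))
      fun _ => integrable_exp_neg_mul_sq (by norm_num)
  have h2 : (fun u : Fin n → ℝ => Real.exp (-(u ⬝ᵥ u) / 2)) =
      fun u : Fin n → ℝ => ∏ i, Real.exp (-(1 / 2) * (u i) ^ 2) := by
    ext u
    rw [← Real.exp_sum, dotProduct, ← Finset.mul_sum]
    congr 1
    simp only [sq]
    ring
  rw [← h2] at h
  exact h.lintegral_lt_top.ne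

lemma lintegral_exp_neg_dotProduct_ne_zero :
    ∫⁻ u : Fin n → ℝ, ENNReal.ofReal (Real.exp (-(u ⬝ᵥ u) / 2)) ≠ 0 := by
  rw [← pos_iff_ne_zero, lintegral_pos_iff_support]
  · have : (Function.support fun u : Fin n → ℝ =>
        ENNReal.ofReal (Real.exp (-(u ⬝ᵥ u) / 2))) = Set.univ := by
      ext u
      simp [Real.exp_pos]
    rw [this]
    exact isOpen_univ.measure_pos _ Set.univ_nonempty
  · unfold dotProduct
    fun_prop

/-- Completion of the square: translation by the maximizer `V⁻¹ s` of the exponent. -/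
lemma lintegral_exp_dotProduct_sub_quad (hV : V.PosDef) (s : Fin n → ℝ) :
    ∫⁻ u : Fin n → ℝ, ENNReal.ofReal (Real.exp (u ⬝ᵥ s - (u ⬝ᵥ V *ᵥ u) / 2)) =
      ENNReal.ofReal (Real.exp ((s ⬝ᵥ V⁻¹ *ᵥ s) / 2)) *
        ∫⁻ u : Fin n → ℝ, ENNReal.ofReal (Real.exp (-(u ⬝ᵥ V *ᵥ u) / 2)) := by
  rw [← lintegral_add_right_eq_self _ (V⁻¹ *ᵥ s), ← lintegral_const_mul']
  · refine lintegral_congr fun u => ?_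
    rw [← ENNReal.ofReal_mul (Real.exp_pos _).le, ← Real.exp_add]
    congr 2
    have h := quad_add_smul hV.isHermitian (V⁻¹ *ᵥ s) u 1
    rw [one_smul, dotProduct_mulVec_swap hV.isHermitian (V⁻¹ *ᵥ s) u,
      mulVec_inv_mulVec hV, dotProduct_comm (V⁻¹ *ᵥ s) s] at h
    rw [h, add_dotProduct, dotProduct_comm (V⁻¹ *ᵥ s) s]
    ring
  · exact ENNReal.ofReal_ne_top

/-- The self-normalized tail bound of the method of mixtures. -/
lemma measure_selfNormalized_le {Ω : Type*} [MeasurableSpace Ω] {P : Measure Ω} [SFinite P]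
    {s : Ω → Fin n → ℝ} {A : Ω → Matrix (Fin n) (Fin n) ℝ} (hs : Measurable s)
    (hAm : ∀ a b, Measurable fun ω => A ω a b) (hA : ∀ ω, (A ω).PosSemidef)
    (h : ∀ u : Fin n → ℝ,
      ∫⁻ ω, ENNReal.ofReal (Real.exp (u ⬝ᵥ s ω - (u ⬝ᵥ A ω *ᵥ u) / 2)) ∂P ≤ 1)
    {c : ℝ} (hc : 0 < c) {δ : ℝ} (hδ : 0 < δ) :
    P {ω | Real.log (c • (1 : Matrix (Fin n) (Fin n) ℝ) + A ω).det - n * Real.log c +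
        2 * Real.log (1 / δ) < s ω ⬝ᵥ (c • (1 : Matrix (Fin n) (Fin n) ℝ) + A ω)⁻¹ *ᵥ s ω} ≤
      ENNReal.ofReal δ := by
  have hC : (c • (1 : Matrix (Fin n) (Fin n) ℝ)).PosDef := PosDef.one.smul hc
  have hV (ω : Ω) : (c • (1 : Matrix (Fin n) (Fin n) ℝ) + A ω).PosDef := hC.add_posSemidef (hA ω)
  set V : Ω → Matrix (Fin n) (Fin n) ℝ := fun ω => c • (1 : Matrix (Fin n) (Fin n) ℝ) + A ω
  set I := ∫⁻ u : Fin n → ℝ, ENNReal.ofReal (Real.exp (-(u ⬝ᵥ u) / 2)) with hI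
  -- With `V = c I + A`, this is the exponential of the hypothesis times the Gaussian weight `exp
  -- (-c (u ⬝ᵥ u) / 2)`. Integration over `u` replaces the unknown optimal direction by an average
  -- over all directions.
  set F : Ω → (Fin n → ℝ) → ENNReal := fun ω u =>
    ENNReal.ofReal (Real.exp (u ⬝ᵥ s ω - (u ⬝ᵥ V ω *ᵥ u) / 2)) with hF
  have hVu (ω : Ω) (u : Fin n → ℝ) :
      u ⬝ᵥ V ω *ᵥ u = c * (u ⬝ᵥ u) + u ⬝ᵥ A ω *ᵥ u := by
    simp [V, add_mulVec, smul_mulVec]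
  have hFm : Measurable (Function.uncurry F) := by
    have hsi (i : Fin n) : Measurable fun p : Ω × (Fin n → ℝ) => s p.1 i :=
      (measurable_pi_apply i).comp (hs.comp measurable_fst)
    have hAi (a b : Fin n) : Measurable fun p : Ω × (Fin n → ℝ) => A p.1 a b :=
      (hAm a b).comp measurable_fst
    have : Function.uncurry F = fun p : Ω × (Fin n → ℝ) => ENNReal.ofReal (Real.exp
        (p.2 ⬝ᵥ s p.1 - (c * (p.2 ⬝ᵥ p.2) + p.2 ⬝ᵥ A p.1 *ᵥ p.2) / 2)) := by
      ext p
      simp only [F, Function.uncurry, hVu]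
    rw [this]
    simp only [dotProduct, mulVec]
    fun_prop
  have hFω (ω : Ω) : ∫⁻ u, F ω u =
      ENNReal.ofReal (Real.exp ((s ω ⬝ᵥ (V ω)⁻¹ *ᵥ s ω) / 2) * (√(V ω).det)⁻¹) * I := by
    rw [hF, lintegral_exp_dotProduct_sub_quad (hV ω), lintegral_exp_neg_quad (hV ω), ← mul_assoc,
      ENNReal.ofReal_mul (Real.exp_pos _).le]
  have hF_le : ∫⁻ ω, (∫⁻ u, F ω u) ∂P ≤
      ENNReal.ofReal (√(c • (1 : Matrix (Fin n) (Fin n) ℝ)).det)⁻¹ * I := by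
    rw [lintegral_lintegral_swap hFm.aemeasurable, hI, ← lintegral_exp_neg_quad hC]
    refine lintegral_mono fun u => ?_
    calc ∫⁻ ω, F ω u ∂P
        = ∫⁻ ω, ENNReal.ofReal (Real.exp (-(u ⬝ᵥ (c • (1 : Matrix (Fin n) (Fin n) ℝ)) *ᵥ u) / 2)) *
          ENNReal.ofReal (Real.exp (u ⬝ᵥ s ω - (u ⬝ᵥ A ω *ᵥ u) / 2)) ∂P := by
          refine lintegral_congr fun ω => ?_
          rw [← ENNReal.ofReal_mul (Real.exp_pos _).le, ← Real.exp_add, hF]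
          simp only [hVu, smul_mulVec, one_mulVec, dotProduct_smul, smul_eq_mul]
          congr 2
          ring
      _ ≤ _ := by
          rw [lintegral_const_mul' _ _ ENNReal.ofReal_ne_top]
          exact mul_le_of_le_one_right (zero_le) (h u)
  set a := (√(c • (1 : Matrix (Fin n) (Fin n) ℝ)).det)⁻¹ with ha
  have hapos : 0 < a := inv_pos.2 (Real.sqrt_pos.2 hC.det_pos)
  have hloga : Real.log a = -(n * Real.log c) / 2 := by
    rw [ha, Real.log_inv, Real.log_sqrt hC.det_pos.le, det_smul, det_one, mul_one, Fintype.card_fin,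
      Real.log_pow]
    ring
  -- Markov's inequality at `1 / δ` times the bound `a I` on the mean; the explicit value of the
  -- mixture turns the threshold into the log-determinant condition.
  have hmarkov := mul_meas_ge_le_lintegral (μ := P) (f := fun ω => ∫⁻ u, F ω u)
    hFm.lintegral_prod_right' (ENNReal.ofReal (a / δ) * I)
  have hsub : {ω | Real.log (V ω).det - n * Real.log c + 2 * Real.log (1 / δ) <
      s ω ⬝ᵥ (V ω)⁻¹ *ᵥ s ω} ⊆ {ω | ENNReal.ofReal (a / δ) * I ≤ ∫⁻ u, F ω u} := by
    intro ω hω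
    simp only [Set.mem_ofPred_eq] at hω ⊢
    rw [hFω]
    gcongr
    have hd : 0 < √(V ω).det := Real.sqrt_pos.2 (hV ω).det_pos
    rw [← Real.log_le_log_iff (by positivity) (by positivity), Real.log_div hapos.ne' hδ.ne',
      Real.log_mul (Real.exp_pos _).ne' (by positivity), Real.log_exp, Real.log_inv (√(V ω).det),
      Real.log_sqrt (hV ω).det_pos.le, hloga]
    rw [one_div, Real.log_inv] at hω
    linarith
  have h1 := (mul_le_mul_right (measure_mono hsub) (ENNReal.ofReal (a / δ) * I)).trans
    (hmarkov.trans hF_le)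
  have hI0 : I ≠ 0 := lintegral_exp_neg_dotProduct_ne_zero
  have hIt : I ≠ ⊤ := lintegral_exp_neg_dotProduct_ne_top
  have h2 : ENNReal.ofReal a * I = (ENNReal.ofReal (a / δ) * I) * ENNReal.ofReal δ := by
    rw [mul_right_comm, ← ENNReal.ofReal_mul (by positivity), div_mul_cancel₀ _ hδ.ne']
  rw [h2] at h1
  refine (ENNReal.mul_le_mul_iff_right ?_ ?_).1 h1
  · refine mul_ne_zero ?_ hI0
    simpa using by positivity
  · exact ENNReal.mul_ne_top ENNReal.ofReal_ne_top hIt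

end SelfNormalized

/-! ### Strong convexity of the log-partition function -/

section LogSumExp

variable {ι : Type*} (S : Finset ι) (a b : ι → ℝ)

lemma hasDerivAt_sum_mul_exp (g : ι → ℝ) (s : ℝ) :
    HasDerivAt (fun s : ℝ => ∑ j ∈ S, g j * Real.exp (a j + s * b j))
      (∑ j ∈ S, (g j * b j) * Real.exp (a j + s * b j)) s := by
  refine HasDerivAt.fun_sum fun j _ => ?_
  have h : HasDerivAt (fun s : ℝ => a j + s * b j) (b j) s := by
    simpa using ((hasDerivAt_id s).mul_const (b j)).const_add (a j)
  rw [mul_assoc, mul_comm (b j)]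
  exact h.exp.const_mul (g j)

/-- Strong convexity of `s ↦ log (1 + ∑ exp (a j + s * b j))`, in the form of a lower bound by the
second order expansion at `0`. -/
lemma log_one_add_sum_exp_ge {c : ℝ}
    (hc : ∀ s ∈ Set.Icc (0 : ℝ) 1, ∀ j ∈ S, c ≤
      Real.exp (a j + s * b j) / (1 + ∑ i ∈ S, Real.exp (a i + s * b i)) ^ 2) :
    Real.log (1 + ∑ j ∈ S, Real.exp (a j)) +
        (∑ j ∈ S, b j * Real.exp (a j)) / (1 + ∑ j ∈ S, Real.exp (a j)) +
        c / 2 * ∑ j ∈ S, b j ^ 2 ≤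
      Real.log (1 + ∑ j ∈ S, Real.exp (a j + b j)) := by
  set T : ℝ → ℝ := fun s => 1 + ∑ j ∈ S, 1 * Real.exp (a j + s * b j) with hT
  set T1 : ℝ → ℝ := fun s => ∑ j ∈ S, (1 * b j) * Real.exp (a j + s * b j) with hT1
  set T2 : ℝ → ℝ := fun s => ∑ j ∈ S, (1 * b j * b j) * Real.exp (a j + s * b j) with hT2
  have hTpos (s : ℝ) : 0 < T s := by
    have : 0 ≤ ∑ j ∈ S, 1 * Real.exp (a j + s * b j) :=
      Finset.sum_nonneg fun j _ => by positivity
    simp only [hT]; linarith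
  have dT (s : ℝ) : HasDerivAt T (T1 s) s := (hasDerivAt_sum_mul_exp S a b _ s).const_add 1
  have dT1 (s : ℝ) : HasDerivAt T1 (T2 s) s := hasDerivAt_sum_mul_exp S a b _ s
  set q := ∑ j ∈ S, b j ^ 2 with hq
  have dg (s : ℝ) : HasDerivAt (fun s => T1 s / T s - c * q * s)
      ((T2 s * T s - T1 s * T1 s) / T s ^ 2 - c * q) s := by
    have := ((dT1 s).div (dT s) (hTpos s).ne').sub ((hasDerivAt_id s).const_mul (c * q))
    simpa using! this
  -- The first and second order parts are subtracted, so the claim becomes monotonicity on `[0, 1]`;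
  -- the derivative is nonnegative because it vanishes at `0` and is itself monotone, by `hg`.
  have df (s : ℝ) : HasDerivAt (fun s => Real.log (T s) - T1 0 / T 0 * s - c / 2 * q * s ^ 2)
      (T1 s / T s - T1 0 / T 0 - c * q * s) s := by
    have := (((dT s).log (hTpos s).ne').sub ((hasDerivAt_id s).const_mul (T1 0 / T 0))).sub
      ((hasDerivAt_pow 2 s).const_mul (c / 2 * q))
    convert! this using 1
    norm_num
    ring
  have hg : MonotoneOn (fun s => T1 s / T s - c * q * s) (Set.Icc 0 1) := by
    refine monotoneOn_of_deriv_nonneg (convex_Icc 0 1)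
      (fun s _ => (dg s).continuousAt.continuousWithinAt)
      (fun s _ => (dg s).differentiableAt.differentiableWithinAt) fun s hs => ?_
    rw [interior_Icc] at hs
    have hs' : s ∈ Set.Icc (0 : ℝ) 1 := ⟨hs.1.le, hs.2.le⟩
    rw [(dg s).deriv, sub_nonneg, le_div_iff₀ (pow_pos (hTpos s) 2)]
    -- Cauchy–Schwarz with the exponentials as weights, whose total mass is `T - 1`. The outside
    -- option's summand `1` is what leaves `T2 * T - T1 ^ 2 ≥ T2`.
    have h1 : T1 s * T1 s ≤ T2 s * (T s - 1) := by
      have := Finset.sum_mul_sq_le_sq_mul_sq S (fun j => b j * √(Real.exp (a j + s * b j)))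
        (fun j => √(Real.exp (a j + s * b j)))
      simp only [mul_pow, Real.sq_sqrt (Real.exp_pos _).le, mul_assoc,
        Real.mul_self_sqrt (Real.exp_pos _).le] at this
      simp only [hT1, hT2, hT, one_mul, add_sub_cancel_left]
      rw [← sq]
      simpa only [sq (b _)] using this
    have h2 : c * q * T s ^ 2 ≤ T2 s := by
      rw [hq, Finset.mul_sum, Finset.sum_mul]
      refine Finset.sum_le_sum fun j hj => ?_
      have h3 := hc s hs' j hj
      have h4 : T s = 1 + ∑ i ∈ S, Real.exp (a i + s * b i) := by simp [hT]
      rw [← h4, le_div_iff₀ (pow_pos (hTpos s) 2)] at h3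
      nlinarith [mul_le_mul_of_nonneg_left h3 (sq_nonneg (b j))]
    linarith
  have hf : MonotoneOn (fun s => Real.log (T s) - T1 0 / T 0 * s - c / 2 * q * s ^ 2)
      (Set.Icc 0 1) := by
    refine monotoneOn_of_deriv_nonneg (convex_Icc 0 1)
      (fun s _ => (df s).continuousAt.continuousWithinAt)
      (fun s _ => (df s).differentiableAt.differentiableWithinAt) fun s hs => ?_
    rw [interior_Icc] at hs
    rw [(df s).deriv]
    have := hg ⟨le_rfl, zero_le_one⟩ ⟨hs.1.le, hs.2.le⟩ hs.1.le
    simp only [mul_zero, sub_zero] at this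
    linarith
  have := hf ⟨le_rfl, zero_le_one⟩ ⟨zero_le_one, le_rfl⟩ zero_le_one
  simp only [hT, hT1, one_mul, zero_mul, add_zero, mul_zero, sub_zero, mul_one, one_pow, ne_eq,
    OfNat.ofNat_ne_zero, not_false_eq_true, zero_pow] at this
  linarith

end LogSumExp

/-! ### Choice probabilities and the log-likelihood of one round -/

namespace Model

variable {d N : ℕ} {X : Type*} [MeasurableSpace X] (mdl : Model d N X)

lemma partition_pos (x : X) (S : Finset (Fin N)) (θ : EuclideanSpace ℝ (Fin d)) :
    0 < 1 + ∑ i ∈ S, Real.exp (inner ℝ (mdl.feat x i) θ) := by positivity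

lemma choiceProb_nonneg (x : X) (S : Finset (Fin N)) (θ : EuclideanSpace ℝ (Fin d))
    (y : Option (Fin N)) : 0 ≤ mdl.choiceProb x S θ y := by
  rcases y with _ | j
  · simp only [choiceProb]; positivity
  · simp only [choiceProb]; split_ifs <;> positivity

lemma sum_choiceProb (x : X) (S : Finset (Fin N)) (θ : EuclideanSpace ℝ (Fin d)) :
    ∑ y, mdl.choiceProb x S θ y = 1 := by
  have h := mdl.partition_pos x S θ
  rw [Fintype.sum_option]
  simp only [choiceProb, Finset.sum_ite_mem, Finset.univ_inter, ← Finset.sum_div]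
  rw [← add_div, div_self h.ne']

lemma rate_eq (x : X) (S : Finset (Fin N)) (θ : EuclideanSpace ℝ (Fin d)) :
    mdl.rate x S θ = (∑ j ∈ S, Real.exp (inner ℝ (mdl.feat x j) θ)) /
      (1 + ∑ j ∈ S, Real.exp (inner ℝ (mdl.feat x j) θ)) := by
  rw [rate, Finset.sum_div]
  exact Finset.sum_congr rfl fun j hj => by simp [choiceProb, hj]

lemma log_choiceProb {x : X} {S : Finset (Fin N)} {y : Option (Fin N)}
    (hy : ∀ j, y = some j → j ∈ S) (θ : EuclideanSpace ℝ (Fin d)) :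
    Real.log (mdl.choiceProb x S θ y) =
      ∑ j ∈ S, (if y = some j then 1 else 0) * inner ℝ (mdl.feat x j) θ -
        Real.log (1 + ∑ i ∈ S, Real.exp (inner ℝ (mdl.feat x i) θ)) := by
  have h := mdl.partition_pos x S θ
  rcases y with _ | j
  · simp [choiceProb, Real.log_inv]
  · have hj := hy j rfl
    simp only [choiceProb, hj, if_true, Option.some.injEq, ite_mul, one_mul, zero_mul,
      Finset.sum_ite_eq, Real.log_div (Real.exp_pos _).ne' h.ne', Real.log_exp]

/-- The log-likelihood is linear in the utilities minus the log-partition function. The second order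
bound applies with `c` a lower bound for `p_j p_0 = exp (u_j) / T ^ 2`, where `T` is the partition
function, on the segment. -/
lemma log_choiceProb_le {x : X} {S : Finset (Fin N)} {y : Option (Fin N)}
    (hy : ∀ j, y = some j → j ∈ S) {θ θ' : EuclideanSpace ℝ (Fin d)} {c : ℝ}
    (hc : ∀ s ∈ Set.Icc (0 : ℝ) 1, ∀ j ∈ S, c ≤
      mdl.choiceProb x S (θ + s • (θ' - θ)) (some j) *
        mdl.choiceProb x S (θ + s • (θ' - θ)) none) :
    Real.log (mdl.choiceProb x S θ' y) ≤ Real.log (mdl.choiceProb x S θ y) +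
      ∑ j ∈ S, ((if y = some j then 1 else 0) - mdl.choiceProb x S θ (some j)) *
        inner ℝ (mdl.feat x j) (θ' - θ) -
      c / 2 * ∑ j ∈ S, (inner ℝ (mdl.feat x j) (θ' - θ)) ^ 2 := by
  have key := log_one_add_sum_exp_ge S (fun j => inner ℝ (mdl.feat x j) θ)
    (fun j => inner ℝ (mdl.feat x j) (θ' - θ)) (c := c) (fun s hs j hj => by
      have := hc s hs j hj
      simp only [choiceProb, hj, if_true, inner_add_right, real_inner_smul_right] at this
      rw [div_mul_div_comm, mul_one, ← sq] at this
      exact this)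
  simp only [← inner_add_right, add_sub_cancel] at key
  rw [mdl.log_choiceProb hy, mdl.log_choiceProb hy]
  have h1 : ∑ j ∈ S, mdl.choiceProb x S θ (some j) * inner ℝ (mdl.feat x j) (θ' - θ) =
      (∑ j ∈ S, inner ℝ (mdl.feat x j) (θ' - θ) * Real.exp (inner ℝ (mdl.feat x j) θ)) /
        (1 + ∑ j ∈ S, Real.exp (inner ℝ (mdl.feat x j) θ)) := by
    rw [Finset.sum_div]
    exact Finset.sum_congr rfl fun j hj => by simp only [choiceProb, hj, if_true]; ring
  have h2 : ∑ j ∈ S, (if y = some j then (1 : ℝ) else 0) * inner ℝ (mdl.feat x j) (θ' - θ) =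
      ∑ j ∈ S, (if y = some j then (1 : ℝ) else 0) * inner ℝ (mdl.feat x j) θ' -
      ∑ j ∈ S, (if y = some j then (1 : ℝ) else 0) * inner ℝ (mdl.feat x j) θ := by
    rw [← Finset.sum_sub_distrib]
    exact Finset.sum_congr rfl fun j hj => by rw [inner_sub_right]; ring
  simp only [sub_mul, Finset.sum_sub_distrib, h1, h2]
  linarith

lemma inner_eq_dotProduct (x y : EuclideanSpace ℝ (Fin d)) : inner ℝ x y = x.ofLp ⬝ᵥ y.ofLp := by
  rw [EuclideanSpace.inner_eq_star_dotProduct, dotProduct_comm]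
  simp

variable {mdl} {K : ℕ} {κ : ℝ}

/-- A product of two probabilities is at most 1. This is used to absorb the regularization term,
which has curvature `lam₀` rather than `lam₀ / κ`. -/
lemma Assumptions.one_le_curvature (h : mdl.Assumptions K κ) (hK : 1 ≤ K) (hKN : K ≤ N)
    (hκ : 0 < κ) : 1 ≤ κ := by
  have := h.isProbabilityMeasure_ctxLaw
  obtain ⟨x⟩ : Nonempty X := nonempty_of_isProbabilityMeasure mdl.ctxLaw
  obtain ⟨S, -, hS⟩ := Finset.exists_subset_card_eq (s := (Finset.univ : Finset (Fin N))) (n := K)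
    (by simpa using hKN)
  obtain ⟨j, hj⟩ := Finset.card_pos.1 (by omega : 0 < S.card)
  have h1 := h.curvature x S hS j hj mdl.θstar h.θstar_mem
  have hle (y : Option (Fin N)) : mdl.choiceProb x S mdl.θstar y ≤ 1 := by
    rw [← mdl.sum_choiceProb x S mdl.θstar]
    exact Finset.single_le_sum (fun y _ => mdl.choiceProb_nonneg x S _ y) (Finset.mem_univ y)
  have h2 := mul_le_one₀ (hle (some j)) (mdl.choiceProb_nonneg x S mdl.θstar none) (hle none)
  exact (div_le_one hκ).1 (h1.trans h2)

end Model

/-! ### Deterministic error of the regularized maximum likelihood estimator -/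

namespace Run

variable {d N K : ℕ} {X Ω : Type*} [MeasurableSpace X]

/-- The assortment offered in round `t`, empty if the queue is. -/
def active (run : Run d N K X Ω) (t : ℕ) (ω : Ω) : Finset (Fin N) :=
  if run.queue t ω = ∅ then ∅ else run.asst t ω

/-- The sum of the rank one terms of the design matrix. -/
noncomputable def gram (mdl : Model d N X) (run : Run d N K X Ω) (t : ℕ) (ω : Ω) :
    Matrix (Fin d) (Fin d) ℝ :=
  ∑ i ∈ Finset.Icc 1 t, ∑ j ∈ run.active i ω,
    vecMulVec (mdl.feat (run.query i ω) j).ofLp (mdl.feat (run.query i ω) j).ofLp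

/-- The sum of the features weighted by the centred choice indicators. -/
noncomputable def noise (mdl : Model d N X) (run : Run d N K X Ω) (t : ℕ) (ω : Ω) : Fin d → ℝ :=
  ∑ i ∈ Finset.Icc 1 t, ∑ j ∈ run.active i ω,
    ((if run.choice i ω = some j then 1 else 0) -
      mdl.choiceProb (run.query i ω) (run.active i ω) mdl.θstar (some j)) •
      (mdl.feat (run.query i ω) j).ofLp

variable {mdl : Model d N X} {run : Run d N K X Ω} {lam₀ κ : ℝ} {t : ℕ} {ω : Ω}

lemma design_eq : run.design mdl lam₀ t ω =
    lam₀ • (1 : Matrix (Fin d) (Fin d) ℝ) + run.gram mdl t ω := by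
  rw [design, gram]
  congr 1
  refine Finset.sum_congr rfl fun i _ => ?_
  rw [active]
  split_ifs <;> rfl

lemma posSemidef_gram : (run.gram mdl t ω).PosSemidef :=
  posSemidef_sum _ fun _ _ => posSemidef_sum _ fun _ _ => posSemidef_vecMulVec _

lemma posDef_design (hlam : 0 < lam₀) : (run.design mdl lam₀ t ω).PosDef := by
  rw [design_eq]
  exact (PosDef.one.smul hlam).add_posSemidef posSemidef_gram

lemma quad_gram (y : Fin d → ℝ) : y ⬝ᵥ run.gram mdl t ω *ᵥ y =
    ∑ i ∈ Finset.Icc 1 t, ∑ j ∈ run.active i ω,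
      ((mdl.feat (run.query i ω) j).ofLp ⬝ᵥ y) ^ 2 := by
  simp only [gram, sum_mulVec, dotProduct_sum, quad_vecMulVec]

lemma quad_design (y : Fin d → ℝ) : y ⬝ᵥ run.design mdl lam₀ t ω *ᵥ y =
    lam₀ * (y ⬝ᵥ y) + y ⬝ᵥ run.gram mdl t ω *ᵥ y := by
  simp [design_eq, add_mulVec, smul_mulVec]

lemma noise_succ (u : Fin d → ℝ) : u ⬝ᵥ run.noise mdl (t + 1) ω =
    u ⬝ᵥ run.noise mdl t ω + ∑ j ∈ run.active (t + 1) ω,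
      ((if run.choice (t + 1) ω = some j then 1 else 0) - mdl.choiceProb (run.query (t + 1) ω)
        (run.active (t + 1) ω) mdl.θstar (some j)) *
        ((mdl.feat (run.query (t + 1) ω) j).ofLp ⬝ᵥ u) := by
  rw [dotProduct_comm u, noise, Finset.sum_Icc_succ_top (by omega), add_dotProduct,
    dotProduct_comm u, noise]
  simp only [sum_dotProduct, smul_dotProduct, smul_eq_mul]

lemma quad_gram_succ (u : Fin d → ℝ) :
    u ⬝ᵥ run.gram mdl (t + 1) ω *ᵥ u = u ⬝ᵥ run.gram mdl t ω *ᵥ u +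
      ∑ j ∈ run.active (t + 1) ω, ((mdl.feat (run.query (t + 1) ω) j).ofLp ⬝ᵥ u) ^ 2 := by
  rw [quad_gram, Finset.sum_Icc_succ_top (by omega), ← quad_gram]

/-- Deterministic error bound for the regularized maximum likelihood estimator. -/
lemma sqrt_quad_error_le (hlam : 0 < lam₀) (hκ : 1 ≤ κ) (hm : mdl.Assumptions K κ)
    (hcard : ∀ i ∈ Finset.Icc 1 t, run.queue i ω ≠ ∅ → (run.asst i ω).card = K)
    (hchoice : ∀ i ∈ Finset.Icc 1 t, run.queue i ω ≠ ∅ →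
      ∀ j, run.choice i ω = some j → j ∈ run.asst i ω)
    (hmem : run.est t ω ∈ mdl.Θ) (hmin : IsMinOn (run.loss mdl lam₀ t ω) mdl.Θ (run.est t ω)) :
    √((run.est t ω - mdl.θstar).ofLp ⬝ᵥ
        run.design mdl lam₀ t ω *ᵥ (run.est t ω - mdl.θstar).ofLp) ≤
      2 * κ * (√(run.noise mdl t ω ⬝ᵥ (run.design mdl lam₀ t ω)⁻¹ *ᵥ run.noise mdl t ω) +
        √lam₀) := by
  set b := run.est t ω - mdl.θstar with hb
  have hV : (run.design mdl lam₀ t ω).PosDef := posDef_design hlam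
  have hle : run.loss mdl lam₀ t ω (run.est t ω) ≤ run.loss mdl lam₀ t ω mdl.θstar :=
    hmin hm.θstar_mem
  have hround : ∀ i ∈ Finset.Icc 1 t,
      (if run.queue i ω = ∅ then 0 else
        Real.log (mdl.choiceProb (run.query i ω) (run.asst i ω) (run.est t ω) (run.choice i ω))) ≤
      (if run.queue i ω = ∅ then 0 else
        Real.log (mdl.choiceProb (run.query i ω) (run.asst i ω) mdl.θstar (run.choice i ω))) +
      ∑ j ∈ run.active i ω, ((if run.choice i ω = some j then 1 else 0) -
        mdl.choiceProb (run.query i ω) (run.active i ω) mdl.θstar (some j)) *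
        ((mdl.feat (run.query i ω) j).ofLp ⬝ᵥ b.ofLp) -
      (1 / κ) / 2 * ∑ j ∈ run.active i ω,
        ((mdl.feat (run.query i ω) j).ofLp ⬝ᵥ b.ofLp) ^ 2 := by
    intro i hi
    rw [active]
    split_ifs with hq
    · simp
    · have := mdl.log_choiceProb_le (x := run.query i ω) (hchoice i hi hq)
        -- The curvature is needed only between `θ*` and the estimator, a segment which convexity
        -- keeps inside `Θ`.
        (θ := mdl.θstar) (θ' := run.est t ω) (c := 1 / κ) (fun s hs j hj =>
          hm.curvature _ _ (hcard i hi hq) j hj _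
            (hm.convex_Θ.add_smul_sub_mem hm.θstar_mem hmem hs))
      simpa only [Model.inner_eq_dotProduct] using this
  have hsum := Finset.sum_le_sum hround
  rw [Finset.sum_sub_distrib, Finset.sum_add_distrib, ← Finset.mul_sum, ← quad_gram] at hsum
  have hnoise : run.noise mdl t ω ⬝ᵥ b.ofLp = ∑ i ∈ Finset.Icc 1 t, ∑ j ∈ run.active i ω,
      ((if run.choice i ω = some j then 1 else 0) -
        mdl.choiceProb (run.query i ω) (run.active i ω) mdl.θstar (some j)) *
        ((mdl.feat (run.query i ω) j).ofLp ⬝ᵥ b.ofLp) := by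
    simp only [noise, sum_dotProduct, smul_dotProduct, smul_eq_mul]
  rw [← hnoise] at hsum
  have hnorm : ‖run.est t ω‖ ^ 2 = ‖mdl.θstar‖ ^ 2 + 2 * (mdl.θstar.ofLp ⬝ᵥ b.ofLp) +
      b.ofLp ⬝ᵥ b.ofLp := by
    rw [← Model.inner_eq_dotProduct, ← Model.inner_eq_dotProduct, ← real_inner_self_eq_norm_sq,
      ← real_inner_self_eq_norm_sq]
    have : run.est t ω = mdl.θstar + b := by simp [hb]
    rw [this, inner_add_left, inner_add_right, inner_add_right, real_inner_comm b]
    ring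
  simp only [loss, hnorm] at hle
  set Q := b.ofLp ⬝ᵥ run.design mdl lam₀ t ω *ᵥ b.ofLp with hQ
  set G := b.ofLp ⬝ᵥ run.gram mdl t ω *ᵥ b.ofLp
  have hQG : Q = lam₀ * (b.ofLp ⬝ᵥ b.ofLp) + G := quad_design _
  have hG0 : 0 ≤ G := quad_nonneg posSemidef_gram _
  have hbb : 0 ≤ b.ofLp ⬝ᵥ b.ofLp := Finset.sum_nonneg fun _ _ => mul_self_nonneg _
  have hQ0 : 0 ≤ Q := quad_nonneg hV.posSemidef _
  have h1 := (le_abs_self _).trans (abs_dotProduct_le hV (run.noise mdl t ω) b.ofLp)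
  rw [← hQ] at h1
  -- The bias of the regularization, paid for with `‖θ*‖ ≤ 1` and `lam₀ ‖b‖² ≤ Q`.
  have h2 : -(lam₀ * (mdl.θstar.ofLp ⬝ᵥ b.ofLp)) ≤ √lam₀ * √Q := by
    have h3 : |mdl.θstar.ofLp ⬝ᵥ b.ofLp| ≤ √(b.ofLp ⬝ᵥ b.ofLp) := by
      have := abs_real_inner_le_norm mdl.θstar b
      rw [← Model.inner_eq_dotProduct, ← Model.inner_eq_dotProduct, real_inner_self_eq_norm_sq,
        Real.sqrt_sq (norm_nonneg _)]
      exact this.trans (mul_le_of_le_one_left (norm_nonneg _) hm.norm_θstar_le)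
    have h4 : √lam₀ * √(b.ofLp ⬝ᵥ b.ofLp) ≤ √Q := by
      rw [← Real.sqrt_mul hlam.le]
      exact Real.sqrt_le_sqrt (by linarith)
    calc -(lam₀ * (mdl.θstar.ofLp ⬝ᵥ b.ofLp)) ≤ lam₀ * |mdl.θstar.ofLp ⬝ᵥ b.ofLp| := by
          nlinarith [neg_abs_le (mdl.θstar.ofLp ⬝ᵥ b.ofLp)]
      _ ≤ lam₀ * √(b.ofLp ⬝ᵥ b.ofLp) := by gcongr
      _ = √lam₀ * (√lam₀ * √(b.ofLp ⬝ᵥ b.ofLp)) := by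
          rw [← mul_assoc, Real.mul_self_sqrt hlam.le]
      _ ≤ √lam₀ * √Q := by gcongr
  have hκ0 : 0 < κ := by linarith
  -- The loss comparison bounds a quadratic in `√Q` by a linear term; cancelling one factor `√Q`
  -- gives the claim. No first order condition is involved, so a minimizer on the boundary of `Θ` is
  -- covered.
  have h5 : 1 / κ / 2 * Q ≤ (√(run.noise mdl t ω ⬝ᵥ (run.design mdl lam₀ t ω)⁻¹ *ᵥ
      run.noise mdl t ω) + √lam₀) * √Q := by
    have h6 : 1 / κ ≤ 1 := by rw [div_le_one hκ0]; exact hκ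
    have h7 : 1 / κ / 2 * (lam₀ * (b.ofLp ⬝ᵥ b.ofLp)) ≤ lam₀ / 2 * (b.ofLp ⬝ᵥ b.ofLp) := by
      nlinarith [mul_nonneg hlam.le hbb]
    rw [add_mul]
    have : 1 / κ / 2 * Q = 1 / κ / 2 * (lam₀ * (b.ofLp ⬝ᵥ b.ofLp)) + 1 / κ / 2 * G := by
      rw [hQG]; ring
    linarith
  rcases (Real.sqrt_nonneg Q).eq_or_lt with h0 | h0
  · rw [← h0]; positivity
  · nth_rewrite 1 [← Real.mul_self_sqrt hQ0] at h5
    rw [← mul_assoc] at h5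
    have h8 := le_of_mul_le_mul_right h5 h0
    rw [div_div, one_div, inv_mul_le_iff₀ (by positivity)] at h8
    linarith

end Run

/-! ### The departure rate as a function of the utilities -/

section RateFunction

variable {ι : Type*}

/-- The departure rate as a function of the utilities. -/
noncomputable def rateOf (S : Finset ι) (u : ι → ℝ) : ℝ :=
  ∑ k ∈ S, Real.exp (u k) / (1 + ∑ j ∈ S, Real.exp (u j))

variable (S : Finset ι) (u v : ι → ℝ)

lemma rateOf_eq : rateOf S u = (∑ k ∈ S, Real.exp (u k)) / (1 + ∑ j ∈ S, Real.exp (u j)) := by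
  rw [rateOf, Finset.sum_div]

lemma rateOf_nonneg : 0 ≤ rateOf S u := by
  rw [rateOf]; positivity

lemma rateOf_le_one : rateOf S u ≤ 1 := by
  rw [rateOf_eq, div_le_one (by positivity)]
  linarith

lemma div_one_add_le_div_one_add {a b : ℝ} (ha : 0 ≤ a) (hab : a ≤ b) :
    a / (1 + a) ≤ b / (1 + b) := by
  rw [div_le_div_iff₀ (by linarith) (by linarith)]
  nlinarith

/-- The rate increases with the sum of the exponentials, and this sum lies above its tangent at `u`.
A single linear inequality thus replaces one inequality per server, which is why the probability of
optimism does not decay with `K`. -/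
lemma rateOf_le_rateOf_of_sum_nonneg
    (h : 0 ≤ ∑ j ∈ S, Real.exp (u j) * (v j - u j)) : rateOf S u ≤ rateOf S v := by
  rw [rateOf_eq, rateOf_eq]
  refine div_one_add_le_div_one_add (by positivity) ?_
  have h1 : ∀ j ∈ S, Real.exp (u j) + Real.exp (u j) * (v j - u j) ≤ Real.exp (v j) := by
    intro j _
    have h2 := Real.add_one_le_exp (v j - u j)
    have h3 : Real.exp (v j) = Real.exp (u j) * Real.exp (v j - u j) := by
      rw [← Real.exp_add]; congr 1; ring
    rw [h3]
    nlinarith [mul_le_mul_of_nonneg_left h2 (Real.exp_pos (u j)).le]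
  have := Finset.sum_le_sum h1
  rw [Finset.sum_add_distrib] at this
  linarith

lemma rateOf_mono (h : ∀ j ∈ S, u j ≤ v j) : rateOf S u ≤ rateOf S v :=
  rateOf_le_rateOf_of_sum_nonneg S u v (Finset.sum_nonneg fun j hj =>
    mul_nonneg (Real.exp_pos _).le (sub_nonneg.2 (h j hj)))

/-- The departure rate is `1`-Lipschitz in the `ℓ¹` distance of the utilities. -/
lemma rateOf_sub_le : rateOf S u - rateOf S v ≤ ∑ j ∈ S, |u j - v j| := by
  set δ := ∑ j ∈ S, |u j - v j| with hδ
  have hδ0 : 0 ≤ δ := Finset.sum_nonneg fun _ _ => abs_nonneg _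
  set T := ∑ j ∈ S, Real.exp (v j) with hT
  have hT0 : 0 ≤ T := Finset.sum_nonneg fun _ _ => (Real.exp_pos _).le
  have h1 : ∑ j ∈ S, Real.exp (u j) ≤ Real.exp δ * T := by
    rw [hT, Finset.mul_sum]
    refine Finset.sum_le_sum fun j hj => ?_
    rw [← Real.exp_add, Real.exp_le_exp]
    have := Finset.single_le_sum (f := fun j => |u j - v j|) (fun _ _ => abs_nonneg _) hj
    simp only [← hδ] at this
    linarith [le_abs_self (u j - v j)]
  have h2 := div_one_add_le_div_one_add (Finset.sum_nonneg fun _ _ => (Real.exp_pos _).le) h1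
  rw [rateOf_eq, rateOf_eq, ← hT]
  have h3 : Real.exp δ * T / (1 + Real.exp δ * T) - T / (1 + T) ≤ δ := by
    have hE := Real.one_le_exp hδ0
    have hE' : 1 - δ ≤ Real.exp (-δ) := by linarith [Real.add_one_le_exp (-δ)]
    have hE2 : Real.exp δ - 1 ≤ δ * Real.exp δ := by
      have : Real.exp δ * Real.exp (-δ) = 1 := by rw [← Real.exp_add]; simp
      nlinarith
    rw [div_sub_div _ _ (by positivity) (by positivity), div_le_iff₀ (by positivity)]
    have h4 : 0 ≤ δ * T * (1 + Real.exp δ * T) := by positivity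
    have h5 : 0 ≤ (δ * Real.exp δ - (Real.exp δ - 1)) * T :=
      mul_nonneg (by linarith) hT0
    nlinarith
  linarith

end RateFunction

lemma Model.rate_eq_rateOf {d N : ℕ} {X : Type*} [MeasurableSpace X] (mdl : Model d N X) (x : X)
    (S : Finset (Fin N)) (θ : EuclideanSpace ℝ (Fin d)) :
    mdl.rate x S θ = rateOf S fun j => inner ℝ (mdl.feat x j) θ := by
  rw [Model.rate_eq, rateOf_eq]

/-- The logarithm in the denominator is nonpositive. Optimism needs just one sample; the actual
value of `M` enters only as a factor in the second moment of the spread. -/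
lemma sampleSize_pos {K : ℕ} (hK : 1 ≤ K) : 0 < sampleSize K := by
  rw [sampleSize, Nat.ceil_pos, sub_pos]
  refine lt_of_le_of_lt (div_nonpos_of_nonneg_of_nonpos
    (Real.log_nonneg (by exact_mod_cast hK)) (Real.log_nonpos ?_ ?_)) zero_lt_one
  · have : 1 ≤ √(Real.exp 1 * Real.pi) := by
      rw [Real.one_le_sqrt]
      nlinarith [Real.add_one_le_exp 1, Real.pi_gt_three]
    rw [sub_nonneg, div_le_one (by positivity)]
    linarith
  · have : 0 ≤ 1 / (4 * √(Real.exp 1 * Real.pi)) := by positivity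
    linarith

/-! ### Gaussian sampling: anti-concentration and second moments -/

section Gaussian

variable {n : ℕ} {V : Matrix (Fin n) (Fin n) ℝ} {a : ℝ}

lemma posSemidef_smul_inv (hV : V.PosDef) (a : ℝ) : (a ^ 2 • V⁻¹).PosSemidef :=
  hV.inv.posSemidef.smul (sq_nonneg a)

lemma map_inner_multivariateGaussian {S : Matrix (Fin n) (Fin n) ℝ} (hS : S.PosSemidef)
    (μ v : EuclideanSpace ℝ (Fin n)) :
    (multivariateGaussian μ S).map (fun x => inner ℝ v x) =
      gaussianReal (inner ℝ v μ) (v.ofLp ⬝ᵥ S *ᵥ v.ofLp).toNNReal := by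
  have h := IsGaussian.map_eq_gaussianReal (μ := multivariateGaussian μ S) (innerSL ℝ v)
  have h1 : ∫ x, (innerSL ℝ v) x ∂multivariateGaussian μ S = inner ℝ v μ := by
    rw [ContinuousLinearMap.integral_comp_id_comm, integral_id_multivariateGaussian]
    · rfl
    · exact IsGaussian.integrable_id
  have h2 : Var[innerSL ℝ v; multivariateGaussian μ S] = v.ofLp ⬝ᵥ S *ᵥ v.ofLp := by
    rw [← covarianceBilin_multivariateGaussian (μ := μ) hS,
      covarianceBilin_self IsGaussian.memLp_two_id]
    rfl
  rw [h1, h2] at h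
  exact h

/-- The probability that a standard Gaussian exceeds `4`. -/
noncomputable def optimismProb : ℝ := (gaussianReal 0 1).real (Set.Ici 4)

lemma optimismProb_pos : 0 < optimismProb := by
  have h0 : gaussianReal 0 1 (Set.Ici 4) ≠ 0 := by
    intro h1
    have h2 := (gaussianReal_absolutelyContinuous' 0 (v := 1) one_ne_zero) h1
    simp at h2
  exact ENNReal.toReal_pos h0 (measure_ne_top _ _)

/-- Anti-concentration of the Gaussian samples. -/
lemma optimismProb_le (hV : V.PosDef) (ha : 0 < a) (μ θ v : EuclideanSpace ℝ (Fin n))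
    (h : √((μ - θ).ofLp ⬝ᵥ V *ᵥ (μ - θ).ofLp) ≤ 4 * a) :
    optimismProb ≤ (multivariateGaussian μ (a ^ 2 • V⁻¹)).real {x | 0 ≤ inner ℝ v (x - θ)} := by
  set s := √(v.ofLp ⬝ᵥ V⁻¹ *ᵥ v.ofLp) with hs
  have hs2 : s ^ 2 = v.ofLp ⬝ᵥ V⁻¹ *ᵥ v.ofLp := Real.sq_sqrt (quad_inv_nonneg hV _)
  have hmap := map_inner_multivariateGaussian (posSemidef_smul_inv hV a) μ v
  have hvar : (v.ofLp ⬝ᵥ (a ^ 2 • V⁻¹) *ᵥ v.ofLp).toNNReal =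
      NNReal.mk ((a * s) ^ 2) (sq_nonneg _) * 1 := by
    ext
    simp only [smul_mulVec, dotProduct_smul, smul_eq_mul, ← hs2]
    rw [← mul_pow, Real.coe_toNNReal _ (sq_nonneg _)]
    simp
  have hstd := gaussianReal_map_const_mul (μ := 0) (v := 1) (a * s)
  rw [hvar] at hmap
  rw [mul_zero] at hstd
  -- The marginal is written as an affine image of the standard Gaussian, so the degenerate case `s
  -- = 0` needs no separate treatment.
  have hadd : gaussianReal (inner ℝ v μ) (NNReal.mk ((a * s) ^ 2) (sq_nonneg _) * 1) =
      (gaussianReal 0 1).map (fun x => a * s * x + inner ℝ v μ) := by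
    rw [← zero_add (inner ℝ v μ), ← gaussianReal_map_add_const, ← hstd,
      Measure.map_map (by fun_prop) (by fun_prop)]
    simp [Function.comp_def]
  rw [hadd] at hmap
  have hset : {x : EuclideanSpace ℝ (Fin n) | 0 ≤ inner ℝ v (x - θ)} =
      (fun x => inner ℝ v x) ⁻¹' (Set.Ici (inner ℝ v θ)) := by
    ext x; simp [inner_sub_right]
  rw [hset, ← map_measureReal_apply (by fun_prop) measurableSet_Ici, hmap,
    map_measureReal_apply (by fun_prop) measurableSet_Ici, optimismProb]
  refine measureReal_mono fun x hx => ?_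
  -- The target `inner ℝ v θ` is at most `4 a s` above the mean, that is, at most four standard
  -- deviations.
  have h1 := (abs_le.1 (abs_dotProduct_le hV v.ofLp (μ - θ).ofLp)).1
  rw [← hs, ← Model.inner_eq_dotProduct v (μ - θ), inner_sub_right] at h1
  have hs0 : 0 ≤ s := Real.sqrt_nonneg _
  have h2 := mul_le_mul_of_nonneg_left h hs0
  have h3 := mul_le_mul_of_nonneg_left (Set.mem_Ici.1 hx) (mul_nonneg ha.le hs0)
  simp only [Set.mem_preimage, Set.mem_Ici]
  linarith

/-- The mean squared `V`-distance of `N(μ, a² V⁻¹)` from its centre. -/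
lemma lintegral_quad_multivariateGaussian (hV : V.PosDef) (a : ℝ)
    (μ : EuclideanSpace ℝ (Fin n)) :
    ∫⁻ x, ENNReal.ofReal ((x - μ).ofLp ⬝ᵥ V *ᵥ (x - μ).ofLp)
        ∂multivariateGaussian μ (a ^ 2 • V⁻¹) = ENNReal.ofReal (a ^ 2 * n) := by
  set G := multivariateGaussian μ (a ^ 2 • V⁻¹) with hG
  have hL2 (i : Fin n) : MemLp (fun x : EuclideanSpace ℝ (Fin n) => (x - μ) i) 2 G := by
    have h1 : MemLp (fun x : EuclideanSpace ℝ (Fin n) => x i) 2 G :=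
      (IsGaussian.memLp_two_id (μ := G)).eval_piLp i
    exact h1.sub (memLp_const (μ i))
  have hint (i j : Fin n) :
      Integrable (fun x : EuclideanSpace ℝ (Fin n) => (x - μ) i * (x - μ) j) G :=
    (hL2 i).integrable_mul (hL2 j)
  have hmean (i : Fin n) : ∫ x, x i ∂G = μ i := by
    have := ContinuousLinearMap.integral_comp_id_comm (μ := G)
      (IsGaussian.integrable_id) (EuclideanSpace.proj i : EuclideanSpace ℝ (Fin n) →L[ℝ] ℝ)
    simpa [hG] using this
  have hcov (i j : Fin n) : ∫ x, (x - μ) i * (x - μ) j ∂G = a ^ 2 * V⁻¹ i j := by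
    have := covariance_eval_multivariateGaussian (μ := μ) (posSemidef_smul_inv hV a) i j
    rw [covariance, ← hG, hmean, hmean] at this
    simpa using this
  have hquad (x : EuclideanSpace ℝ (Fin n)) : (x - μ).ofLp ⬝ᵥ V *ᵥ (x - μ).ofLp =
      ∑ i, ∑ j, V i j * ((x - μ) i * (x - μ) j) := by
    simp only [dotProduct, mulVec, Finset.mul_sum]
    exact Finset.sum_congr rfl fun i _ => Finset.sum_congr rfl fun j _ => by ring
  have hint2 : Integrable (fun x : EuclideanSpace ℝ (Fin n) =>
      (x - μ).ofLp ⬝ᵥ V *ᵥ (x - μ).ofLp) G := by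
    simp only [hquad]
    exact integrable_finsetSum _ fun i _ => integrable_finsetSum _ fun j _ =>
      (hint i j).const_mul _
  rw [← ofReal_integral_eq_lintegral_ofReal hint2
    (Filter.Eventually.of_forall fun x => quad_nonneg hV.posSemidef _)]
  congr 1
  simp only [hquad]
  have hint3 (i : Fin n) : Integrable (fun x : EuclideanSpace ℝ (Fin n) =>
      ∑ j, V i j * ((x - μ) i * (x - μ) j)) G :=
    integrable_finsetSum _ fun j _ => (hint i j).const_mul _
  refine (integral_finsetSum _ fun i _ => hint3 i).trans ?_
  -- The mean is `a² tr (V V⁻¹) = a² n`: the spread pays one dimension factor.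
  have htr : (V * V⁻¹).trace = n := by
    rw [mul_nonsing_inv _ hV.det_pos.ne'.isUnit, trace_one, Fintype.card_fin]
  rw [← htr, trace, Finset.mul_sum]
  refine Finset.sum_congr rfl fun i _ => ?_
  refine (integral_finsetSum _ fun j _ => (hint i j).const_mul _).trans ?_
  rw [diag_apply, mul_apply, Finset.mul_sum]
  refine Finset.sum_congr rfl fun j _ => ?_
  have hsymm : V⁻¹ i j = V⁻¹ j i := by
    have := hV.inv.isHermitian.apply i j
    simpa using this.symm
  rw [integral_const_mul, hcov, hsymm]
  ring

end Gaussian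

/-! ### Regular conditional laws and the cost of optimism -/

section ConditionalLaw

variable {Ω β E : Type*} [MeasurableSpace Ω] [mβ : MeasurableSpace β] [MeasurableSpace E]
  {P : Measure Ω}

/-- Two families of probability measures which a.e. agree on each measurable set agree a.e. -/
lemma ae_eq_of_forall_measurableSet [MeasurableSpace.CountablyGenerated E]
    {κ ν : Ω → Measure E} [∀ ω, IsProbabilityMeasure (κ ω)] [∀ ω, IsProbabilityMeasure (ν ω)]
    {H : Set Ω}
    (h : ∀ B, MeasurableSet B → ∀ᵐ ω ∂P, ω ∈ H → (κ ω).real B = (ν ω).real B) :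
    ∀ᵐ ω ∂P, ω ∈ H → κ ω = ν ω := by
  -- The exceptional null set depends on the measurable set, so agreement is collected on a
  -- countable generating algebra, a π-system that determines a finite measure.
  set C := generateSetAlgebra (MeasurableSpace.countableGeneratingSet E) with hC
  have hCc : C.Countable :=
    countable_generateSetAlgebra (MeasurableSpace.countable_countableGeneratingSet)
  have hgen : ‹MeasurableSpace E› = MeasurableSpace.generateFrom C := by
    rw [hC, generateFrom_generateSetAlgebra_eq,
      MeasurableSpace.generateFrom_countableGeneratingSet]
  have hpi : IsPiSystem C := fun s hs t ht _ => isSetAlgebra_generateSetAlgebra.inter_mem hs ht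
  have hall : ∀ᵐ ω ∂P, ∀ B ∈ C, ω ∈ H → (κ ω).real B = (ν ω).real B := by
    rw [ae_ball_iff hCc]
    intro B hB
    exact h B (by rw [hgen]; exact MeasurableSpace.measurableSet_generateFrom hB)
  filter_upwards [hall] with ω hω hH
  refine ext_of_generate_finite C hgen hpi (fun B hB => ?_) (by simp)
  exact (measureReal_eq_measureReal_iff).1 (hω B hB hH)

variable [StandardBorelSpace E] [Nonempty E] [IsProbabilityMeasure P] {X : Ω → β} {Y : Ω → E}

lemma ae_condDistrib_eq (hX : Measurable X) (hY : Measurable Y) {ν : Ω → Measure E}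
    [∀ ω, IsProbabilityMeasure (ν ω)] {H : Set Ω}
    (h : ∀ B, MeasurableSet B → ∀ᵐ ω ∂P, ω ∈ H → (P⟦Y ⁻¹' B | mβ.comap X⟧) ω = (ν ω).real B) :
    ∀ᵐ ω ∂P, ω ∈ H → condDistrib Y X P (X ω) = ν ω := by
  refine ae_eq_of_forall_measurableSet fun B hB => ?_
  filter_upwards [h B hB, condDistrib_ae_eq_condExp hX hY hB] with ω h1 h2 hω
  rw [← h1 hω, ← h2]

lemma lintegral_comp_prodMk (hX : Measurable X) (hY : Measurable Y) {f : β × E → ENNReal}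
    (hf : Measurable f) :
    ∫⁻ ω, f (X ω, Y ω) ∂P = ∫⁻ ω, ∫⁻ y, f (X ω, y) ∂condDistrib Y X P (X ω) ∂P := by
  rw [← lintegral_map hf (hX.prodMk hY), ← compProd_map_condDistrib hY.aemeasurable,
    Measure.lintegral_compProd hf, lintegral_map hf.lintegral_kernel_prod_right' hX]

lemma integral_comp_prodMk (hX : Measurable X) (hY : Measurable Y) {f : β × E → ℝ}
    (hf : Measurable f) {c : ℝ} (hc : ∀ p, |f p| ≤ c) :
    ∫ ω, f (X ω, Y ω) ∂P = ∫ ω, ∫ y, f (X ω, y) ∂condDistrib Y X P (X ω) ∂P := by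
  have hXY := hX.prodMk hY
  have hprob : IsProbabilityMeasure (P.map fun ω => (X ω, Y ω)) :=
    Measure.isProbabilityMeasure_map hXY.aemeasurable
  have hint : Integrable f (P.map fun ω => (X ω, Y ω)) :=
    Integrable.of_bound hf.aestronglyMeasurable c (Filter.Eventually.of_forall hc)
  rw [← integral_map hXY.aemeasurable hf.aestronglyMeasurable]
  rw [← compProd_map_condDistrib hY.aemeasurable] at hint ⊢
  rw [Measure.integral_compProd hint, integral_map hX.aemeasurable
    hf.stronglyMeasurable.integral_kernel_prod_right'.aestronglyMeasurable]

/-- Comparison of an optimistic value with its target: if the value `φ (X, Y)` reaches `R X` with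
conditional probability at least `q`, and exceeds its conditional mean by at most `U`, then its
expected shortfall is at most `E[U] / q`. -/
lemma mul_setIntegral_sub_le (hX : Measurable X) (hY : Measurable Y) {H : Set β}
    (hH : MeasurableSet H) {φ : β × E → ℝ} (hφ : Measurable φ) (hφ0 : ∀ p, 0 ≤ φ p)
    (hφ1 : ∀ p, φ p ≤ 1) {R : β → ℝ} (hR : Measurable R) (hR0 : ∀ b, 0 ≤ R b) (hR1 : ∀ b, R b ≤ 1)
    {U : Ω → ℝ} (hU : IntegrableOn U (X ⁻¹' H) P) (hU0 : ∀ ω, 0 ≤ U ω) {q : ℝ}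
    (hq : ∀ᵐ ω ∂P, X ω ∈ H → q ≤ (condDistrib Y X P (X ω)).real {y | R (X ω) ≤ φ (X ω, y)})
    (hq0 : 0 ≤ q)
    (hle : ∀ᵐ ω ∂P, X ω ∈ H →
      φ (X ω, Y ω) - U ω ≤ ∫ y, φ (X ω, y) ∂condDistrib Y X P (X ω)) :
    q * ∫ ω in X ⁻¹' H, (R (X ω) - φ (X ω, Y ω)) ∂P ≤ ∫ ω in X ⁻¹' H, U ω ∂P := by
  set κ := condDistrib Y X P
  set Fb : β → ℝ := fun b => ∫ y, φ (b, y) ∂κ b with hFb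
  have hFbm : Measurable Fb := hφ.stronglyMeasurable.integral_kernel_prod_right'.measurable
  have hFb0 (b : β) : 0 ≤ Fb b := integral_nonneg fun y => hφ0 _
  have hFb1 (b : β) : Fb b ≤ 1 := by
    have := integral_mono_of_nonneg (μ := κ b) (f := fun y => φ (b, y)) (g := fun _ => (1 : ℝ))
      (Filter.Eventually.of_forall fun y => hφ0 _) (integrable_const _)
      (Filter.Eventually.of_forall fun y => hφ1 _)
    simpa using this
  have hXH : MeasurableSet (X ⁻¹' H) := hX hH
  have hint {f : Ω → ℝ} (hf : Measurable f) (h0 : ∀ ω, 0 ≤ f ω) (h1 : ∀ ω, f ω ≤ 1)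
      {μ : Measure Ω} [IsFiniteMeasure μ] : Integrable f μ :=
    Integrable.of_bound hf.aestronglyMeasurable 1 (Filter.Eventually.of_forall fun ω => by
      rw [Real.norm_of_nonneg (h0 ω)]; exact h1 ω)
  have hφi : Integrable (fun ω => φ (X ω, Y ω)) (P.restrict (X ⁻¹' H)) :=
    hint (hφ.comp (hX.prodMk hY)) (fun ω => hφ0 _) (fun ω => hφ1 _)
  have hRi : Integrable (fun ω => R (X ω)) (P.restrict (X ⁻¹' H)) :=
    hint (hR.comp hX) (fun ω => hR0 _) (fun ω => hR1 _)
  have hFbi : Integrable (fun ω => Fb (X ω)) (P.restrict (X ⁻¹' H)) :=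
    hint (hFbm.comp hX) (fun ω => hFb0 _) (fun ω => hFb1 _)
  have hmean : ∫ ω in X ⁻¹' H, φ (X ω, Y ω) ∂P = ∫ ω in X ⁻¹' H, Fb (X ω) ∂P := by
    have h := integral_comp_prodMk (P := P) hX hY (f := (Prod.fst ⁻¹' H).indicator φ)
      (hφ.indicator (measurable_fst hH)) (c := 1) (fun p => by
        by_cases hp : p ∈ Prod.fst ⁻¹' H
        · rw [Set.indicator_of_mem hp, abs_of_nonneg (hφ0 _)]; exact hφ1 _
        · rw [Set.indicator_of_notMem hp]; simp)
    rw [← integral_indicator hXH, ← integral_indicator hXH]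
    refine h.trans (integral_congr_ae (Filter.Eventually.of_forall fun ω => ?_))
    by_cases hω : X ω ∈ H
    · refine Eq.trans ?_ (Set.indicator_of_mem (s := X ⁻¹' H) hω _).symm
      refine integral_congr_ae (Filter.Eventually.of_forall fun y => ?_)
      exact Set.indicator_of_mem (s := Prod.fst ⁻¹' H) (a := (X ω, y)) hω φ
    · refine Eq.trans ?_ (Set.indicator_of_notMem (s := X ⁻¹' H) hω _).symm
      rw [← integral_zero E ℝ (μ := κ (X ω))]
      refine integral_congr_ae (Filter.Eventually.of_forall fun y => ?_)
      exact Set.indicator_of_notMem (s := Prod.fst ⁻¹' H) (a := (X ω, y)) hω φ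
  -- The positive part of the gap between the target and the conditional mean. It depends on `X`
  -- alone, hence restricting to the optimistic event `O` below keeps at least a fraction `q` of its
  -- integral.
  set g : β → ℝ := fun b => max (R b - Fb b) 0
  have hgm : Measurable g := (hR.sub hFbm).max measurable_const
  have hg0 (b : β) : 0 ≤ g b := le_max_right _ _
  have hg1 (b : β) : g b ≤ 1 := max_le (by linarith [hR1 b, hFb0 b]) zero_le_one
  have hgi : Integrable (fun ω => g (X ω)) (P.restrict (X ⁻¹' H)) :=
    hint (hgm.comp hX) (fun ω => hg0 _) (fun ω => hg1 _)
  set O : Set (β × E) := {p | p.1 ∈ H ∧ R p.1 ≤ φ p}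
  have hOm : MeasurableSet O :=
    (measurable_fst hH).inter (measurableSet_le (hR.comp measurable_fst) hφ)
  have hbd (p : β × E) : |O.indicator (fun p => g p.1) p| ≤ 1 := by
    by_cases hp : p ∈ O
    · rw [Set.indicator_of_mem hp, abs_of_nonneg (hg0 _)]; exact hg1 _
    · rw [Set.indicator_of_notMem hp]; simp
  have hOi := (hgm.comp measurable_fst).indicator (f := fun p : β × E => g p.1) hOm
  have hopt := integral_comp_prodMk (P := P) hX hY hOi hbd
  have hleft : q * ∫ ω in X ⁻¹' H, g (X ω) ∂P ≤
      ∫ ω, ∫ y, O.indicator (fun p => g p.1) (X ω, y) ∂κ (X ω) ∂P := by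
    rw [← integral_const_mul, ← integral_indicator hXH]
    refine integral_mono_ae (IntegrableOn.integrable_indicator (hgi.const_mul q) hXH) ?_ ?_
    · refine hint (hOi.stronglyMeasurable.integral_kernel_prod_right'.measurable.comp hX)
        (fun ω => integral_nonneg fun y => Set.indicator_nonneg (fun p _ => hg0 _) _) fun ω => ?_
      refine (le_abs_self _).trans ?_
      have := norm_integral_le_of_norm_le_const (μ := κ (X ω)) (C := 1)
        (f := fun y => O.indicator (fun p => g p.1) (X ω, y))
        (Filter.Eventually.of_forall fun y => hbd _)
      simpa using this
    · filter_upwards [hq] with ω hω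
      by_cases hXω : X ω ∈ H
      · have h1 : ω ∈ X ⁻¹' H := hXω
        rw [Set.indicator_of_mem h1]
        have h2 : (fun y => O.indicator (fun p => g p.1) (X ω, y)) =
            {y | R (X ω) ≤ φ (X ω, y)}.indicator fun _ => g (X ω) := by
          funext y
          by_cases hy : R (X ω) ≤ φ (X ω, y)
          · rw [Set.indicator_of_mem (show (X ω, y) ∈ O from ⟨hXω, hy⟩),
              Set.indicator_of_mem (show y ∈ {y | R (X ω) ≤ φ (X ω, y)} from hy)]
          · rw [Set.indicator_of_notMem (show (X ω, y) ∉ O from fun h => hy h.2),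
              Set.indicator_of_notMem (show y ∉ {y | R (X ω) ≤ φ (X ω, y)} from hy)]
        have h3 : MeasurableSet {y | R (X ω) ≤ φ (X ω, y)} :=
          measurableSet_le measurable_const (hφ.comp measurable_prodMk_left)
        rw [h2, integral_indicator_const _ h3, smul_eq_mul]
        exact mul_le_mul_of_nonneg_right (hω hXω) (hg0 _)
      · have h1 : ω ∉ X ⁻¹' H := hXω
        rw [Set.indicator_of_notMem h1]
        exact integral_nonneg fun y => Set.indicator_nonneg (fun p _ => hg0 _) _
  -- On `O`, `R ≤ φ` gives `R - Fb ≤ φ - Fb ≤ U`: the gap is paid by the upward deviation of `φ`.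
  have hright : ∫ ω, O.indicator (fun p => g p.1) (X ω, Y ω) ∂P ≤ ∫ ω in X ⁻¹' H, U ω ∂P := by
    rw [← integral_indicator hXH]
    refine integral_mono_ae (hint (hOi.comp (hX.prodMk hY)) (fun ω =>
      Set.indicator_nonneg (fun p _ => hg0 _) _) fun ω => (le_abs_self _).trans (hbd _))
      (hU.integrable_indicator hXH) ?_
    filter_upwards [hle] with ω hω
    by_cases hp : (X ω, Y ω) ∈ O
    · have h1 : ω ∈ X ⁻¹' H := hp.1
      rw [Set.indicator_of_mem hp, Set.indicator_of_mem h1]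
      refine max_le ?_ (hU0 ω)
      have := hω hp.1
      have h2 : R (X ω) ≤ φ (X ω, Y ω) := hp.2
      simp only [hFb]
      linarith
    · rw [Set.indicator_of_notMem hp]
      exact Set.indicator_nonneg (fun ω _ => hU0 ω) _
  rw [integral_sub hRi hφi, hmean, ← integral_sub hRi hFbi]
  calc q * ∫ ω in X ⁻¹' H, (R (X ω) - Fb (X ω)) ∂P
      ≤ q * ∫ ω in X ⁻¹' H, g (X ω) ∂P :=
        mul_le_mul_of_nonneg_left (integral_mono (hRi.sub hFbi) hgi fun ω => le_max_left _ _) hq0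
    _ ≤ _ := hleft
    _ ≤ _ := hopt.symm.le.trans hright

end ConditionalLaw

/-! ### Measurability of maxima over random finite sets -/

section MeasurableCases

variable {A B ι : Type*} {mA : MeasurableSpace A} [MeasurableSpace B]

/-- A function which agrees with a measurable function on each piece of a countable measurable
partition is measurable. -/
lemma measurable_of_countable_cases [Countable ι] {c : A → ι}
    (hc : ∀ i, MeasurableSet {a | c a = i}) {f : A → B} {g : ι → A → B}
    (hg : ∀ a, Measurable (g (c a))) (hfg : ∀ a, f a = g (c a) a) : Measurable f := by
  intro s hs
  have : f ⁻¹' s = ⋃ i, {a | c a = i} ∩ f ⁻¹' s := by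
    ext a; simp
  rw [this]
  refine MeasurableSet.iUnion fun i => ?_
  by_cases hi : ∃ a, c a = i
  · obtain ⟨a, rfl⟩ := hi
    have : {a' | c a' = c a} ∩ f ⁻¹' s = {a' | c a' = c a} ∩ g (c a) ⁻¹' s := by
      ext a'
      simp only [Set.mem_inter_iff, Set.mem_ofPred_eq, Set.mem_preimage]
      refine and_congr_right fun h => ?_
      rw [hfg a', h]
    rw [this]
    exact (hc _).inter (hg a hs)
  · push Not at hi
    have : {a | c a = i} = ∅ := by
      ext a; simpa using hi a
    simp [this]

variable {N : ℕ}

/-- The largest value of `g q S` for a query `q` of `Q` and an assortment `S` of size `K`. -/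
noncomputable def maxOver (K : ℕ) (Q : Finset ℤ) (g : ℤ → Finset (Fin N) → ℝ) : ℝ :=
  sSup {r | ∃ q ∈ Q, ∃ S : Finset (Fin N), S.card = K ∧ r = g q S}

lemma maxOver_set_eq (K : ℕ) (Q : Finset ℤ) (g : ℤ → Finset (Fin N) → ℝ) :
    {r | ∃ q ∈ Q, ∃ S : Finset (Fin N), S.card = K ∧ r = g q S} =
      (fun p : ℤ × Finset (Fin N) => g p.1 p.2) ''
        ((Q ×ˢ (Finset.univ.powersetCard K) : Finset (ℤ × Finset (Fin N))) : Set _) := by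
  ext r
  simp only [Set.mem_image, Set.mem_ofPred_eq, Finset.mem_coe,
    Finset.mem_product, Finset.mem_powersetCard, Finset.subset_univ, true_and, Prod.exists]
  constructor
  · rintro ⟨q, hq, S, hS, rfl⟩
    exact ⟨q, S, ⟨hq, hS⟩, rfl⟩
  · rintro ⟨q, S, ⟨hq, hS⟩, rfl⟩
    exact ⟨q, hq, S, hS, rfl⟩

lemma maxOver_set_finite (K : ℕ) (Q : Finset ℤ) (g : ℤ → Finset (Fin N) → ℝ) :
    {r | ∃ q ∈ Q, ∃ S : Finset (Fin N), S.card = K ∧ r = g q S}.Finite := by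
  rw [maxOver_set_eq]
  exact (Finset.finite_toSet _).image _

lemma le_maxOver {K : ℕ} {Q : Finset ℤ} (g : ℤ → Finset (Fin N) → ℝ) {q : ℤ} (hq : q ∈ Q)
    {S : Finset (Fin N)} (hS : S.card = K) : g q S ≤ maxOver K Q g :=
  le_csSup (maxOver_set_finite K Q g).bddAbove ⟨q, hq, S, hS, rfl⟩

lemma exists_eq_maxOver {K : ℕ} (hKN : K ≤ N) {Q : Finset ℤ} (hQ : Q.Nonempty)
    (g : ℤ → Finset (Fin N) → ℝ) :
    ∃ q ∈ Q, ∃ S : Finset (Fin N), S.card = K ∧ maxOver K Q g = g q S := by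
  obtain ⟨q, hq⟩ := hQ
  obtain ⟨S, -, hS⟩ := Finset.exists_subset_card_eq (s := (Finset.univ : Finset (Fin N))) (n := K)
    (by simpa using hKN)
  have hne : {r | ∃ q ∈ Q, ∃ S : Finset (Fin N), S.card = K ∧ r = g q S}.Nonempty :=
    ⟨_, q, hq, S, hS, rfl⟩
  exact hne.csSup_mem (maxOver_set_finite K Q g)

lemma maxOver_nonneg {K : ℕ} {Q : Finset ℤ} {g : ℤ → Finset (Fin N) → ℝ} (h : ∀ q S, 0 ≤ g q S) :
    0 ≤ maxOver K Q g :=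
  Real.sSup_nonneg (by rintro r ⟨q, -, S, -, rfl⟩; exact h q S)

lemma maxOver_le {K : ℕ} {Q : Finset ℤ} {g : ℤ → Finset (Fin N) → ℝ} {c : ℝ} (hc : 0 ≤ c)
    (h : ∀ q ∈ Q, ∀ S : Finset (Fin N), S.card = K → g q S ≤ c) : maxOver K Q g ≤ c :=
  Real.sSup_le (by rintro r ⟨q, hq, S, hS, rfl⟩; exact h q hq S hS) hc

lemma measurable_maxOver (K : ℕ) {Q : A → Finset ℤ} (hQ : ∀ q, MeasurableSet {a | Q a = q})
    {g : ℤ → Finset (Fin N) → A → ℝ} (hg : ∀ a, ∀ q ∈ Q a, ∀ S, Measurable (g q S)) :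
    Measurable fun a => maxOver K (Q a) fun q S => g q S a := by
  refine measurable_of_countable_cases hQ (g := fun q a => maxOver K q fun q S => g q S a)
    (fun a => ?_) fun a => rfl
  simp only [maxOver, maxOver_set_eq]
  set T := Q a ×ˢ (Finset.univ : Finset (Fin N)).powersetCard K
  by_cases hTe : T.Nonempty
  · have := Finset.measurable_sup' (δ := A) hTe (f := fun (p : ℤ × Finset (Fin N)) a => g p.1 p.2 a)
      fun p hp => hg a p.1 (Finset.mem_product.1 hp).1 p.2
    convert this using 1
    ext a'
    rw [Finset.sup'_apply, Finset.sup'_eq_csSup_image]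
  · rw [Finset.not_nonempty_iff_eq_empty] at hTe
    simp [hTe]

end MeasurableCases

lemma Model.bestRateQueue_eq {d N : ℕ} {X : Type*} [MeasurableSpace X] (mdl : Model d N X)
    (K : ℕ) (ctx : ℤ → X) (Q : Finset ℤ) : mdl.bestRateQueue K ctx Q =
      maxOver K Q fun q S => mdl.rate (ctx q) S mdl.θstar := rfl

lemma Model.bestRate_eq {d N : ℕ} {X : Type*} [MeasurableSpace X] (mdl : Model d N X)
    (K : ℕ) (x : X) : mdl.bestRate K x = maxOver K {0} fun _ S => mdl.rate x S mdl.θstar := by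
  simp [bestRate, maxOver]

lemma Model.measurable_choiceProb {d N : ℕ} {X : Type*} [MeasurableSpace X] {mdl : Model d N X}
    {K : ℕ} {κ : ℝ} (hm : mdl.Assumptions K κ) (S : Finset (Fin N)) (θ : EuclideanSpace ℝ (Fin d))
    (y : Option (Fin N)) : Measurable fun x => mdl.choiceProb x S θ y := by
  have h (j : Fin N) : Measurable fun x => inner ℝ (mdl.feat x j) θ :=
    (hm.measurable_feat j).inner_const
  rcases y with _ | j
  · simp only [choiceProb]; fun_prop
  · simp only [choiceProb]
    split_ifs <;> fun_prop

lemma Model.measurable_rate {d N : ℕ} {X : Type*} [MeasurableSpace X] {mdl : Model d N X}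
    {K : ℕ} {κ : ℝ} (hm : mdl.Assumptions K κ) (S : Finset (Fin N))
    (θ : EuclideanSpace ℝ (Fin d)) : Measurable fun x => mdl.rate x S θ :=
  Finset.measurable_sum _ fun _ _ => measurable_choiceProb hm S θ _

lemma Model.measurable_bestRate {d N : ℕ} {X : Type*} [MeasurableSpace X] {mdl : Model d N X}
    {K : ℕ} {κ : ℝ} (hm : mdl.Assumptions K κ) : Measurable fun x => mdl.bestRate K x := by
  simp only [bestRate_eq]
  exact measurable_maxOver K (Q := fun _ => {0}) (fun q => by simp) fun _ _ _ S =>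
    measurable_rate hm S _

lemma Model.rate_nonneg {d N : ℕ} {X : Type*} [MeasurableSpace X] (mdl : Model d N X) (x : X)
    (S : Finset (Fin N)) (θ : EuclideanSpace ℝ (Fin d)) : 0 ≤ mdl.rate x S θ := by
  rw [rate_eq_rateOf]; exact rateOf_nonneg _ _

lemma Model.rate_le_one {d N : ℕ} {X : Type*} [MeasurableSpace X] (mdl : Model d N X) (x : X)
    (S : Finset (Fin N)) (θ : EuclideanSpace ℝ (Fin d)) : mdl.rate x S θ ≤ 1 := by
  rw [rate_eq_rateOf]; exact rateOf_le_one _ _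

/-- The inverse is the adjugate divided by the determinant; with `0⁻¹ = 0` no invertibility is
needed. -/
lemma measurable_inv_apply {n : ℕ} {A : Type*} [MeasurableSpace A]
    {V : A → Matrix (Fin n) (Fin n) ℝ} (hV : ∀ i j, Measurable fun a => V a i j) (i j : Fin n) :
    Measurable fun a => (V a)⁻¹ i j := by
  have hV' : Measurable fun a => (fun i j => V a i j : Fin n → Fin n → ℝ) :=
    measurable_pi_lambda _ fun i => measurable_pi_lambda _ fun j => hV i j
  have h1 : Continuous fun M : Fin n → Fin n → ℝ => (Matrix.of M).det :=
    Continuous.matrix_det (A := fun M : Fin n → Fin n → ℝ => Matrix.of M) continuous_id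
  have h2 : Continuous fun M : Fin n → Fin n → ℝ => (Matrix.of M).adjugate i j :=
    (Continuous.matrix_adjugate (A := fun M : Fin n → Fin n → ℝ => Matrix.of M)
      continuous_id).matrix_elem i j
  simp only [inv_def, Ring.inverse_eq_inv', Matrix.smul_apply, smul_eq_mul]
  exact (h1.measurable.comp hV').inv.mul (h2.measurable.comp hV')

/-! ### Structure of the queue and measurability along a run -/

namespace Run.IsACQB

variable {d N K : ℕ} {X Ω : Type*} [MeasurableSpace X] [mΩ : MeasurableSpace Ω] {P : Measure Ω}
  {mdl : Model d N X} {κ lam₀ c₁ : ℝ} {enum : ℕ → Finset (Fin N)} {run : Run d N K X Ω}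

section

variable (h : run.IsACQB P mdl κ lam₀ c₁ enum) {t : ℕ} (ht : 1 ≤ t)
include h ht

/-- Contexts are measurable at the beginning of round `t` only for labels below `t`; this makes the
contexts of all pending queries available. -/
lemma queue_lt (ω : Ω) : ∀ k ∈ run.queue t ω, k < t := by
  induction t, ht using Nat.le_induction with
  | base => intro k hk; have := h.queue_one_le ω k hk; push_cast; omega
  | succ t ht ih =>
    intro k hk
    rw [h.queue_succ t ht] at hk
    push_cast
    rcases Finset.mem_union.1 hk with hk | hk
    · have : k ∈ run.queue t ω := by
        split_ifs at hk
        · exact hk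
        · exact Finset.mem_of_mem_erase hk
      have := ih k this
      omega
    · split_ifs at hk
      · rw [Finset.mem_singleton] at hk; omega
      · simp at hk

/-- The arrival of round `t - 1` joins after the departure of that round, so it is still pending;
for `t = 1` this is the convention on the label `0`. -/
lemma mem_queue_of_explores {ω : Ω} (hE : run.Explores t ω) : (t : ℤ) - 1 ∈ run.queue t ω := by
  obtain ⟨s, rfl⟩ : ∃ s, t = s + 1 := ⟨t - 1, by omega⟩
  have harr : run.arr s ω = true := hE.1
  rcases Nat.eq_zero_or_pos s with rfl | hs
  · simpa using h.queue_one_arr ω harr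
  · rw [h.queue_succ s hs, harr]
    simp

lemma job_mem {ω : Ω} (hq : run.queue t ω ≠ ∅) : run.job t ω ∈ run.queue t ω := by
  by_cases hE : run.Explores t ω
  · rw [h.explore_job t ht ω hE]; exact h.mem_queue_of_explores ht hE
  · exact h.opt_job t ht ω hE hq

lemma card_asst (hKN : K ≤ N) {ω : Ω} (hq : run.queue t ω ≠ ∅) : (run.asst t ω).card = K := by
  by_cases hE : run.Explores t ω
  · rw [h.explore_asst t ht ω hE]
    exact h.enum_bijOn.mapsTo (Set.mem_Iio.2 (Nat.mod_lt _ (Nat.choose_pos hKN)))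
  · exact h.opt_asst t ht ω hE hq

lemma card_active_le (hKN : K ≤ N) (ω : Ω) : (run.active t ω).card ≤ K := by
  rw [active]
  split_ifs with hq
  · simp
  · exact (h.card_asst ht hKN hq).le

omit ht in
lemma pre_mono {s : ℕ} (hs : 1 ≤ s) (hst : s ≤ t) : run.pre s ≤ run.pre t := by
  induction t, hst using Nat.le_induction with
  | base => exact le_rfl
  | succ t hst ih =>
    exact ih.trans ((h.pre_le_mid t (hs.trans hst)).trans (h.mid_le_pre t (hs.trans hst)))

omit ht in
lemma mid_le_pre_of_lt {s : ℕ} (hs : 1 ≤ s) (hst : s < t) : run.mid s ≤ run.pre t :=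
  (h.mid_le_pre s hs).trans (h.pre_mono (by omega) hst)

lemma mid_le : run.mid t ≤ mΩ := (h.mid_le_pre t ht).trans (h.pre_le _ (by omega))

/-- A function of the served query and of the assortment is known once the action is chosen. -/
lemma measurable_action {Z : Type*} [MeasurableSpace Z] (z : Z) {F : Finset (Fin N) → X → Z}
    (hF : ∀ S, Measurable (F S)) :
    Measurable[run.mid t]
      fun ω => if run.queue t ω = ∅ then z else F (run.asst t ω) (run.query t ω) := by
  refine measurable_of_countable_cases (mA := run.mid t)
    -- Queue, label and assortment take countably many values. On each piece the served context is
    -- that of a fixed label.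
    (c := fun ω => (run.queue t ω, run.job t ω, run.asst t ω)) (fun i => ?_)
    (g := fun i ω => if i.1 = ∅ then z else F i.2.2 (run.ctx i.2.1 ω)) (fun ω => ?_) fun ω => rfl
  · have h1 := h.pre_le_mid t ht _ (h.measurable_queue t ht i.1)
    have h2 := h.measurable_job t ht (MeasurableSet.singleton i.2.1)
    have h3 := h.measurable_asst t ht i.2.2
    convert! h1.inter (h2.inter h3) using 1
    ext ω
    simp [Prod.ext_iff]
  · dsimp only
    split_ifs with hq
    · exact measurable_const
    · exact (hF _).comp ((h.measurable_ctx _ t ht (h.queue_lt ht ω _ (h.job_mem ht hq))).mono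
        (h.pre_le_mid t ht) le_rfl)

lemma measurable_sum_active {F : Finset (Fin N) → X → Fin N → ℝ}
    (hF : ∀ S j, Measurable fun x => F S x j) : Measurable[run.mid t]
      fun ω => ∑ j ∈ run.active t ω, F (run.active t ω) (run.query t ω) j := by
  have := h.measurable_action ht (0 : ℝ) (F := fun S x => ∑ j ∈ S, F S x j)
    fun S => Finset.measurable_sum _ fun j _ => hF S j
  convert this using 2 with ω
  rw [active]
  split_ifs <;> simp

end

variable (h : run.IsACQB P mdl κ lam₀ c₁ enum) (hm : mdl.Assumptions K κ)
include h hm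

lemma measurable_gram (t : ℕ) (a b : Fin d) :
    Measurable[run.pre (t + 1)] fun ω => run.gram mdl t ω a b := by
  simp only [gram, Matrix.sum_apply]
  refine Finset.measurable_fun_sum _ fun i hi => ?_
  rw [Finset.mem_Icc] at hi
  refine Measurable.mono ?_ (h.mid_le_pre_of_lt hi.1 (by omega : i < t + 1)) le_rfl
  refine h.measurable_sum_active hi.1 (F := fun S x j =>
    vecMulVec (mdl.feat x j).ofLp (mdl.feat x j).ofLp a b) fun S j => ?_
  have := hm.measurable_feat j
  simp only [vecMulVec_apply]
  fun_prop

lemma measurable_design (t : ℕ) (a b : Fin d) :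
    Measurable[run.pre (t + 1)] fun ω => run.design mdl lam₀ t ω a b := by
  simp only [design_eq, Matrix.add_apply]
  exact (h.measurable_gram hm t a b).const_add _

lemma measurable_noise (t : ℕ) (a : Fin d) :
    Measurable[run.pre (t + 1)] fun ω => run.noise mdl t ω a := by
  simp only [noise, Finset.sum_apply, Pi.smul_apply, smul_eq_mul]
  refine Finset.measurable_fun_sum _ fun i hi => ?_
  rw [Finset.mem_Icc] at hi
  refine Measurable.mono ?_ (h.pre_mono (by omega : 1 ≤ i + 1) (by omega : i + 1 ≤ t + 1)) le_rfl
  refine measurable_of_countable_cases (mA := run.pre (i + 1)) (c := fun ω => run.choice i ω)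
    (fun y => h.measurable_choice i hi.1 y) (g := fun y ω => ∑ j ∈ run.active i ω,
      ((if y = some j then 1 else 0) -
      mdl.choiceProb (run.query i ω) (run.active i ω) mdl.θstar (some j)) *
      (mdl.feat (run.query i ω) j).ofLp a) (fun ω => ?_) fun ω => rfl
  refine Measurable.mono ?_ (h.mid_le_pre i hi.1) le_rfl
  refine h.measurable_sum_active hi.1 (F := fun S x j =>
    ((if run.choice i ω = some j then 1 else 0) - mdl.choiceProb x S mdl.θstar (some j)) *
      (mdl.feat x j).ofLp a) fun S j => ?_
  have h1 := hm.measurable_feat j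
  have h2 := Model.measurable_choiceProb hm S mdl.θstar (some j)
  fun_prop

end Run.IsACQB

/-- Hoeffding's lemma for a finitely supported distribution. -/
lemma sum_mul_exp_sub_le {ι : Type*} [Fintype ι] {p a : ι → ℝ} (hp : ∀ i, 0 ≤ p i)
    (hsum : ∑ i, p i = 1) {b : ℝ} (hb : 0 ≤ b) (ha : ∀ i, |a i| ≤ b) :
    ∑ i, p i * Real.exp (a i - ∑ k, p k * a k) ≤ Real.exp (b ^ 2 / 2) := by
  let _ : MeasurableSpace ι := ⊤
  have : MeasurableSingletonClass ι := ⟨fun _ => trivial⟩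
  have hs : ∑ i, ENNReal.ofReal (p i) = 1 := by
    rw [← ENNReal.ofReal_sum_of_nonneg fun i _ => hp i, hsum, ENNReal.ofReal_one]
  set μ := (PMF.ofFintype (fun i => ENNReal.ofReal (p i)) hs).toMeasure with hμ
  have hint (f : ι → ℝ) : ∫ i, f i ∂μ = ∑ i, p i * f i := by
    rw [hμ, PMF.integral_eq_sum]
    exact Finset.sum_congr rfl fun i _ => by
      rw [PMF.ofFintype_apply, ENNReal.toReal_ofReal (hp i), smul_eq_mul]
  have h := (hasSubgaussianMGF_of_mem_Icc (μ := μ) (X := a) (a := -b) (b := b)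
    measurable_from_top.aemeasurable
    (Filter.Eventually.of_forall fun i => abs_le.1 (ha i))).mgf_le 1
  rw [mgf, hint] at h
  simp only [one_mul, hint] at h
  refine h.trans (Real.exp_le_exp.2 (le_of_eq ?_))
  simp only [sub_neg_eq_add, NNReal.coe_pow, NNReal.coe_div, coe_nnnorm, NNReal.coe_ofNat,
    Real.norm_of_nonneg (by linarith : 0 ≤ b + b)]
  ring

/-- The pull-out property of conditional probability for `ENNReal`-valued `g`, localized to `D`
since the conditional law of the choice is prescribed only for nonempty queues. -/
lemma setLIntegral_indicator_eq {Ω : Type*} {m mΩ : MeasurableSpace Ω} {P : Measure Ω}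
    [IsFiniteMeasure P] (hm : m ≤ mΩ) {A D : Set Ω} (hA : MeasurableSet A)
    (hD : MeasurableSet[m] D) {p : Ω → ℝ} (hp : Measurable p)
    (h : ∀ᵐ ω ∂P, ω ∈ D → (P⟦A | m⟧) ω = p ω) {g : Ω → ENNReal} (hg : Measurable[m] g) :
    ∫⁻ ω in D, A.indicator g ω ∂P = ∫⁻ ω in D, ENNReal.ofReal (p ω) * g ω ∂P := by
  have hpm : Measurable fun ω => ENNReal.ofReal (p ω) := hp.ennreal_ofReal
  refine Measurable.ennreal_induction (motive := fun g =>
    ∫⁻ ω in D, A.indicator g ω ∂P = ∫⁻ ω in D, ENNReal.ofReal (p ω) * g ω ∂P) ?_ ?_ ?_ hg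
  · intro c B hB
    have hDB : MeasurableSet[m] (D ∩ B) := hD.inter hB
    have h1 : ∫⁻ ω in D ∩ B, ENNReal.ofReal (p ω) ∂P = P (A ∩ (D ∩ B)) := by
      have hind : Integrable (A.indicator fun _ => (1 : ℝ)) P :=
        (integrable_const 1).indicator hA
      have h2 := setIntegral_condExp hm hind hDB
      have h3 : ∫⁻ ω in D ∩ B, ENNReal.ofReal (p ω) ∂P =
          ∫⁻ ω in D ∩ B, ENNReal.ofReal ((P⟦A | m⟧) ω) ∂P := by
        refine setLIntegral_congr_fun_ae (hm _ hDB) ?_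
        filter_upwards [h] with ω hω hωD
        rw [hω hωD.1]
      have h4 : 0 ≤ᵐ[P.restrict (D ∩ B)] P⟦A | m⟧ :=
        ae_restrict_of_ae (condExp_nonneg (Filter.Eventually.of_forall fun ω =>
          Set.indicator_nonneg (fun _ _ => zero_le_one) ω))
      rw [h3, ← ofReal_integral_eq_lintegral_ofReal integrable_condExp.integrableOn h4, h2,
        integral_indicator hA, Measure.restrict_restrict hA]
      simp
    have h5 : A.indicator (B.indicator fun _ => c) = (A ∩ B).indicator fun _ => c := by
      rw [Set.indicator_indicator]
    rw [h5, lintegral_indicator_const (hA.inter (hm _ hB)), Measure.restrict_apply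
      (hA.inter (hm _ hB))]
    have h6 (ω : Ω) : ENNReal.ofReal (p ω) * B.indicator (fun _ => c) ω =
        B.indicator (fun ω => c * ENNReal.ofReal (p ω)) ω := by
      by_cases hω : ω ∈ B <;> simp [hω, mul_comm]
    simp only [h6]
    rw [lintegral_indicator (hm _ hB), Measure.restrict_restrict (hm _ hB), Set.inter_comm B D,
      lintegral_const_mul _ hpm, h1]
    congr 2
    ext ω
    simp only [Set.mem_inter_iff]
    tauto
  · intro f g _ hf hg hf' hg'
    have h1 (ω : Ω) : A.indicator (f + g) ω = A.indicator f ω + A.indicator g ω := by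
      by_cases hω : ω ∈ A <;> simp [hω]
    simp only [h1, mul_add, Pi.add_apply]
    rw [lintegral_add_left ((hf.mono hm le_rfl).indicator hA),
      lintegral_add_left (f := fun ω => ENNReal.ofReal (p ω) * f ω) (hpm.mul (hf.mono hm le_rfl)), hf', hg']
  · intro f hf hmono ih
    have h1 (ω : Ω) : A.indicator (fun x => ⨆ i, f i x) ω = ⨆ i, A.indicator (f i) ω := by
      by_cases hω : ω ∈ A <;> simp [hω]
    simp only [h1, ENNReal.mul_iSup]
    rw [lintegral_iSup (fun i => ((hf i).mono hm le_rfl).indicator hA),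
      lintegral_iSup (f := fun i ω => ENNReal.ofReal (p ω) * f i ω)
        fun i => hpm.mul ((hf i).mono hm le_rfl)]
    · exact iSup_congr ih
    · intro i j hij ω
      exact mul_le_mul_right (hmono hij ω) _
    · intro i j hij ω
      exact Set.indicator_le_indicator (hmono hij ω)

/-! ### The exponential supermartingale and the confidence ellipsoid -/

namespace Run.IsACQB

variable {d N K : ℕ} {X Ω : Type*} [MeasurableSpace X] [mΩ : MeasurableSpace Ω] {P : Measure Ω}
  {mdl : Model d N X} {κ lam₀ c₁ : ℝ} {enum : ℕ → Finset (Fin N)} {run : Run d N K X Ω}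

lemma measurableSet_queue_ne (h : run.IsACQB P mdl κ lam₀ c₁ enum) {t : ℕ} (ht : 1 ≤ t) :
    MeasurableSet[run.pre t] {ω | run.queue t ω ≠ ∅} :=
  MeasurableSet.compl (h.measurable_queue t ht ∅)

variable [IsProbabilityMeasure P]

lemma ae_choice_mem (h : run.IsACQB P mdl κ lam₀ c₁ enum) {t : ℕ} (ht : 1 ≤ t) :
    ∀ᵐ ω ∂P, run.queue t ω ≠ ∅ → ∀ j, run.choice t ω = some j → j ∈ run.asst t ω := by
  suffices hj : ∀ j, ∀ᵐ ω ∂P, run.queue t ω ≠ ∅ → run.choice t ω = some j → j ∈ run.asst t ω by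
    filter_upwards [ae_all_iff.2 hj] with ω hω hq j hc using hω j hq hc
  intro j
  have hm := h.mid_le ht
  have hD : MeasurableSet[run.mid t] ({ω | run.queue t ω ≠ ∅} ∩ {ω | j ∉ run.asst t ω}) := by
    refine (h.pre_le_mid t ht _ (h.measurableSet_queue_ne ht)).inter ?_
    have : {ω | j ∉ run.asst t ω} = ⋃ S ∈ {S : Finset (Fin N) | j ∉ S}, {ω | run.asst t ω = S} := by
      ext ω; simp
    rw [this]
    exact MeasurableSet.biUnion (Set.to_countable _) fun S _ => h.measurable_asst t ht S
  have hA : MeasurableSet {ω | run.choice t ω = some j} :=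
    h.pre_le (t + 1) (by omega) _ (h.measurable_choice t ht (some j))
  have key := setLIntegral_indicator_eq (P := P) hm hA hD (p := fun _ => 0) measurable_const
    (by
      filter_upwards [h.choice_law t ht (some j)] with ω hω hωD
      rw [hω hωD.1]
      exact if_neg hωD.2) (g := fun _ => 1) measurable_const
  simp only [ENNReal.ofReal_zero, zero_mul, lintegral_zero] at key
  rw [lintegral_indicator_const hA, one_mul, Measure.restrict_apply hA] at key
  have : ∀ᵐ ω ∂P, ω ∉ {ω | run.choice t ω = some j} ∩
      ({ω | run.queue t ω ≠ ∅} ∩ {ω | j ∉ run.asst t ω}) := measure_eq_zero_iff_ae_notMem.1 key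
  filter_upwards [this] with ω hω hq hc
  by_contra hj
  exact hω ⟨hc, hq, hj⟩

/-- Induction over the rounds. Given the action, the new factor has conditional mean at most 1 by
Hoeffding's lemma, because the new summand of the quadratic form is exactly the required variance
proxy. -/
lemma lintegral_exp_noise_le (h : run.IsACQB P mdl κ lam₀ c₁ enum) (hm : mdl.Assumptions K κ)
    (u : Fin d → ℝ) (t : ℕ) :
    ∫⁻ ω, ENNReal.ofReal (Real.exp (u ⬝ᵥ run.noise mdl t ω -
      (u ⬝ᵥ run.gram mdl t ω *ᵥ u) / 2)) ∂P ≤ 1 := by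
  induction t with
  | zero => simp [noise, gram]
  | succ t ih =>
    refine le_trans ?_ ih
    have ht : 1 ≤ t + 1 := by omega
    have hmid := h.mid_le ht
    set f : Ω → ENNReal := fun ω => ENNReal.ofReal (Real.exp (u ⬝ᵥ run.noise mdl t ω -
      (u ⬝ᵥ run.gram mdl t ω *ᵥ u) / 2)) with hf
    have hfm : Measurable[run.mid (t + 1)] f := by
      have h1 := fun a => h.measurable_noise hm t a
      have h2 := fun a b => h.measurable_gram hm t a b
      refine Measurable.mono ?_ (h.pre_le_mid _ ht) le_rfl
      simp only [hf, dotProduct, mulVec]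
      fun_prop
    set w : Ω → Fin N → ℝ := fun ω j => (mdl.feat (run.query (t + 1) ω) j).ofLp ⬝ᵥ u
    set S : Ω → Finset (Fin N) := fun ω => run.active (t + 1) ω
    set p : Option (Fin N) → Ω → ℝ := fun y ω => if run.queue (t + 1) ω = ∅ then 0 else
      mdl.choiceProb (run.query (t + 1) ω) (run.asst (t + 1) ω) mdl.θstar y with hp
    set e : Option (Fin N) → Ω → ENNReal := fun y ω => ENNReal.ofReal (Real.exp
      (∑ j ∈ S ω, ((if y = some j then 1 else 0) -
        mdl.choiceProb (run.query (t + 1) ω) (S ω) mdl.θstar (some j)) * w ω j -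
        (∑ j ∈ S ω, w ω j ^ 2) / 2)) with he
    have hpm (y : Option (Fin N)) : Measurable[run.mid (t + 1)] (p y) :=
      h.measurable_action ht 0 fun S => Model.measurable_choiceProb hm S _ y
    have hem (y : Option (Fin N)) : Measurable[run.mid (t + 1)] (e y) := by
      have hfeat (j : Fin N) : Measurable fun x => (mdl.feat x j).ofLp ⬝ᵥ u := by
        have := hm.measurable_feat j
        simp only [dotProduct]
        fun_prop
      have h1 := h.measurable_sum_active ht (F := fun S x j => ((if y = some j then 1 else 0) -
        mdl.choiceProb x S mdl.θstar (some j)) * ((mdl.feat x j).ofLp ⬝ᵥ u))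
        fun S j => ((Model.measurable_choiceProb hm S _ _).const_sub _).mul (hfeat j)
      have h2 := h.measurable_sum_active ht (F := fun S x j => ((mdl.feat x j).ofLp ⬝ᵥ u) ^ 2)
        fun S j => (hfeat j).pow_const 2
      exact (h1.sub (h2.div_const 2)).exp.ennreal_ofReal
    set D := {ω | run.queue (t + 1) ω ≠ ∅} with hD
    have hDm : MeasurableSet[run.mid (t + 1)] D :=
      h.pre_le_mid _ ht _ (h.measurableSet_queue_ne ht)
    have hCm (y : Option (Fin N)) : MeasurableSet {ω | run.choice (t + 1) ω = y} :=
      h.pre_le _ (by omega) _ (h.measurable_choice (t + 1) ht y)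
    have hstep (ω : Ω) : ENNReal.ofReal (Real.exp (u ⬝ᵥ run.noise mdl (t + 1) ω -
        (u ⬝ᵥ run.gram mdl (t + 1) ω *ᵥ u) / 2)) = f ω * e (run.choice (t + 1) ω) ω := by
      rw [hf, he, ← ENNReal.ofReal_mul (Real.exp_pos _).le, ← Real.exp_add, noise_succ,
        quad_gram_succ]
      congr 2
      ring
    -- The factor depends on the choice, which takes finitely many values; splitting over them lets
    -- the choice law replace each indicator by its probability.
    have hstep2 (ω : Ω) : f ω * e (run.choice (t + 1) ω) ω =
        ∑ y, {ω | run.choice (t + 1) ω = y}.indicator (fun ω => f ω * e y ω) ω := by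
      rw [Finset.sum_eq_single (run.choice (t + 1) ω)]
      · rw [Set.indicator_of_mem (by simp)]
      · intro y _ hy
        rw [Set.indicator_of_notMem]
        exact fun h => hy h.symm
      · simp
    simp only [hstep]
    rw [← lintegral_add_compl _ (hmid _ hDm), ← lintegral_add_compl f (hmid _ hDm)]
    refine add_le_add ?_ ?_
    · simp only [hstep2]
      rw [lintegral_finsetSum]
      · have hy (y : Option (Fin N)) := setLIntegral_indicator_eq (P := P) hmid (hCm y) hDm
          ((hpm y).mono hmid le_rfl)
          (by
            filter_upwards [h.choice_law (t + 1) ht y] with ω hω hωD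
            rw [hω hωD, hp]
            exact (if_neg hωD).symm)
          (hfm.mul (hem y))
        refine (Finset.sum_congr rfl fun y _ => hy y).trans_le ?_
        rw [← lintegral_finsetSum]
        · refine setLIntegral_mono (hfm.mono hmid le_rfl) fun ω hω => ?_
          have hSω : S ω = run.asst (t + 1) ω := if_neg hω
          have hpω (y : Option (Fin N)) : p y ω =
              mdl.choiceProb (run.query (t + 1) ω) (S ω) mdl.θstar y := by
            rw [hSω]; exact if_neg hω
          have hp0 (y : Option (Fin N)) : 0 ≤ p y ω := by
            rw [hpω]; exact mdl.choiceProb_nonneg _ _ _ _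
          set a : Option (Fin N) → ℝ := fun y =>
            ∑ j ∈ S ω, (if y = some j then 1 else 0) * w ω j with ha
          have hss : 0 ≤ ∑ j ∈ S ω, w ω j ^ 2 := Finset.sum_nonneg fun _ _ => sq_nonneg _
          -- At most one server is chosen, so the variable is bounded by the Euclidean norm of the
          -- `w ω j`. This gives the proxy `∑ w ω j ^ 2`, with no factor `K`.
          have hab (y : Option (Fin N)) : |a y| ≤ √(∑ j ∈ S ω, w ω j ^ 2) := by
            rcases y with _ | j
            · simp [ha]
            · by_cases hj : j ∈ S ω
              · refine Real.abs_le_sqrt ?_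
                simp only [ha, Option.some.injEq, ite_mul, one_mul, zero_mul, Finset.sum_ite_eq, hj,
                  if_true]
                exact Finset.single_le_sum (f := fun j => w ω j ^ 2) (fun _ _ => sq_nonneg _) hj
              · simp [ha, hj]
          have hmean : ∑ y, p y ω * a y = ∑ j ∈ S ω,
              mdl.choiceProb (run.query (t + 1) ω) (S ω) mdl.θstar (some j) * w ω j := by
            rw [Fintype.sum_option]
            simp [ha, hpω, Finset.sum_ite_eq, Finset.sum_ite_mem]
          have hH := sum_mul_exp_sub_le (p := fun y => p y ω) (a := a) hp0
            (by simp only [hpω]; exact mdl.sum_choiceProb _ _ _) (Real.sqrt_nonneg _) hab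
          rw [Real.sq_sqrt hss, hmean] at hH
          calc ∑ y, ENNReal.ofReal (p y ω) * (f ω * e y ω)
              = f ω * ENNReal.ofReal (∑ y, p y ω * Real.exp (a y - ∑ j ∈ S ω,
                mdl.choiceProb (run.query (t + 1) ω) (S ω) mdl.θstar (some j) * w ω j) *
                Real.exp (-((∑ j ∈ S ω, w ω j ^ 2) / 2))) := by
                rw [ENNReal.ofReal_sum_of_nonneg fun y _ => by have := hp0 y; positivity,
                  Finset.mul_sum]
                refine Finset.sum_congr rfl fun y _ => ?_
                rw [mul_assoc (p y ω), ← Real.exp_add, ENNReal.ofReal_mul (hp0 y), mul_left_comm]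
                congr 2
                simp only [he, ha, sub_mul, Finset.sum_sub_distrib]
                rfl
            _ ≤ f ω * 1 := by
                gcongr
                rw [← ENNReal.ofReal_one, ← Finset.sum_mul]
                refine ENNReal.ofReal_le_ofReal ?_
                calc _ ≤ Real.exp ((∑ j ∈ S ω, w ω j ^ 2) / 2) *
                      Real.exp (-((∑ j ∈ S ω, w ω j ^ 2) / 2)) := by gcongr
                  _ = 1 := by rw [← Real.exp_add]; simp
            _ = f ω := mul_one _
        · exact fun y _ => (((hpm y).ennreal_ofReal).mul (hfm.mul (hem y))).mono hmid le_rfl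
      · exact fun y _ => ((hfm.mul (hem y)).mono hmid le_rfl).indicator (hCm y)
    · refine setLIntegral_mono (hfm.mono hmid le_rfl) fun ω hω => ?_
      have hq : run.queue (t + 1) ω = ∅ := by simpa [hD] using hω
      have : S ω = ∅ := if_pos hq
      simp [he, this]

omit [IsProbabilityMeasure P] in
lemma trace_design_le (h : run.IsACQB P mdl κ lam₀ c₁ enum) (hm : mdl.Assumptions K κ)
    (hKN : K ≤ N) (t : ℕ) (ω : Ω) :
    (run.design mdl lam₀ t ω).trace ≤ lam₀ * d + t * K := by
  rw [design_eq, trace_add, trace_smul, trace_one, Fintype.card_fin, smul_eq_mul, gram, trace_sum]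
  gcongr
  calc ∑ i ∈ Finset.Icc 1 t, (∑ j ∈ run.active i ω, vecMulVec (mdl.feat (run.query i ω) j).ofLp
        (mdl.feat (run.query i ω) j).ofLp).trace
      ≤ ∑ i ∈ Finset.Icc 1 t, (K : ℝ) := by
        refine Finset.sum_le_sum fun i hi => ?_
        rw [trace_sum]
        calc _ ≤ ∑ j ∈ run.active i ω, (1 : ℝ) := by
              refine Finset.sum_le_sum fun j _ => ?_
              rw [trace_vecMulVec, ← Model.inner_eq_dotProduct, real_inner_self_eq_norm_sq]
              exact pow_le_one₀ (norm_nonneg _) (hm.norm_feat_le _ _)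
          _ ≤ K := by
              simpa using h.card_active_le (Finset.mem_Icc.1 hi).1 hKN ω
    _ = t * K := by simp

omit [IsProbabilityMeasure P] in
lemma log_det_design_le (h : run.IsACQB P mdl κ lam₀ c₁ enum) (hm : mdl.Assumptions K κ)
    (hKN : K ≤ N) (hd : 1 ≤ d) (hlam : 0 < lam₀) (t : ℕ) (ω : Ω) :
    Real.log (run.design mdl lam₀ t ω).det - d * Real.log lam₀ ≤
      d * Real.log (1 + t * K / (d * lam₀)) := by
  have hd' : (0 : ℝ) < d := by exact_mod_cast hd
  have hV : (run.design mdl lam₀ t ω).PosDef := posDef_design hlam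
  have : Nonempty (Fin d) := ⟨⟨0, hd⟩⟩
  have h1 := log_det_le hd hV
  have h2 : Real.log ((run.design mdl lam₀ t ω).trace / d) ≤
      Real.log (lam₀ * (1 + t * K / (d * lam₀))) := by
    refine Real.log_le_log (div_pos hV.trace_pos hd') ?_
    rw [div_le_iff₀ hd']
    refine (h.trace_design_le hm hKN t ω).trans (le_of_eq ?_)
    field_simp
  rw [Real.log_mul hlam.ne' (by positivity)] at h2
  nlinarith [mul_le_mul_of_nonneg_left h2 hd'.le]

/-- The confidence ellipsoid. -/
lemma measure_error_le (h : run.IsACQB P mdl κ lam₀ c₁ enum) (hm : mdl.Assumptions K κ)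
    (hK : 1 ≤ K) (hKN : K ≤ N) (hd : 1 ≤ d) (hκ : 0 < κ) (hlam : 0 < lam₀) {t : ℕ} (ht : 1 ≤ t) :
    P {ω | 4 * radius d K κ lam₀ t < √((run.est t ω - mdl.θstar).ofLp ⬝ᵥ
        run.design mdl lam₀ t ω *ᵥ (run.est t ω - mdl.θstar).ofLp)} ≤
      ENNReal.ofReal (1 / (t : ℝ) ^ 2) := by
  have ht' : (0 : ℝ) < t := by exact_mod_cast ht
  have hpre := h.pre_le (t + 1) (by omega)
  have hself := measure_selfNormalized_le (P := P) (s := fun ω => run.noise mdl t ω)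
    (A := fun ω => run.gram mdl t ω)
    (measurable_pi_lambda _ fun a => (h.measurable_noise hm t a).mono hpre le_rfl)
    (fun a b => (h.measurable_gram hm t a b).mono hpre le_rfl)
    (fun ω => posSemidef_gram) (fun u => h.lintegral_exp_noise_le hm u t) hlam
    (δ := 1 / (t : ℝ) ^ 2) (by positivity)
  refine le_trans (measure_mono_ae ?_) hself
  have hchoice : ∀ᵐ ω ∂P, ∀ i ∈ Finset.Icc 1 t, run.queue i ω ≠ ∅ →
      ∀ j, run.choice i ω = some j → j ∈ run.asst i ω := by
    rw [Filter.eventually_all_finset]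
    exact fun i hi => h.ae_choice_mem (Finset.mem_Icc.1 hi).1
  filter_upwards [hchoice] with ω hω hbad
  have hbad' : 4 * radius d K κ lam₀ t < √((run.est t ω - mdl.θstar).ofLp ⬝ᵥ
        run.design mdl lam₀ t ω *ᵥ (run.est t ω - mdl.θstar).ofLp) := hbad
  by_contra hcon
  have hcon' := not_lt.1 hcon
  rw [← design_eq] at hcon'
  have hdet := h.log_det_design_le hm hKN hd hlam t ω
  -- The level `δ = 1 / t ^ 2` produces the term `4 log t` of the radius.
  have hlog : 2 * Real.log (1 / (1 / (t : ℝ) ^ 2)) = 4 * Real.log t := by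
    rw [one_div_one_div, Real.log_pow]; push_cast; ring
  rw [hlog] at hcon'
  have herr := sqrt_quad_error_le hlam (hm.one_le_curvature hK hKN hκ) hm
    (fun i hi hq => h.card_asst (Finset.mem_Icc.1 hi).1 hKN hq) hω (h.est_mem t ω) (h.est_min t ω)
  have hsq := Real.sqrt_le_sqrt (hcon'.trans (add_le_add_left hdet (4 * Real.log t)))
  have h1 := hbad'.trans_le herr
  rw [radius] at h1
  have h2 := mul_le_mul_of_nonneg_left hsq hκ.le
  have h3 := mul_nonneg hκ.le (Real.sqrt_nonneg lam₀)
  -- The error is at most `2 κ √(…) + 2 κ √lam₀`, while four radii are `2 κ √(…) + 4 κ √lam₀`; this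
  -- is the origin of the factor 4.
  linarith

end Run.IsACQB

/-! ### Families of independent Gaussian samples -/

section GaussianFamily

variable {n M : ℕ} {V : Matrix (Fin n) (Fin n) ℝ}

/-- The sum of the squared `V`-distances of the members of a family to `μ`. -/
noncomputable def spread (V : Matrix (Fin n) (Fin n) ℝ) (μ : EuclideanSpace ℝ (Fin n))
    (θ : Fin M → EuclideanSpace ℝ (Fin n)) : ℝ :=
  ∑ i, (θ i - μ).ofLp ⬝ᵥ V *ᵥ (θ i - μ).ofLp

lemma spread_nonneg (hV : V.PosDef) (μ : EuclideanSpace ℝ (Fin n))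
    (θ : Fin M → EuclideanSpace ℝ (Fin n)) : 0 ≤ spread V μ θ :=
  Finset.sum_nonneg fun _ _ => quad_nonneg hV.posSemidef _

lemma measurable_spread {A : Type*} [MeasurableSpace A] {V : A → Matrix (Fin n) (Fin n) ℝ}
    (hV : ∀ i j, Measurable fun a => V a i j) {μ : A → EuclideanSpace ℝ (Fin n)}
    (hμ : Measurable μ) {θ : A → Fin M → EuclideanSpace ℝ (Fin n)} (hθ : Measurable θ) :
    Measurable fun a => spread (V a) (μ a) (θ a) := by
  simp only [spread, dotProduct, mulVec]
  fun_prop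

variable (μ : EuclideanSpace ℝ (Fin n)) (a : ℝ)

lemma lintegral_spread (hV : V.PosDef) :
    ∫⁻ θ, ENNReal.ofReal (spread V μ θ)
      ∂Measure.pi (fun _ : Fin M => multivariateGaussian μ (a ^ 2 • V⁻¹)) =
      ENNReal.ofReal (M * n * a ^ 2) := by
  have h1 (i : Fin M) : ∫⁻ θ : Fin M → EuclideanSpace ℝ (Fin n),
      ENNReal.ofReal ((θ i - μ).ofLp ⬝ᵥ V *ᵥ (θ i - μ).ofLp)
      ∂Measure.pi (fun _ : Fin M => multivariateGaussian μ (a ^ 2 • V⁻¹)) =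
      ENNReal.ofReal (a ^ 2 * n) := by
    have hmp := measurePreserving_eval (fun _ : Fin M => multivariateGaussian μ (a ^ 2 • V⁻¹)) i
    have hmeas : Measurable fun x : EuclideanSpace ℝ (Fin n) =>
        ENNReal.ofReal ((x - μ).ofLp ⬝ᵥ V *ᵥ (x - μ).ofLp) := by
      simp only [dotProduct, mulVec]
      fun_prop
    rw [← lintegral_quad_multivariateGaussian hV a μ, ← hmp.lintegral_comp hmeas]
  simp only [spread, ENNReal.ofReal_sum_of_nonneg fun i _ =>
    quad_nonneg hV.posSemidef _]
  rw [lintegral_finsetSum]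
  · simp only [h1, Finset.sum_const, Finset.card_univ, Fintype.card_fin, nsmul_eq_mul]
    rw [← ENNReal.ofReal_natCast, ← ENNReal.ofReal_mul (by positivity)]
    congr 1
    ring
  · intro i _
    simp only [dotProduct, mulVec]
    fun_prop

/-- Only the marginal of one sample is involved, since optimism of a single sample suffices. -/
lemma optimismProb_le_pi (hV : V.PosDef) {a : ℝ} (ha : 0 < a) (i : Fin M)
    (θ v : EuclideanSpace ℝ (Fin n))
    (h : √((μ - θ).ofLp ⬝ᵥ V *ᵥ (μ - θ).ofLp) ≤ 4 * a) :
    optimismProb ≤ (Measure.pi fun _ : Fin M => multivariateGaussian μ (a ^ 2 • V⁻¹)).real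
      {x | 0 ≤ inner ℝ v (x i - θ)} := by
  refine (optimismProb_le hV ha μ θ v h).trans (le_of_eq ?_)
  have hmp := measurePreserving_eval (fun _ : Fin M => multivariateGaussian μ (a ^ 2 • V⁻¹)) i
  refine (hmp.measureReal_preimage ?_).symm
  exact (measurableSet_le measurable_const (by fun_prop)).nullMeasurableSet

/-- A function bounded below in terms of a square integrable function has the corresponding lower
bound on its mean. -/
lemma sub_mul_le_integral {A : Type*} [MeasurableSpace A] {ν : Measure A} [IsProbabilityMeasure ν]
    {s φ : A → ℝ} (hs : Measurable s) (hs0 : ∀ θ, 0 ≤ s θ) {z L w : ℝ} (hz : 0 < z)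
    (hsz : ∫⁻ θ, ENNReal.ofReal (s θ) ∂ν = ENNReal.ofReal (z ^ 2)) (hw : 0 ≤ w)
    (hφ : Integrable φ ν) (h : ∀ θ, L - √(s θ) * w ≤ φ θ) :
    L - z * w ≤ ∫ θ, φ θ ∂ν := by
  have hint : Integrable s ν := by
    refine ⟨hs.aestronglyMeasurable, ?_⟩
    rw [hasFiniteIntegral_iff_ofReal (Filter.Eventually.of_forall hs0), hsz]
    exact ENNReal.ofReal_lt_top
  have hmean : ∫ θ, s θ ∂ν = z ^ 2 := by
    rw [integral_eq_lintegral_of_nonneg_ae (Filter.Eventually.of_forall hs0)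
      hs.aestronglyMeasurable, hsz, ENNReal.toReal_ofReal (by positivity)]
  have hle (θ : A) : L - (s θ / z + z) / 2 * w ≤ φ θ := by
    refine le_trans ?_ (h θ)
    -- The tangent of the square root at `z ^ 2`: a linear bound in `s` whose mean is exactly `z`,
    -- which proves `E √s ≤ z`.
    have h1 : √(s θ) ≤ (s θ / z + z) / 2 := by
      have h2 := Real.sq_sqrt (hs0 θ)
      rw [le_div_iff₀ two_pos]
      have h3 : s θ / z + z = (√(s θ) ^ 2 + z ^ 2) / z := by
        rw [h2]; field_simp
      rw [h3, le_div_iff₀ hz]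
      nlinarith [sq_nonneg (√(s θ) - z)]
    have := mul_le_mul_of_nonneg_right h1 hw
    linarith
  have hint2 : Integrable (fun θ => (s θ / z + z) / 2 * w) ν :=
    (((hint.div_const z).add (integrable_const z)).div_const 2).mul_const w
  have h4 : ∫ θ, (L - (s θ / z + z) / 2 * w) ∂ν = L - z * w := by
    rw [integral_sub (integrable_const L) hint2, integral_mul_const, integral_div,
      integral_add (hint.div_const z) (integrable_const z), integral_div, hmean]
    simp only [integral_const, probReal_univ, smul_eq_mul, one_mul]
    congr 2
    field_simp
    ring
  rw [← h4]
  exact integral_mono ((integrable_const L).sub hint2) hφ hle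

lemma abs_iSup_inner_sub_le [NeZero M] (hV : V.PosDef) (x : EuclideanSpace ℝ (Fin n))
    (θ : Fin M → EuclideanSpace ℝ (Fin n)) :
    |(⨆ i, inner ℝ x (θ i)) - inner ℝ x μ| ≤ √(spread V μ θ) * √(x.ofLp ⬝ᵥ V⁻¹ *ᵥ x.ofLp) := by
  obtain ⟨i, hi⟩ := exists_eq_ciSup_of_finite (f := fun i => inner ℝ x (θ i))
  rw [← hi, ← inner_sub_right, Model.inner_eq_dotProduct, mul_comm]
  refine (abs_dotProduct_le hV _ _).trans ?_
  gcongr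
  exact Finset.single_le_sum (f := fun i => (θ i - μ).ofLp ⬝ᵥ V *ᵥ (θ i - μ).ofLp)
    (fun _ _ => quad_nonneg hV.posSemidef _) (Finset.mem_univ i)

end GaussianFamily

/-! ### Elliptical potential: the widths sum to a log-determinant -/

section Potential

variable {n : ℕ} {V : Matrix (Fin n) (Fin n) ℝ} {c : ℝ}

lemma dotProduct_sq_le_self (x y : Fin n → ℝ) : (x ⬝ᵥ y) ^ 2 ≤ (x ⬝ᵥ x) * (y ⬝ᵥ y) := by
  simpa using dotProduct_sq_le (V := (1 : Matrix (Fin n) (Fin n) ℝ)) PosDef.one x y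

lemma quad_inv_le_of_le (hV : V.PosDef) (hc : 0 < c) (h : ∀ y, c * (y ⬝ᵥ y) ≤ y ⬝ᵥ V *ᵥ y)
    {x : Fin n → ℝ} (hx : x ⬝ᵥ x ≤ 1) : x ⬝ᵥ V⁻¹ *ᵥ x ≤ 1 / c := by
  have h0 := quad_inv_nonneg hV x
  have h1 := h (V⁻¹ *ᵥ x)
  rw [mulVec_inv_mulVec hV, dotProduct_comm (V⁻¹ *ᵥ x) x] at h1
  have h2 := dotProduct_sq_le_self x (V⁻¹ *ᵥ x)
  have h4 : 0 ≤ (V⁻¹ *ᵥ x) ⬝ᵥ (V⁻¹ *ᵥ x) := Finset.sum_nonneg fun _ _ => mul_self_nonneg _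
  have h3 := mul_le_mul_of_nonneg_right hx h4
  rw [le_div_iff₀ hc]
  set q := x ⬝ᵥ V⁻¹ *ᵥ x
  rcases h0.eq_or_lt with h0 | h0
  · rw [← h0]; simp
  · by_contra hcon
    push Not at hcon
    nlinarith

/-- Elliptical potential: the increment of the log-determinant controls the widths. -/
lemma sum_quad_inv_le {ι : Type*} [DecidableEq ι] (hV : V.PosDef) (hc : 0 < c)
    (h : ∀ y, c * (y ⬝ᵥ y) ≤ y ⬝ᵥ V *ᵥ y) (f : ι → Fin n → ℝ) (hf : ∀ j, f j ⬝ᵥ f j ≤ 1)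
    {S : Finset ι} {K : ℕ} (hS : S.card ≤ K) :
    ∑ j ∈ S, f j ⬝ᵥ V⁻¹ *ᵥ f j ≤ (1 + K / c) * (1 + 1 / c) *
      (Real.log (V + ∑ j ∈ S, vecMulVec (f j) (f j)).det - Real.log V.det) := by
  have hC : 1 ≤ 1 + K / c := by have : 0 ≤ K / c := by positivity
                                linarith
  -- Up to `K` unit vectors add at most `K (y ⬝ᵥ y) ≤ (K / c) (y ⬝ᵥ V *ᵥ y)`, so the whole
  -- assortment enlarges the form by a factor of at most `1 + K / c`.
  have key := sum_log_le_log_det_add_sum hV (c := 1 + K / c) (by positivity) f S fun y => by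
    have h1 : ∑ j ∈ S, (f j ⬝ᵥ y) ^ 2 ≤ K * (y ⬝ᵥ y) := by
      have hy : 0 ≤ y ⬝ᵥ y := Finset.sum_nonneg fun _ _ => mul_self_nonneg _
      calc ∑ j ∈ S, (f j ⬝ᵥ y) ^ 2 ≤ ∑ j ∈ S, (y ⬝ᵥ y) := Finset.sum_le_sum fun j _ =>
            (dotProduct_sq_le_self _ _).trans (mul_le_of_le_one_left hy (hf j))
        _ = S.card * (y ⬝ᵥ y) := by simp
        _ ≤ K * (y ⬝ᵥ y) := by gcongr
    have h2 : K * (y ⬝ᵥ y) ≤ K / c * (y ⬝ᵥ V *ᵥ y) := by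
      rw [div_mul_eq_mul_div, le_div_iff₀ hc, mul_assoc, mul_comm (y ⬝ᵥ y)]
      exact mul_le_mul_of_nonneg_left (h y) (Nat.cast_nonneg _)
    linarith
  have hterm : ∀ j ∈ S, f j ⬝ᵥ V⁻¹ *ᵥ f j ≤ (1 + K / c) * (1 + 1 / c) *
      Real.log (1 + (f j ⬝ᵥ V⁻¹ *ᵥ f j) / (1 + K / c)) := by
    intro j _
    have h0 := quad_inv_nonneg hV (f j)
    have h1 := quad_inv_le_of_le hV hc h (hf j)
    set u := (f j ⬝ᵥ V⁻¹ *ᵥ f j) / (1 + K / c) with hu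
    have hu0 : 0 ≤ u := by positivity
    have hu1 : u ≤ 1 / c := (div_le_self h0 hC).trans h1
    have h2 : f j ⬝ᵥ V⁻¹ *ᵥ f j = (1 + K / c) * u := by rw [hu]; field_simp
    rw [h2, mul_assoc]
    gcongr
    -- From `log (1 + u) ≥ u / (1 + u)` and `u ≤ 1 / c`; no lower bound on the regularization beyond
    -- positivity is required.
    have h3 := Real.one_sub_inv_le_log_of_pos (by linarith : 0 < 1 + u)
    have h4 : 1 - (1 + u)⁻¹ = u / (1 + u) := by field_simp; ring
    rw [h4, div_le_iff₀ (by linarith)] at h3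
    have h5 : 0 ≤ Real.log (1 + u) := Real.log_nonneg (by linarith)
    nlinarith
  refine (Finset.sum_le_sum hterm).trans ?_
  rw [← Finset.mul_sum]
  gcongr
  linarith

end Potential

namespace Run

variable {d N K : ℕ} {X Ω : Type*} [MeasurableSpace X]

/-- The sum of the squared `V⁻¹`-norms of the features of the action of round `t`, where `V` is the
design matrix of the previous rounds. -/
noncomputable def width (mdl : Model d N X) (lam₀ : ℝ) (run : Run d N K X Ω) (t : ℕ) (ω : Ω) : ℝ :=
  ∑ j ∈ run.active t ω, (mdl.feat (run.query t ω) j).ofLp ⬝ᵥ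
    (run.design mdl lam₀ (t - 1) ω)⁻¹ *ᵥ (mdl.feat (run.query t ω) j).ofLp

variable {mdl : Model d N X} {run : Run d N K X Ω} {lam₀ κ : ℝ} {ω : Ω}

lemma width_nonneg (hlam : 0 < lam₀) (t : ℕ) : 0 ≤ run.width mdl lam₀ t ω :=
  Finset.sum_nonneg fun _ _ => quad_inv_nonneg (posDef_design hlam) _

lemma mul_dotProduct_le_quad_design (t : ℕ) (y : Fin d → ℝ) :
    lam₀ * (y ⬝ᵥ y) ≤ y ⬝ᵥ run.design mdl lam₀ t ω *ᵥ y := by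
  rw [quad_design]
  linarith [quad_nonneg (posSemidef_gram (mdl := mdl) (run := run) (t := t) (ω := ω)) y]

lemma feat_dotProduct_le (hm : mdl.Assumptions K κ) (x : X) (j : Fin N) :
    (mdl.feat x j).ofLp ⬝ᵥ (mdl.feat x j).ofLp ≤ 1 := by
  rw [← Model.inner_eq_dotProduct, real_inner_self_eq_norm_sq]
  exact pow_le_one₀ (norm_nonneg _) (hm.norm_feat_le _ _)

lemma width_succ_le (hlam : 0 < lam₀) (hm : mdl.Assumptions K κ) {t : ℕ}
    (hcard : (run.active (t + 1) ω).card ≤ K) :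
    run.width mdl lam₀ (t + 1) ω ≤ (1 + K / lam₀) * (1 + 1 / lam₀) *
      (Real.log (run.design mdl lam₀ (t + 1) ω).det - Real.log (run.design mdl lam₀ t ω).det) := by
  have h := sum_quad_inv_le (posDef_design (run := run) (mdl := mdl) (t := t) (ω := ω) hlam) hlam
    (mul_dotProduct_le_quad_design t) (fun j => (mdl.feat (run.query (t + 1) ω) j).ofLp)
    (fun j => feat_dotProduct_le hm _ j) hcard
  have hdes : run.design mdl lam₀ (t + 1) ω = run.design mdl lam₀ t ω +
      ∑ j ∈ run.active (t + 1) ω, vecMulVec (mdl.feat (run.query (t + 1) ω) j).ofLp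
        (mdl.feat (run.query (t + 1) ω) j).ofLp := by
    rw [design_eq, design_eq, gram, Finset.sum_Icc_succ_top (by omega), ← gram, add_assoc]
  rw [hdes]
  exact h

/-- The increments of the log-determinant telescope, starting from `lam₀ I`. -/
lemma sum_width_le (hlam : 0 < lam₀) (hm : mdl.Assumptions K κ) (t : ℕ)
    (hcard : ∀ i ∈ Finset.Icc 1 t, (run.active i ω).card ≤ K) :
    ∑ i ∈ Finset.Icc 1 t, run.width mdl lam₀ i ω ≤ (1 + K / lam₀) * (1 + 1 / lam₀) *
      (Real.log (run.design mdl lam₀ t ω).det - d * Real.log lam₀) := by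
  induction t with
  | zero =>
    have : run.design mdl lam₀ 0 ω = lam₀ • (1 : Matrix (Fin d) (Fin d) ℝ) := by simp [design]
    simp [this]
  | succ t ih =>
    rw [Finset.sum_Icc_succ_top (by omega)]
    have h1 := ih fun i hi => hcard i (by rw [Finset.mem_Icc] at hi ⊢; omega)
    have h2 := width_succ_le (run := run) (ω := ω) hlam hm (hcard (t + 1) (by simp))
    linarith

end Run

/-! ### Regret of one round of optimistic Thompson sampling -/

section Round

variable {d N K M : ℕ} {X : Type*} [MeasurableSpace X]

/-- The optimistic utilities of the servers under the sampled parameters `θ`. -/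
noncomputable def sampleUtility (mdl : Model d N X) (θ : Fin M → EuclideanSpace ℝ (Fin d)) (x : X)
    (j : Fin N) : ℝ :=
  ⨆ i, inner ℝ (mdl.feat x j) (θ i)

/-- The sum of the `V⁻¹`-norms of the features of an action. -/
noncomputable def norms (mdl : Model d N X) (V : Matrix (Fin d) (Fin d) ℝ) (x : X)
    (S : Finset (Fin N)) : ℝ :=
  ∑ j ∈ S, √((mdl.feat x j).ofLp ⬝ᵥ V⁻¹ *ᵥ (mdl.feat x j).ofLp)

variable (mdl : Model d N X) {V : Matrix (Fin d) (Fin d) ℝ}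

lemma norms_nonneg (x : X) (S : Finset (Fin N)) : 0 ≤ norms mdl V x S :=
  Finset.sum_nonneg fun _ _ => Real.sqrt_nonneg _

lemma norms_sq_le (hV : V.PosDef) (x : X) {S : Finset (Fin N)} (hS : S.card = K) :
    norms mdl V x S ^ 2 ≤
      K * ∑ j ∈ S, (mdl.feat x j).ofLp ⬝ᵥ V⁻¹ *ᵥ (mdl.feat x j).ofLp := by
  have h := sq_sum_le_card_mul_sum_sq (s := S)
    (f := fun j => √((mdl.feat x j).ofLp ⬝ᵥ V⁻¹ *ᵥ (mdl.feat x j).ofLp))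
  simp only [Real.sq_sqrt (quad_inv_nonneg hV _), hS] at h
  exact h

lemma abs_rateOf_sampleUtility_sub_le [NeZero M] (hV : V.PosDef) (μ : EuclideanSpace ℝ (Fin d))
    (θ : Fin M → EuclideanSpace ℝ (Fin d)) (x : X) (S : Finset (Fin N)) :
    |rateOf S (sampleUtility mdl θ x) - mdl.rate x S μ| ≤ √(spread V μ θ) * norms mdl V x S := by
  have hle : ∑ j ∈ S, |sampleUtility mdl θ x j - inner ℝ (mdl.feat x j) μ| ≤
      √(spread V μ θ) * norms mdl V x S := by
    rw [norms, Finset.mul_sum]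
    exact Finset.sum_le_sum fun j _ => abs_iSup_inner_sub_le μ hV _ θ
  rw [mdl.rate_eq_rateOf, abs_le]
  constructor
  · have := rateOf_sub_le S (fun j => inner ℝ (mdl.feat x j) μ) (sampleUtility mdl θ x)
    simp only [abs_sub_comm (inner ℝ _ μ)] at this
    linarith
  · exact (rateOf_sub_le S _ _).trans hle

lemma rate_sub_le (hV : V.PosDef) (θ μ : EuclideanSpace ℝ (Fin d)) (x : X) (S : Finset (Fin N)) :
    mdl.rate x S μ - mdl.rate x S θ ≤
      √((μ - θ).ofLp ⬝ᵥ V *ᵥ (μ - θ).ofLp) * norms mdl V x S := by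
  rw [mdl.rate_eq_rateOf, mdl.rate_eq_rateOf, norms, Finset.mul_sum]
  refine (rateOf_sub_le S _ _).trans (Finset.sum_le_sum fun j _ => ?_)
  rw [← inner_sub_right, Model.inner_eq_dotProduct, mul_comm]
  exact abs_dotProduct_le hV _ _

/-- A half-space of sampled parameters under which the optimistic rate exceeds the true one. -/
lemma rate_le_rateOf_sampleUtility [NeZero M] (x : X) (S : Finset (Fin N))
    (θ : EuclideanSpace ℝ (Fin d)) (s : Fin M → EuclideanSpace ℝ (Fin d))
    (h : 0 ≤ inner ℝ (∑ j ∈ S, Real.exp (inner ℝ (mdl.feat x j) θ) • mdl.feat x j) (s 0 - θ)) :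
    mdl.rate x S θ ≤ rateOf S (sampleUtility mdl s x) := by
  rw [mdl.rate_eq_rateOf]
  refine (rateOf_le_rateOf_of_sum_nonneg S _ (fun j => inner ℝ (mdl.feat x j) (s 0)) ?_).trans
    (rateOf_mono S _ _ fun j _ => ?_)
  · simpa only [sum_inner, real_inner_smul_left, inner_sub_right, mul_sub,
      Finset.sum_sub_distrib] using h
  · exact le_ciSup (f := fun i => inner ℝ (mdl.feat x j) (s i)) (Set.finite_range _).bddAbove 0

variable {mdl}

lemma measurable_rateOf {A : Type*} [MeasurableSpace A] {S : Finset (Fin N)} {u : A → Fin N → ℝ}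
    (hu : ∀ j, Measurable fun a => u a j) : Measurable fun a => rateOf S (u a) := by
  simp only [rateOf]
  fun_prop

variable {Ω β : Type*} [MeasurableSpace Ω] [mβ : MeasurableSpace β] {P : Measure Ω}
  [IsProbabilityMeasure P] {κ : ℝ}

/-- The expected regret of a round of optimistic Thompson sampling, on an event known before the
samples are drawn on which the estimator is accurate. -/
theorem setIntegral_regret_le [NeZero M] (hd : 1 ≤ d) (hKN : K ≤ N) (hm : mdl.Assumptions K κ)
    {I : Ω → β} (hI : Measurable I) {Y : Ω → Fin M → EuclideanSpace ℝ (Fin d)} (hY : Measurable Y)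
    {Q : β → Finset ℤ} (hQ : ∀ q, MeasurableSet {b | Q b = q}) {x : ℤ → β → X}
    (hx : ∀ b, ∀ q ∈ Q b, Measurable (x q)) {est : β → EuclideanSpace ℝ (Fin d)}
    (hest : Measurable est) {V : β → Matrix (Fin d) (Fin d) ℝ}
    (hVm : ∀ i j, Measurable fun b => V b i j) (hV : ∀ b, (V b).PosDef) {r : ℝ} (hr : 0 < r)
    {H : Set β} (hH : MeasurableSet H) (hHQ : ∀ b ∈ H, (Q b).Nonempty)
    (hHerr : ∀ b ∈ H, √((est b - mdl.θstar).ofLp ⬝ᵥ V b *ᵥ (est b - mdl.θstar).ofLp) ≤ 4 * r)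
    (hlaw : ∀ B, MeasurableSet B → ∀ᵐ ω ∂P, ω ∈ I ⁻¹' H → (P⟦Y ⁻¹' B | mβ.comap I⟧) ω =
      (Measure.pi fun _ : Fin M =>
        multivariateGaussian (est (I ω)) (r ^ 2 • (V (I ω))⁻¹)).real B)
    {job : Ω → ℤ} {S : Ω → Finset (Fin N)} (hjob : ∀ ω, I ω ∈ H → job ω ∈ Q (I ω))
    (hS : ∀ ω, I ω ∈ H → (S ω).card = K)
    (hmax : ∀ ω, I ω ∈ H → ∀ q ∈ Q (I ω), ∀ T : Finset (Fin N), T.card = K →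
      rateOf T (sampleUtility mdl (Y ω) (x q (I ω))) ≤
        rateOf (S ω) (sampleUtility mdl (Y ω) (x (job ω) (I ω))))
    {ρ w : Ω → ℝ} (hρ : Integrable ρ P)
    (hρeq : ∀ ω, I ω ∈ H → ρ ω = mdl.rate (x (job ω) (I ω)) (S ω) mdl.θstar)
    (hw : Integrable w P) (hw0 : ∀ ω, 0 ≤ w ω)
    (hweq : ∀ ω, I ω ∈ H → w ω = ∑ j ∈ S ω, (mdl.feat (x (job ω) (I ω)) j).ofLp ⬝ᵥ
      (V (I ω))⁻¹ *ᵥ (mdl.feat (x (job ω) (I ω)) j).ofLp) {b : ℝ} (hb : 0 < b) :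
    ∫ ω in I ⁻¹' H, (maxOver K (Q (I ω)) (fun q T => mdl.rate (x q (I ω)) T mdl.θstar) - ρ ω) ∂P ≤
      (1 / optimismProb + 4) * (2 * (M * d * r ^ 2) / b + b * K / 2 * ∫ ω, w ω ∂P) := by
  have hIH : MeasurableSet (I ⁻¹' H) := hI hH
  have hM : (1 : ℝ) ≤ M := by exact_mod_cast NeZero.one_le
  have hd' : (1 : ℝ) ≤ d := by exact_mod_cast hd
  -- `z ^ 2` is the mean of the spread of a fresh family, so `z` dominates both the mean
  -- `V`-distance and the radius `r`.
  set z := √(M * d * r ^ 2)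
  have hz : 0 < z := Real.sqrt_pos.2 (by positivity)
  have hz2 : z ^ 2 = M * d * r ^ 2 := Real.sq_sqrt (by positivity)
  have hrz : r ≤ z := by
    refine Real.le_sqrt_of_sq_le (le_mul_of_one_le_left (sq_nonneg _) ?_)
    nlinarith
  set ν : Ω → Measure (Fin M → EuclideanSpace ℝ (Fin d)) := fun ω => Measure.pi fun _ =>
    multivariateGaussian (est (I ω)) (r ^ 2 • (V (I ω))⁻¹) with hν
  have hκ := ae_condDistrib_eq hI hY (ν := ν) (H := I ⁻¹' H) hlaw
  set φ : β × (Fin M → EuclideanSpace ℝ (Fin d)) → ℝ := fun p =>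
    maxOver K (Q p.1) fun q T => rateOf T (sampleUtility mdl p.2 (x q p.1)) with hφ_def
  have hφ : Measurable φ := by
    refine measurable_maxOver K (A := β × (Fin M → EuclideanSpace ℝ (Fin d)))
      (Q := fun p => Q p.1) (fun q => measurable_fst (hQ q))
      (g := fun q T p => rateOf T (sampleUtility mdl p.2 (x q p.1))) fun p q hq T => ?_
    refine measurable_rateOf fun j => ?_
    simp only [sampleUtility]
    have h1 : Measurable fun p : β × (Fin M → EuclideanSpace ℝ (Fin d)) =>
        mdl.feat (x q p.1) j := (hm.measurable_feat j).comp ((hx _ q hq).comp measurable_fst)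
    exact Measurable.iSup fun i => h1.inner (by fun_prop)
  have hφ0 (p) : 0 ≤ φ p := maxOver_nonneg fun _ _ => rateOf_nonneg _ _
  have hφ1 (p) : φ p ≤ 1 := maxOver_le zero_le_one fun _ _ _ _ => rateOf_le_one _ _
  set R : β → ℝ := fun b => maxOver K (Q b) fun q T => mdl.rate (x q b) T mdl.θstar
  have hR : Measurable R := measurable_maxOver K hQ
    (g := fun q T b => mdl.rate (x q b) T mdl.θstar)
    fun b q hq T => (Model.measurable_rate hm T _).comp (hx b q hq)
  have hR0 (b) : 0 ≤ R b := maxOver_nonneg fun _ _ => mdl.rate_nonneg _ _ _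
  have hR1 (b) : R b ≤ 1 := maxOver_le zero_le_one fun _ _ _ _ => mdl.rate_le_one _ _ _
  set sp : β × (Fin M → EuclideanSpace ℝ (Fin d)) → ℝ := fun p =>
    spread (V p.1) (est p.1) p.2 with hsp_def
  have hsp : Measurable sp := measurable_spread (fun i j => (hVm i j).comp measurable_fst)
    (hest.comp measurable_fst) measurable_snd
  have hsp0 (p) : 0 ≤ sp p := spread_nonneg (hV _) _ _
  have hsp_le : ∫⁻ ω in I ⁻¹' H, ENNReal.ofReal (sp (I ω, Y ω)) ∂P ≤ ENNReal.ofReal (z ^ 2) := by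
    have h1 := lintegral_comp_prodMk (P := P) hI hY
      (f := (Prod.fst ⁻¹' H).indicator fun p => ENNReal.ofReal (sp p))
      (hsp.ennreal_ofReal.indicator (measurable_fst hH))
    rw [← lintegral_indicator hIH]
    refine h1.trans_le ?_
    calc _ ≤ ∫⁻ ω, ENNReal.ofReal (z ^ 2) ∂P := by
          refine lintegral_mono_ae ?_
          filter_upwards [hκ] with ω hω
          by_cases hωH : I ω ∈ H
          · rw [hω hωH, hz2, ← lintegral_spread (est (I ω)) r (hV (I ω))]
            refine lintegral_mono fun y => ?_
            exact Set.indicator_le_self _ _ _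
          · have h0 (y : Fin M → EuclideanSpace ℝ (Fin d)) :
                (Prod.fst ⁻¹' H).indicator (fun p => ENNReal.ofReal (sp p)) (I ω, y) = 0 :=
              Set.indicator_of_notMem (s := Prod.fst ⁻¹' H) (a := (I ω, y)) hωH _
            simp [h0]
      _ = _ := by simp
  have hspm : Measurable fun ω => sp (I ω, Y ω) := hsp.comp (hI.prodMk hY)
  have hspi : IntegrableOn (fun ω => sp (I ω, Y ω)) (I ⁻¹' H) P := by
    refine ⟨hspm.aestronglyMeasurable, ?_⟩
    rw [hasFiniteIntegral_iff_ofReal (Filter.Eventually.of_forall fun ω => hsp0 _)]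
    exact hsp_le.trans_lt ENNReal.ofReal_lt_top
  have hsp_int : ∫ ω in I ⁻¹' H, sp (I ω, Y ω) ∂P ≤ z ^ 2 := by
    rw [integral_eq_lintegral_of_nonneg_ae (Filter.Eventually.of_forall fun ω => hsp0 _)
      hspm.aestronglyMeasurable]
    exact ENNReal.toReal_le_of_le_ofReal (sq_nonneg _) hsp_le
  -- The separated form of `(√spread + z) * W`: a second moment of the samples and the squared
  -- width, weighted by the free parameter `b`. The norm and the spread are dependent, and this
  -- avoids the mean of their product.
  set U : Ω → ℝ := fun ω => (sp (I ω, Y ω) + z ^ 2) / b + b * K / 2 * w ω with hU_def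
  have hU0 (ω) : 0 ≤ U ω := by
    have h1 := hsp0 (I ω, Y ω)
    have h2 := hw0 ω
    positivity
  have hspz : IntegrableOn (fun ω => sp (I ω, Y ω) + z ^ 2) (I ⁻¹' H) P :=
    hspi.add (integrable_const _)
  have hwi : IntegrableOn (fun ω => b * K / 2 * w ω) (I ⁻¹' H) P := hw.integrableOn.const_mul _
  have hUi : IntegrableOn U (I ⁻¹' H) P := (hspz.div_const b).add hwi
  have hU_int : ∫ ω in I ⁻¹' H, U ω ∂P ≤
      2 * (M * d * r ^ 2) / b + b * K / 2 * ∫ ω, w ω ∂P := by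
    have h1 : ∫ ω in I ⁻¹' H, U ω ∂P = (∫ ω in I ⁻¹' H, sp (I ω, Y ω) ∂P +
        P.real (I ⁻¹' H) * z ^ 2) / b + b * K / 2 * ∫ ω in I ⁻¹' H, w ω ∂P := by
      refine (integral_add (hspz.div_const b) hwi).trans ?_
      rw [integral_div, integral_add hspi (integrable_const _),
        integral_const_mul]
      simp
    have h2 : ∫ ω in I ⁻¹' H, w ω ∂P ≤ ∫ ω, w ω ∂P :=
      setIntegral_le_integral hw (Filter.Eventually.of_forall hw0)
    have h3 : P.real (I ⁻¹' H) * z ^ 2 ≤ z ^ 2 :=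
      mul_le_of_le_one_left (sq_nonneg _) measureReal_le_one
    rw [h1, ← hz2]
    gcongr
    linarith
  set W : Ω → ℝ := fun ω => norms mdl (V (I ω)) (x (job ω) (I ω)) (S ω) with hW_def
  have hW0 (ω) : 0 ≤ W ω := norms_nonneg _ _ _
  have hWU (ω) (hω : I ω ∈ H) : (√(sp (I ω, Y ω)) + z) * W ω ≤ U ω := by
    have h1 : W ω ^ 2 ≤ K * w ω := by
      rw [hweq ω hω]; exact norms_sq_le mdl (hV _) _ (hS ω hω)
    have h2 := Real.sq_sqrt (hsp0 (I ω, Y ω))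
    set s := √(sp (I ω, Y ω))
    have h3 : U ω = ((s ^ 2 + z ^ 2) + b ^ 2 / 2 * (K * w ω)) / b := by
      simp only [hU_def]; rw [h2]; field_simp
    rw [h3, le_div_iff₀ hb]
    nlinarith [sq_nonneg ((s + z) - b * W ω), sq_nonneg (s - z),
      mul_le_mul_of_nonneg_left h1 (by positivity : 0 ≤ b ^ 2 / 2)]
  have hφeq (ω) (hω : I ω ∈ H) :
      φ (I ω, Y ω) = rateOf (S ω) (sampleUtility mdl (Y ω) (x (job ω) (I ω))) :=
    le_antisymm (maxOver_le (rateOf_nonneg _ _) fun q hq T hT => hmax ω hω q hq T hT)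
      (le_maxOver (fun q T => rateOf T (sampleUtility mdl (Y ω) (x q (I ω)))) (hjob ω hω)
        (hS ω hω))
  have hdev (ω) (hω : I ω ∈ H) (y : Fin M → EuclideanSpace ℝ (Fin d)) :=
    abs_le.1 (abs_rateOf_sampleUtility_sub_le mdl (hV (I ω)) (est (I ω)) y (x (job ω) (I ω)) (S ω))
  have hopt : ∀ᵐ ω ∂P, I ω ∈ H →
      optimismProb ≤ (condDistrib Y I P (I ω)).real {y | R (I ω) ≤ φ (I ω, y)} := by
    -- The maximizing pair for the true rates is known before the samples are drawn. Hence its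
    -- half-space is fixed and no union over pairs is needed.
    filter_upwards [hκ] with ω hω hωH
    obtain ⟨q, hq, T, hT, hRT⟩ := exists_eq_maxOver hKN (hHQ _ hωH)
      fun q T => mdl.rate (x q (I ω)) T mdl.θstar
    rw [hω hωH]
    refine (optimismProb_le_pi (est (I ω)) (hV (I ω)) hr (0 : Fin M) mdl.θstar
      (∑ j ∈ T, Real.exp (inner ℝ (mdl.feat (x q (I ω)) j) mdl.θstar) • mdl.feat (x q (I ω)) j)
      (hHerr _ hωH)).trans (measureReal_mono fun y hy => ?_)
    have h1 := rate_le_rateOf_sampleUtility mdl (x q (I ω)) T mdl.θstar y hy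
    rw [← hRT] at h1
    exact h1.trans
      (le_maxOver (fun q T => rateOf T (sampleUtility mdl y (x q (I ω)))) hq hT)
  have hmean : ∀ᵐ ω ∂P, I ω ∈ H →
      φ (I ω, Y ω) - U ω ≤ ∫ y, φ (I ω, y) ∂condDistrib Y I P (I ω) := by
    filter_upwards [hκ] with ω hω hωH
    rw [hω hωH]
    have hφi : Integrable (fun y => φ (I ω, y)) (ν ω) :=
      Integrable.of_bound (hφ.comp measurable_prodMk_left).aestronglyMeasurable 1
        (Filter.Eventually.of_forall fun y => by
          rw [Real.norm_of_nonneg (hφ0 _)]; exact hφ1 _)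
    -- The realized action is kept while the samples are redrawn. It remains a competitor in the
    -- maximum, which bounds the conditional mean of `φ` from below by the action's rate at the
    -- estimator minus `z * W`.
    have h1 := sub_mul_le_integral (ν := ν ω) (s := fun y => sp (I ω, y))
      (hsp.comp measurable_prodMk_left) (fun y => hsp0 _) hz
      (by rw [hz2]; exact lintegral_spread (est (I ω)) r (hV (I ω)))
      (L := mdl.rate (x (job ω) (I ω)) (S ω) (est (I ω))) (hW0 ω) hφi fun y => by
        have h2 := (hdev ω hωH y).1
        have h3 : rateOf (S ω) (sampleUtility mdl y (x (job ω) (I ω))) ≤ φ (I ω, y) :=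
          le_maxOver (fun q T => rateOf T (sampleUtility mdl y (x q (I ω)))) (hjob ω hωH)
            (hS ω hωH)
        simp only [hsp_def, hW_def]
        linarith
    refine le_trans ?_ h1
    have h4 := (hdev ω hωH (Y ω)).2
    have h5 := hWU ω hωH
    rw [hφeq ω hωH]
    simp only [hsp_def, hW_def] at h4 h5 ⊢
    linarith
  have hshort := mul_setIntegral_sub_le hI hY hH hφ hφ0 hφ1 hR hR0 hR1 hUi hU0 hopt
    optimismProb_pos.le hmean
  -- The loss from the samples to the estimator is `√spread * W` and from the estimator to `θ*` it
  -- is `4 r W ≤ 4 z W`; together at most `4 U`.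
  have hest_le : ∫ ω in I ⁻¹' H, (φ (I ω, Y ω) - ρ ω) ∂P ≤ 4 * ∫ ω in I ⁻¹' H, U ω ∂P := by
    rw [← integral_const_mul]
    have hφi : IntegrableOn (fun ω => φ (I ω, Y ω)) (I ⁻¹' H) P :=
      Integrable.of_bound (hφ.comp (hI.prodMk hY)).aestronglyMeasurable 1
        (Filter.Eventually.of_forall fun ω => by
          rw [Real.norm_of_nonneg (hφ0 _)]; exact hφ1 _)
    refine setIntegral_mono_on (hφi.sub hρ.integrableOn) (hUi.const_mul 4) hIH fun ω hω => ?_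
    have h1 := (hdev ω hω (Y ω)).2
    have h2 := rate_sub_le mdl (hV (I ω)) mdl.θstar (est (I ω)) (x (job ω) (I ω)) (S ω)
    have h3 := mul_le_mul_of_nonneg_right (hHerr _ hω) (hW0 ω)
    have h4 := hWU ω hω
    have h5 := mul_le_mul_of_nonneg_right hrz (hW0 ω)
    have h6 := mul_nonneg (Real.sqrt_nonneg (sp (I ω, Y ω))) (hW0 ω)
    rw [hφeq ω hω, hρeq ω hω]
    simp only [hsp_def, hW_def] at h1 h2 h3 h4 h5 h6 ⊢
    linarith
  have hsplit : ∫ ω in I ⁻¹' H, (R (I ω) - ρ ω) ∂P =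
      ∫ ω in I ⁻¹' H, (R (I ω) - φ (I ω, Y ω)) ∂P + ∫ ω in I ⁻¹' H, (φ (I ω, Y ω) - ρ ω) ∂P := by
    have hφi : IntegrableOn (fun ω => φ (I ω, Y ω)) (I ⁻¹' H) P :=
      Integrable.of_bound (hφ.comp (hI.prodMk hY)).aestronglyMeasurable 1
        (Filter.Eventually.of_forall fun ω => by
          rw [Real.norm_of_nonneg (hφ0 _)]; exact hφ1 _)
    have hRi : IntegrableOn (fun ω => R (I ω)) (I ⁻¹' H) P :=
      Integrable.of_bound (hR.comp hI).aestronglyMeasurable 1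
        (Filter.Eventually.of_forall fun ω => by
          rw [Real.norm_of_nonneg (hR0 _)]; exact hR1 _)
    refine Eq.trans ?_ (integral_add (hRi.sub hφi) (hφi.sub hρ.integrableOn))
    refine integral_congr_ae (Filter.Eventually.of_forall fun ω => ?_)
    simp
  have hq := optimismProb_pos
  have h1 : ∫ ω in I ⁻¹' H, (R (I ω) - φ (I ω, Y ω)) ∂P ≤
      1 / optimismProb * ∫ ω in I ⁻¹' H, U ω ∂P := by
    rw [div_mul_eq_mul_div, one_mul, le_div_iff₀ hq, mul_comm]
    exact hshort
  calc ∫ ω in I ⁻¹' H, (R (I ω) - ρ ω) ∂P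
      ≤ (1 / optimismProb + 4) * ∫ ω in I ⁻¹' H, U ω ∂P := by
        rw [hsplit, add_mul]; exact add_le_add h1 hest_le
    _ ≤ _ := by gcongr

end Round

lemma radius_pos {d K : ℕ} {κ lam₀ : ℝ} (hκ : 0 < κ) (hlam : 0 < lam₀) (l : ℕ) :
    0 < radius d K κ lam₀ l := by
  rw [radius]
  positivity

lemma exploreProb_le (c₁ : ℝ) (t : ℕ) : exploreProb c₁ t ≤ c₁ / √((t : ℝ) + 1) := min_le_right _ _

lemma sum_dotProduct_mulVec_eq {ι : Type*} {n : ℕ} (s : Finset ι) (W : Matrix (Fin n) (Fin n) ℝ)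
    (f : ι → EuclideanSpace ℝ (Fin n)) : ∑ j ∈ s, (f j).ofLp ⬝ᵥ W *ᵥ (f j).ofLp =
      ∑ a, ∑ b, W a b * ∑ j ∈ s, f j a * f j b := by
  simp only [dotProduct, mulVec, Finset.mul_sum]
  rw [Finset.sum_comm]
  refine Finset.sum_congr rfl fun a _ => ?_
  rw [Finset.sum_comm]
  exact Finset.sum_congr rfl fun b _ => Finset.sum_congr rfl fun j _ => by ring

/-! ### Expected regret of a round of the algorithm -/

namespace Run

variable {d N K : ℕ} {X Ω : Type*} [MeasurableSpace X] {mdl : Model d N X} {run : Run d N K X Ω}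

/-- The departure rate of the action of round `t`, zero if the queue is empty. -/
noncomputable def reward (mdl : Model d N X) (run : Run d N K X Ω) (t : ℕ) (ω : Ω) : ℝ :=
  if run.queue t ω = ∅ then 0 else mdl.rate (run.query t ω) (run.asst t ω) mdl.θstar

lemma reward_nonneg (t : ℕ) (ω : Ω) : 0 ≤ run.reward mdl t ω := by
  rw [reward]
  split_ifs
  · exact le_rfl
  · exact mdl.rate_nonneg _ _ _

lemma reward_le_one (t : ℕ) (ω : Ω) : run.reward mdl t ω ≤ 1 := by
  rw [reward]
  split_ifs
  · exact zero_le_one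
  · exact mdl.rate_le_one _ _ _

lemma queueRegret_eq (t : ℕ) (ω : Ω) : run.queueRegret mdl t ω =
    maxOver K (run.queue t ω) (fun q S => mdl.rate (run.ctx q ω) S mdl.θstar) -
      run.reward mdl t ω := by
  rw [queueRegret, reward]
  split_ifs with hq
  · simp [hq, maxOver]
  · rfl

lemma queueRegret_le_one (t : ℕ) (ω : Ω) : run.queueRegret mdl t ω ≤ 1 := by
  rw [queueRegret_eq]
  have h1 : maxOver K (run.queue t ω) (fun q S => mdl.rate (run.ctx q ω) S mdl.θstar) ≤ 1 :=
    maxOver_le zero_le_one fun _ _ _ _ => mdl.rate_le_one _ _ _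
  linarith [run.reward_nonneg (mdl := mdl) t ω]

lemma abs_queueRegret_le (t : ℕ) (ω : Ω) : |run.queueRegret mdl t ω| ≤ 1 := by
  refine abs_le.2 ⟨?_, queueRegret_le_one t ω⟩
  rw [queueRegret_eq]
  have h1 : 0 ≤ maxOver K (run.queue t ω) (fun q S => mdl.rate (run.ctx q ω) S mdl.θstar) :=
    maxOver_nonneg fun _ _ => mdl.rate_nonneg _ _ _
  linarith [run.reward_le_one (mdl := mdl) t ω]

lemma abs_routingRegret_le (t : ℕ) (ω : Ω) : |run.routingRegret mdl t ω| ≤ 1 := by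
  rw [routingRegret]
  split_ifs
  · simp
  · have h1 := mdl.rate_nonneg (run.query t ω) (run.asst t ω) mdl.θstar
    have h2 := mdl.rate_le_one (run.query t ω) (run.asst t ω) mdl.θstar
    rw [Model.bestRate_eq]
    have h3 : 0 ≤ maxOver K {0} fun _ S => mdl.rate (run.query t ω) S mdl.θstar :=
      maxOver_nonneg fun _ _ => mdl.rate_nonneg _ _ _
    have h4 : maxOver K {0} (fun _ S => mdl.rate (run.query t ω) S mdl.θstar) ≤ 1 :=
      maxOver_le zero_le_one fun _ _ _ _ => mdl.rate_le_one _ _ _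
    exact abs_le.2 ⟨by linarith, by linarith⟩

/-- The information on which the samples of round `t + 1` are drawn. -/
abbrev known (run : Run d N K X Ω) (t : ℕ) : MeasurableSpace Ω :=
  run.pre (t + 1) ⊔ MeasurableSpace.comap (run.coin t) ⊤

namespace IsACQB

variable [mΩ : MeasurableSpace Ω] {P : Measure Ω}
  {κ lam₀ c₁ : ℝ} {enum : ℕ → Finset (Fin N)}

lemma routingRegret_le_queueRegret (h : run.IsACQB P mdl κ lam₀ c₁ enum) {t : ℕ} (ht : 1 ≤ t)
    (ω : Ω) : run.routingRegret mdl t ω ≤ run.queueRegret mdl t ω := by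
  rw [routingRegret, queueRegret]
  split_ifs with hq
  · exact le_rfl
  · rw [Model.bestRate_eq, Model.bestRateQueue_eq]
    gcongr
    refine maxOver_le (maxOver_nonneg fun _ _ => mdl.rate_nonneg _ _ _) fun _ _ S hS => ?_
    exact le_maxOver (fun q S => mdl.rate (run.ctx q ω) S mdl.θstar) (h.job_mem ht hq) hS

lemma measurable_reward (h : run.IsACQB P mdl κ lam₀ c₁ enum) (hm : mdl.Assumptions K κ)
    {t : ℕ} (ht : 1 ≤ t) : Measurable (run.reward mdl t) :=
  (h.measurable_action ht 0 fun S => Model.measurable_rate hm S _).mono (h.mid_le ht) le_rfl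

lemma measurable_queueRegret (h : run.IsACQB P mdl κ lam₀ c₁ enum) (hm : mdl.Assumptions K κ)
    {t : ℕ} (ht : 1 ≤ t) : Measurable (run.queueRegret mdl t) := by
  have h1 := measurable_maxOver K (Q := run.queue t)
    (fun q => h.pre_le t ht _ (h.measurable_queue t ht q))
    (g := fun q S ω => mdl.rate (run.ctx q ω) S mdl.θstar) fun ω q hq S =>
      (Model.measurable_rate hm S _).comp
        ((h.measurable_ctx q t ht (h.queue_lt ht ω q hq)).mono (h.pre_le t ht) le_rfl)
  convert h1.sub (h.measurable_reward hm ht) using 1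
  ext ω
  rw [queueRegret_eq]
  rfl

lemma measurable_routingRegret (h : run.IsACQB P mdl κ lam₀ c₁ enum) (hm : mdl.Assumptions K κ)
    {t : ℕ} (ht : 1 ≤ t) : Measurable (run.routingRegret mdl t) :=
  (h.measurable_action ht 0 (F := fun S x => mdl.bestRate K x - mdl.rate x S mdl.θstar)
    fun S => (Model.measurable_bestRate hm).sub (Model.measurable_rate hm S _)).mono
    (h.mid_le ht) le_rfl

lemma measurable_width (h : run.IsACQB P mdl κ lam₀ c₁ enum) (hm : mdl.Assumptions K κ) (t : ℕ) :
    Measurable (run.width mdl lam₀ (t + 1)) := by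
  have ht : 1 ≤ t + 1 := by omega
  have h1 (a b : Fin d) : Measurable fun ω => ∑ j ∈ run.active (t + 1) ω,
      mdl.feat (run.query (t + 1) ω) j a * mdl.feat (run.query (t + 1) ω) j b := by
    refine Measurable.mono ?_ (h.mid_le ht) le_rfl
    refine h.measurable_sum_active ht (F := fun S x j => mdl.feat x j a * mdl.feat x j b)
      fun S j => ?_
    have := hm.measurable_feat j
    fun_prop
  have h2 (a b : Fin d) : Measurable fun ω => (run.design mdl lam₀ t ω)⁻¹ a b :=
    measurable_inv_apply (fun a b => (h.measurable_design hm t a b).mono (h.pre_le _ ht) le_rfl) a b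
  have h3 : run.width mdl lam₀ (t + 1) = fun ω => ∑ a, ∑ b, (run.design mdl lam₀ t ω)⁻¹ a b *
      ∑ j ∈ run.active (t + 1) ω,
        mdl.feat (run.query (t + 1) ω) j a * mdl.feat (run.query (t + 1) ω) j b := by
    funext ω
    exact sum_dotProduct_mulVec_eq _ _ _
  rw [h3]
  exact Finset.measurable_fun_sum _ fun a _ => Finset.measurable_fun_sum _ fun b _ =>
    (h2 a b).mul (h1 a b)

lemma width_le (h : run.IsACQB P mdl κ lam₀ c₁ enum) (hm : mdl.Assumptions K κ) (hKN : K ≤ N)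
    (hlam : 0 < lam₀) {t : ℕ} (ht : 1 ≤ t) (ω : Ω) : run.width mdl lam₀ t ω ≤ K * (1 / lam₀) := by
  calc run.width mdl lam₀ t ω ≤ ∑ j ∈ run.active t ω, 1 / lam₀ :=
        Finset.sum_le_sum fun j _ => quad_inv_le_of_le (posDef_design hlam) hlam
          (mul_dotProduct_le_quad_design _) (feat_dotProduct_le hm _ _)
    _ = (run.active t ω).card * (1 / lam₀) := by simp
    _ ≤ K * (1 / lam₀) := by
        gcongr
        exact h.card_active_le ht hKN ω

variable [IsProbabilityMeasure P]

lemma integrable_width (h : run.IsACQB P mdl κ lam₀ c₁ enum) (hm : mdl.Assumptions K κ)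
    (hKN : K ≤ N) (hlam : 0 < lam₀) (t : ℕ) : Integrable (run.width mdl lam₀ (t + 1)) P :=
  Integrable.of_bound (h.measurable_width hm t).aestronglyMeasurable (K * (1 / lam₀))
    (Filter.Eventually.of_forall fun ω => by
      rw [Real.norm_of_nonneg (width_nonneg hlam _)]
      exact h.width_le hm hKN hlam (by omega) ω)

lemma integrable_queueRegret (h : run.IsACQB P mdl κ lam₀ c₁ enum) (hm : mdl.Assumptions K κ)
    {t : ℕ} (ht : 1 ≤ t) : Integrable (run.queueRegret mdl t) P :=
  Integrable.of_bound (h.measurable_queueRegret hm ht).aestronglyMeasurable 1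
    (Filter.Eventually.of_forall fun ω => abs_queueRegret_le t ω)

lemma integrable_routingRegret (h : run.IsACQB P mdl κ lam₀ c₁ enum) (hm : mdl.Assumptions K κ)
    {t : ℕ} (ht : 1 ≤ t) : Integrable (run.routingRegret mdl t) P :=
  Integrable.of_bound (h.measurable_routingRegret hm ht).aestronglyMeasurable 1
    (Filter.Eventually.of_forall fun ω => abs_routingRegret_le t ω)

/-- Averaging the conditional law of the coin; exploration requires the coin to show heads. -/
lemma measureReal_explores_le (h : run.IsACQB P mdl κ lam₀ c₁ enum) (t : ℕ) :
    P.real {ω | run.Explores (t + 1) ω} ≤ c₁ / √((t : ℝ) + 1) := by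
  have ht : 1 ≤ t + 1 := by omega
  have hcoin : MeasurableSet {ω | run.coin t ω = true} :=
    h.mid_le ht _ (h.measurable_coin t (MeasurableSet.singleton true))
  have h1 : ∫ ω, (P⟦{ω' | run.coin t ω' = true} | run.pre (t + 1)⟧) ω ∂P =
      ∫ ω, exploreProb c₁ t ∂P := integral_congr_ae (h.coin_law (t + 1) ht)
  rw [integral_condExp (h.pre_le _ ht), integral_indicator_const _ hcoin] at h1
  simp only [smul_eq_mul, mul_one, integral_const, probReal_univ, one_mul] at h1
  calc P.real {ω | run.Explores (t + 1) ω} ≤ P.real {ω | run.coin t ω = true} :=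
        measureReal_mono fun ω hω => hω.2
    _ ≤ c₁ / √((t : ℝ) + 1) := h1.trans_le (exploreProb_le _ _)

/-- The event that the confidence ellipsoid at the end of round `t` misses the true parameter. -/
def missSet (mdl : Model d N X) (κ lam₀ : ℝ) (run : Run d N K X Ω) (t : ℕ) : Set Ω :=
  {ω | 4 * radius d K κ lam₀ t < √((run.est t ω - mdl.θstar).ofLp ⬝ᵥ
    run.design mdl lam₀ t ω *ᵥ (run.est t ω - mdl.θstar).ofLp)}

omit [IsProbabilityMeasure P] in
lemma measurableSet_missSet (h : run.IsACQB P mdl κ lam₀ c₁ enum) (hm : mdl.Assumptions K κ)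
    (t : ℕ) : MeasurableSet[run.pre (t + 1)] (missSet mdl κ lam₀ run t) := by
  have h1 := h.measurable_est t
  have h2 := h.measurable_design hm t
  have hf : Measurable[run.pre (t + 1)] fun ω =>
      √((run.est t ω - mdl.θstar).ofLp ⬝ᵥ
        run.design mdl lam₀ t ω *ᵥ (run.est t ω - mdl.θstar).ofLp) := by
    have h3 (a : Fin d) : Measurable[run.pre (t + 1)] fun ω => (run.est t ω - mdl.θstar).ofLp a :=
      (by fun_prop : Measurable fun θ : EuclideanSpace ℝ (Fin d) =>
        (θ - mdl.θstar).ofLp a).comp h1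
    refine Real.continuous_sqrt.measurable.comp ?_
    refine Finset.measurable_fun_sum _ fun a _ => (h3 a).mul ?_
    exact Finset.measurable_fun_sum (f := fun b ω => run.design mdl lam₀ t ω a b *
      (run.est t ω - mdl.θstar).ofLp b) Finset.univ fun b _ => (h2 a b).mul (h3 b)
  exact hf measurableSet_Ioi

lemma measureReal_missSet_le (h : run.IsACQB P mdl κ lam₀ c₁ enum) (hm : mdl.Assumptions K κ)
    (hK : 1 ≤ K) (hKN : K ≤ N) (hd : 1 ≤ d) (hκ : 0 < κ) (hlam : 0 < lam₀) (t : ℕ) :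
    P.real (missSet mdl κ lam₀ run t) ≤ 4 / √((t : ℝ) + 1) := by
  have hs : √((t : ℝ) + 1) ^ 2 = t + 1 := Real.sq_sqrt (by positivity)
  have hs0 : 0 < √((t : ℝ) + 1) := Real.sqrt_pos.2 (by positivity)
  rcases Nat.eq_zero_or_pos t with rfl | ht
  -- No concentration is available at `t = 0`; there the bound reads `4`.
  · refine measureReal_le_one.trans ?_
    norm_num
  · have ht' : (1 : ℝ) ≤ t := by exact_mod_cast ht
    have h1 : P.real (missSet mdl κ lam₀ run t) ≤ 1 / (t : ℝ) ^ 2 :=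
      ENNReal.toReal_le_of_le_ofReal (by positivity)
        (h.measure_error_le hm hK hKN hd hκ hlam ht)
    refine h1.trans ?_
    rw [div_le_div_iff₀ (by positivity) hs0]
    have h2 : √((t : ℝ) + 1) ≤ t + 1 := by
      rw [Real.sqrt_le_left (by positivity)]
      nlinarith
    nlinarith

/-- The expected regret of a single round. -/
lemma integral_queueRegret_le (h : run.IsACQB P mdl κ lam₀ c₁ enum) (hm : mdl.Assumptions K κ)
    (hK : 1 ≤ K) (hKN : K ≤ N) (hd : 1 ≤ d) (hκ : 0 < κ) (hlam : 0 < lam₀) (t : ℕ)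
    {b : ℝ} (hb : 0 < b) :
    ∫ ω, run.queueRegret mdl (t + 1) ω ∂P ≤ (c₁ + 4) / √((t : ℝ) + 1) +
      (1 / optimismProb + 4) * (2 * (sampleSize K * d * radius d K κ lam₀ t ^ 2) / b +
        b * K / 2 * ∫ ω, run.width mdl lam₀ (t + 1) ω ∂P) := by
  have ht : 1 ≤ t + 1 := by omega
  have : NeZero (sampleSize K) := ⟨(sampleSize_pos hK).ne'⟩
  have hpre : run.pre (t + 1) ≤ run.known t := le_sup_left
  have hGle : run.known t ≤ mΩ :=
    (sup_le (h.pre_le_mid _ ht) (h.measurable_coin t).comap_le).trans (h.mid_le ht)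
  set E := {ω | run.Explores (t + 1) ω}
  set B := missSet mdl κ lam₀ run t
  set D := {ω | run.queue (t + 1) ω ≠ ∅} with hD
  have hEm : MeasurableSet[run.known t] E := by
    have h1 : MeasurableSet[run.known t] {ω | run.arr t ω = true} :=
      hpre _ (h.measurable_arr t (MeasurableSet.singleton true))
    have h2 : MeasurableSet[run.known t] {ω | run.coin t ω = true} := by
      have h3 : MeasurableSet[MeasurableSpace.comap (run.coin t) ⊤] {ω | run.coin t ω = true} :=
        ⟨{true}, trivial, rfl⟩
      exact le_sup_right (a := run.pre (t + 1)) _ h3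
    exact h1.inter h2
  have hBm : MeasurableSet[run.known t] B := hpre _ (h.measurableSet_missSet hm t)
  have hDm : MeasurableSet[run.known t] D := hpre _ (h.measurableSet_queue_ne ht)
  -- All three conditions are known before the samples of the round are drawn, so the conditional
  -- sampling law can be used on `H`.
  set H := D \ (E ∪ B)
  have hHm : MeasurableSet[run.known t] H := hDm.diff (hEm.union hBm)
  have hreg := h.integrable_queueRegret hm ht
  have hround : ∫ ω in H, run.queueRegret mdl (t + 1) ω ∂P ≤
      (1 / optimismProb + 4) * (2 * (sampleSize K * d * radius d K κ lam₀ t ^ 2) / b +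
        b * K / 2 * ∫ ω, run.width mdl lam₀ (t + 1) ω ∂P) := by
    -- The conditioning variable is the identity into `Ω` equipped with the smaller σ-algebra
    -- `run.known t`, so that its generated σ-algebra is exactly the available information.
    have key := setIntegral_regret_le (mβ := run.known t) (P := P) (M := sampleSize K) (I := id) hd hKN hm
      (measurable_id'' hGle) (Y := run.sample (t + 1))
      ((h.measurable_sample _ ht).mono (h.mid_le ht) le_rfl) (Q := run.queue (t + 1))
      (fun q => hpre _ (h.measurable_queue _ ht q)) (x := run.ctx)
      (fun ω q hq => (h.measurable_ctx q _ ht (h.queue_lt ht ω q hq)).mono hpre le_rfl)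
      (est := run.est t) ((h.measurable_est t).mono hpre le_rfl)
      (V := run.design mdl lam₀ t) (fun i j => (h.measurable_design hm t i j).mono hpre le_rfl)
      (fun ω => posDef_design hlam) (radius_pos (d := d) (K := K) hκ hlam t) hHm
      (fun ω hω => Finset.nonempty_iff_ne_empty.2 hω.1)
      (fun ω hω => not_lt.1 fun hlt => hω.2 (Or.inr hlt))
      (fun A hA => by
        rw [MeasurableSpace.comap_id]
        filter_upwards [h.sample_law (t + 1) ht A hA] with ω hω hωH
        exact hω fun hex => hωH.2 (Or.inl hex))
      (job := run.job (t + 1)) (S := run.asst (t + 1))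
      (fun ω hω => h.job_mem ht hω.1) (fun ω hω => h.card_asst ht hKN hω.1)
      (fun ω hω q hq T hT => h.opt_max _ ht ω (fun hex => hω.2 (Or.inl hex)) q hq T hT)
      (ρ := run.reward mdl (t + 1)) (w := run.width mdl lam₀ (t + 1))
      (Integrable.of_bound (h.measurable_reward hm ht).aestronglyMeasurable 1
        (Filter.Eventually.of_forall fun ω => by
          rw [Real.norm_of_nonneg (reward_nonneg _ _)]; exact reward_le_one _ _))
      (fun ω hω => if_neg hω.1) (h.integrable_width hm hKN hlam t)
      (fun ω => width_nonneg hlam _)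
      (fun ω hω => by
        have : run.active (t + 1) ω = run.asst (t + 1) ω := if_neg hω.1
        rw [width, this]
        rfl) hb
    simp only [queueRegret_eq]
    exact key
  have hEr := h.measureReal_explores_le t
  have hBr := h.measureReal_missSet_le hm hK hKN hd hκ hlam t
  have hEi : Integrable (E.indicator fun _ => (1 : ℝ)) P :=
    (integrable_const 1).indicator (hGle _ hEm)
  have hBi : Integrable (B.indicator fun _ => (1 : ℝ)) P :=
    (integrable_const 1).indicator (hGle _ hBm)
  have hHi : Integrable (H.indicator (run.queueRegret mdl (t + 1))) P :=
    hreg.indicator (hGle _ hHm)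
  have hpoint (ω : Ω) : run.queueRegret mdl (t + 1) ω ≤ E.indicator (fun _ => (1 : ℝ)) ω +
      B.indicator (fun _ => (1 : ℝ)) ω + H.indicator (run.queueRegret mdl (t + 1)) ω := by
    have hE0 : 0 ≤ E.indicator (fun _ => (1 : ℝ)) ω :=
      Set.indicator_nonneg (fun _ _ => zero_le_one) _
    have hB0 : 0 ≤ B.indicator (fun _ => (1 : ℝ)) ω :=
      Set.indicator_nonneg (fun _ _ => zero_le_one) _
    have h1 := queueRegret_le_one (mdl := mdl) (run := run) (t + 1) ω
    by_cases hωD : ω ∈ D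
    · by_cases hωH : ω ∈ H
      · rw [Set.indicator_of_mem hωH]
        linarith
      · rw [Set.indicator_of_notMem hωH]
        have hEB : ω ∈ E ∪ B := by
          by_contra hcon
          exact hωH ⟨hωD, hcon⟩
        rcases hEB with hω | hω
        · rw [Set.indicator_of_mem hω]; linarith
        · rw [Set.indicator_of_mem hω (f := fun _ => (1 : ℝ))]; linarith
    · have h2 : run.queueRegret mdl (t + 1) ω = 0 := if_pos (not_not.1 hωD)
      rw [h2, Set.indicator_of_notMem (s := H) fun hωH => hωD hωH.1]
      linarith
  calc ∫ ω, run.queueRegret mdl (t + 1) ω ∂P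
      ≤ ∫ ω, (E.indicator (fun _ => (1 : ℝ)) ω + B.indicator (fun _ => (1 : ℝ)) ω +
        H.indicator (run.queueRegret mdl (t + 1)) ω) ∂P :=
        integral_mono hreg ((hEi.add hBi).add hHi) hpoint
    _ = P.real E + P.real B + ∫ ω in H, run.queueRegret mdl (t + 1) ω ∂P := by
        have h1 := integral_add (hEi.add hBi) hHi
        simp only [Pi.add_apply] at h1
        rw [h1, integral_add hEi hBi,
          integral_indicator_const _ (hGle _ hEm), integral_indicator_const _ (hGle _ hBm),
          integral_indicator (hGle _ hHm)]
        simp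
    _ ≤ _ := by
        rw [add_div]
        linarith

end IsACQB

end Run

/-! ### Summation over the rounds and choice of the weight -/

section Sums

lemma sum_Icc_one_eq_sum_range (f : ℕ → ℝ) (t : ℕ) :
    ∑ i ∈ Finset.Icc 1 t, f i = ∑ i ∈ Finset.range t, f (i + 1) := by
  induction t with
  | zero => simp
  | succ t ih => rw [Finset.sum_Icc_succ_top (by omega), ih, Finset.sum_range_succ]

lemma sum_inv_sqrt_le (t : ℕ) : ∑ i ∈ Finset.range t, 1 / √((i : ℝ) + 1) ≤ 2 * √(t : ℝ) := by
  induction t with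
  | zero => simp
  | succ t ih =>
    rw [Finset.sum_range_succ]
    push_cast
    have h1 : √((t : ℝ) + 1) ^ 2 = t + 1 := Real.sq_sqrt (by positivity)
    have h2 : √(t : ℝ) ^ 2 = t := Real.sq_sqrt (by positivity)
    have h3 : 0 < √((t : ℝ) + 1) := Real.sqrt_pos.2 (by positivity)
    have h4 : 1 / √((t : ℝ) + 1) ≤ 2 * √((t : ℝ) + 1) - 2 * √(t : ℝ) := by
      rw [div_le_iff₀ h3]
      nlinarith [sq_nonneg (√((t : ℝ) + 1) - √(t : ℝ))]
    linarith

variable {d K : ℕ} {κ lam₀ : ℝ}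

lemma log_one_add_div_le (hd : 1 ≤ d) (hlam : 0 < lam₀) {l t : ℕ} (hl : l ≤ t) (ht : 1 ≤ t) :
    Real.log (1 + l * K / (d * lam₀)) ≤
      (1 + Real.log (1 + K / lam₀)) * (1 + Real.log t) := by
  have hd' : (1 : ℝ) ≤ d := by exact_mod_cast hd
  have ht' : (1 : ℝ) ≤ t := by exact_mod_cast ht
  have hl' : (l : ℝ) ≤ t := by exact_mod_cast hl
  have hb : 0 ≤ Real.log (1 + K / lam₀) := Real.log_nonneg (by
    have : 0 ≤ K / lam₀ := by positivity
    linarith)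
  have hlt := Real.log_nonneg ht'
  have h1 : 1 + l * K / (d * lam₀) ≤ t * (1 + K / lam₀) := by
    have h2 : l * K / (d * lam₀) ≤ t * K / (1 * lam₀) := by gcongr
    rw [one_mul, mul_div_assoc (t : ℝ)] at h2
    linarith
  have h3 := Real.log_le_log (by positivity) h1
  rw [Real.log_mul (by positivity) (by positivity)] at h3
  nlinarith [mul_nonneg hb hlt]

/-- All radii up to `t` are bounded by one multiple of `√(d (1 + log t))`. The `5` collects the `4`
before `log l` and the `1` of `log_one_add_div_le`. -/
lemma radius_sq_le (hd : 1 ≤ d) (hκ : 0 < κ) (hlam : 0 < lam₀) {l t : ℕ} (hl : l ≤ t)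
    (ht : 1 ≤ t) : radius d K κ lam₀ l ^ 2 ≤
      κ ^ 2 * (√(5 + Real.log (1 + K / lam₀)) + √lam₀) ^ 2 * (d * (1 + Real.log t)) := by
  have hd' : (1 : ℝ) ≤ d := by exact_mod_cast hd
  have ht' : (1 : ℝ) ≤ t := by exact_mod_cast ht
  have hlt := Real.log_nonneg ht'
  have hb : 0 ≤ Real.log (1 + K / lam₀) := Real.log_nonneg (by
    have : 0 ≤ K / lam₀ := by positivity
    linarith)
  set b := Real.log (1 + K / lam₀) with hb_def
  set Λ := 1 + Real.log t with hΛ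
  have hΛ1 : 1 ≤ Λ := by linarith
  have hdΛ : 1 ≤ d * Λ := by nlinarith
  have hlog : Real.log l ≤ Real.log t := by
    -- For `l = 0` the convention `Real.log 0 = 0` applies.
    rcases Nat.eq_zero_or_pos l with rfl | hl0
    · simpa using hlt
    · exact Real.log_le_log (by exact_mod_cast hl0) (by exact_mod_cast hl)
  have h1 : d * Real.log (1 + l * K / (d * lam₀)) + 4 * Real.log l ≤ (5 + b) * (d * Λ) := by
    have h2 := mul_le_mul_of_nonneg_left (log_one_add_div_le (K := K) hd hlam hl ht)
      (by linarith : (0 : ℝ) ≤ d)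
    have h3 : Real.log t ≤ d * Λ := by nlinarith
    nlinarith
  have h4 : radius d K κ lam₀ l ≤ κ * (√(5 + b) + √lam₀) * √(d * Λ) := by
    rw [radius]
    have h5 := Real.sqrt_le_sqrt h1
    rw [Real.sqrt_mul (by linarith)] at h5
    have h6 : 1 ≤ √(d * Λ) := Real.one_le_sqrt.2 hdΛ
    have h7 : κ * √lam₀ ≤ κ * √lam₀ * √(d * Λ) := le_mul_of_one_le_right (by positivity) h6
    have h8 := mul_le_mul_of_nonneg_left h5 hκ.le
    have h9 : 0 ≤ κ * √(d * Real.log (1 + l * K / (d * lam₀)) + 4 * Real.log l) := by positivity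
    nlinarith
  have h10 := pow_le_pow_left₀ (radius_pos hκ hlam l).le h4 2
  rw [mul_pow, mul_pow, Real.sq_sqrt (by linarith)] at h10
  exact h10

end Sums

/-- The constant of the regret bound. -/
noncomputable def regretConst (K : ℕ) (κ lam₀ c₁ : ℝ) : ℝ :=
  2 * (c₁ + 4) + (1 / optimismProb + 4) *
    (2 * sampleSize K * (κ ^ 2 * (√(5 + Real.log (1 + K / lam₀)) + √lam₀) ^ 2) +
      K / 2 * ((1 + K / lam₀) * (1 + 1 / lam₀) * (1 + Real.log (1 + K / lam₀))))

lemma log_one_add_div_nonneg {K : ℕ} {lam₀ : ℝ} (hlam : 0 < lam₀) :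
    0 ≤ Real.log (1 + K / lam₀) :=
  Real.log_nonneg (by
    have : 0 ≤ K / lam₀ := by positivity
    linarith)

lemma regretConst_pos {K : ℕ} {κ lam₀ c₁ : ℝ} (hlam : 0 < lam₀) (hc : 0 < c₁) :
    0 < regretConst K κ lam₀ c₁ := by
  have h1 := log_one_add_div_nonneg (K := K) hlam
  have h2 := optimismProb_pos
  rw [regretConst]
  positivity

lemma Run.IsACQB.sum_integral_queueRegret_le {d N K : ℕ} {X Ω : Type*} [MeasurableSpace X]
    [MeasurableSpace Ω] {mdl : Model d N X} {run : Run d N K X Ω} {P : Measure Ω}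
    [IsProbabilityMeasure P] {κ lam₀ c₁ : ℝ} {enum : ℕ → Finset (Fin N)}
    (h : run.IsACQB P mdl κ lam₀ c₁ enum) (hm : mdl.Assumptions K κ)
    (hK : 1 ≤ K) (hKN : K ≤ N) (hd : 1 ≤ d) (hκ : 0 < κ) (hlam : 0 < lam₀) (hc : 0 < c₁)
    {t : ℕ} (ht : 1 ≤ t) :
    ∑ i ∈ Finset.Icc 1 t, ∫ ω, run.queueRegret mdl i ω ∂P ≤
      regretConst K κ lam₀ c₁ * (d : ℝ) ^ (3 / 2 : ℝ) * √(t : ℝ) * (1 + Real.log t) := by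
  have hd' : (1 : ℝ) ≤ d := by exact_mod_cast hd
  have ht' : (1 : ℝ) ≤ t := by exact_mod_cast ht
  have hlt := Real.log_nonneg ht'
  have hq := optimismProb_pos
  have hlb := log_one_add_div_nonneg (K := K) hlam
  set A := κ ^ 2 * (√(5 + Real.log (1 + K / lam₀)) + √lam₀) ^ 2 with hA
  set D := (1 + K / lam₀) * (1 + 1 / lam₀) * (1 + Real.log (1 + K / lam₀)) with hD
  set Λ := 1 + Real.log t with hΛ
  have hΛ1 : 1 ≤ Λ := by linarith
  set M := (sampleSize K : ℝ)
  set q := 1 / optimismProb + 4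
  have hq0 : 0 ≤ q := by positivity
  -- The weight balancing `t d² / b`, from the spread, against `b d`, from the widths. It may depend
  -- on the horizon because it occurs only in the analysis.
  set b := √(t : ℝ) * √(d : ℝ) with hb_def
  have hst : 0 < √(t : ℝ) := Real.sqrt_pos.2 (by linarith)
  have hsd : 0 < √(d : ℝ) := Real.sqrt_pos.2 (by linarith)
  have hb : 0 < b := by positivity
  have hrpow : (d : ℝ) ^ (3 / 2 : ℝ) = d * √d := by
    rw [Real.sqrt_eq_rpow, ← Real.rpow_one_add' (by linarith) (by norm_num)]
    norm_num
  have hd32 : 1 ≤ d * √(d : ℝ) := by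
    have := Real.one_le_sqrt.2 hd'
    nlinarith
  have hwidth : ∑ i ∈ Finset.range t, ∫ ω, run.width mdl lam₀ (i + 1) ω ∂P ≤ D * (d * Λ) := by
    rw [← integral_finsetSum _ fun i _ => h.integrable_width hm hKN hlam i]
    have hpoint (ω : Ω) : ∑ i ∈ Finset.range t, run.width mdl lam₀ (i + 1) ω ≤ D * (d * Λ) := by
      have h1 := sum_width_le (run := run) (ω := ω) hlam hm t fun i hi =>
        h.card_active_le (Finset.mem_Icc.1 hi).1 hKN ω
      have h2 := h.log_det_design_le hm hKN hd hlam t ω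
      have h3 := log_one_add_div_le (K := K) (lam₀ := lam₀) hd hlam le_rfl ht
      rw [sum_Icc_one_eq_sum_range] at h1
      refine h1.trans ?_
      have h4 := h2.trans (mul_le_mul_of_nonneg_left h3 (by linarith : (0 : ℝ) ≤ d))
      refine (mul_le_mul_of_nonneg_left h4 (by positivity)).trans (le_of_eq ?_)
      rw [hD]
      ring
    calc ∫ ω, ∑ i ∈ Finset.range t, run.width mdl lam₀ (i + 1) ω ∂P
        ≤ ∫ ω, D * (d * Λ) ∂P := integral_mono
          (integrable_finsetSum _ fun i _ => h.integrable_width hm hKN hlam i)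
          (integrable_const _) hpoint
      _ = D * (d * Λ) := by simp
  have hround : ∀ i ∈ Finset.range t, ∫ ω, run.queueRegret mdl (i + 1) ω ∂P ≤
      (c₁ + 4) * (1 / √((i : ℝ) + 1)) + q * (2 * (M * d * (A * (d * Λ))) / b) +
        q * (b * K / 2) * ∫ ω, run.width mdl lam₀ (i + 1) ω ∂P := by
    intro i hi
    have h1 := h.integral_queueRegret_le hm hK hKN hd hκ hlam i hb
    have h2 := radius_sq_le (K := K) hd hκ hlam (Finset.mem_range.1 hi).le ht
    refine h1.trans ?_
    rw [mul_one_div, add_assoc, mul_assoc q, ← mul_add]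
    gcongr
  rw [sum_Icc_one_eq_sum_range, hrpow]
  refine (Finset.sum_le_sum hround).trans ?_
  rw [Finset.sum_add_distrib, Finset.sum_add_distrib, Finset.sum_const, Finset.card_range,
    nsmul_eq_mul, ← Finset.mul_sum, ← Finset.mul_sum]
  have hs1 : (c₁ + 4) * ∑ i ∈ Finset.range t, 1 / √((i : ℝ) + 1) ≤
      2 * (c₁ + 4) * (d * √d * √t * Λ) := by
    have h1 := mul_le_mul_of_nonneg_left (sum_inv_sqrt_le t) (by linarith : 0 ≤ c₁ + 4)
    have h2 : √(t : ℝ) ≤ d * √d * √t * Λ := by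
      calc √(t : ℝ) = 1 * √t * 1 := by ring
        _ ≤ d * √d * √t * Λ := by gcongr
    have h3 := mul_le_mul_of_nonneg_left h2 (by linarith : 0 ≤ 2 * (c₁ + 4))
    linarith
  have hs2 : t * (q * (2 * (M * d * (A * (d * Λ))) / b)) = q * (2 * M * A) * (d * √d * √t * Λ) := by
    have h1 : √(t : ℝ) * √t = t := Real.mul_self_sqrt (by linarith)
    have h2 : √(d : ℝ) * √d = d := Real.mul_self_sqrt (by linarith)
    rw [hb_def]
    field_simp
    rw [sq, sq, h1, h2]
    ring
  have hs3 : q * (b * K / 2) * ∑ i ∈ Finset.range t, ∫ ω, run.width mdl lam₀ (i + 1) ω ∂P ≤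
      q * (K / 2 * D) * (d * √d * √t * Λ) := by
    have h1 := mul_le_mul_of_nonneg_left hwidth (by positivity : 0 ≤ q * (b * K / 2))
    refine h1.trans (le_of_eq ?_)
    rw [hb_def]
    ring
  rw [hs2]
  have hC : regretConst K κ lam₀ c₁ = 2 * (c₁ + 4) + q * (2 * M * A + K / 2 * D) := rfl
  rw [hC]
  calc _ ≤ 2 * (c₁ + 4) * (d * √d * √t * Λ) + q * (2 * M * A) * (d * √d * √t * Λ) +
        q * (K / 2 * D) * (d * √d * √t * Λ) := by gcongr
    _ = _ := by ring

end ACQB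

theorem theorem2 :
    ∃ p : ℕ, ∀ (K : ℕ) (κ lam₀ c₁ : ℝ), 1 ≤ K → 0 < κ → 0 < lam₀ → 0 < c₁ →
      ∃ C : ℝ, 0 < C ∧
        ∀ (d N : ℕ), 1 ≤ d → K ≤ N →
        ∀ (X : Type*) [MeasurableSpace X] (mdl : ACQB.Model d N X), mdl.Assumptions K κ →
        ∀ (Ω : Type*) [MeasurableSpace Ω] (P : Measure Ω) [IsProbabilityMeasure P]
          (enum : ℕ → Finset (Fin N)) (run : ACQB.Run d N K X Ω),
          run.IsACQB P mdl κ lam₀ c₁ enum →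
        ∀ t : ℕ, 1 ≤ t →
          (∀ i ∈ Finset.Icc 1 t, Integrable (run.routingRegret mdl i) P ∧
            Integrable (run.queueRegret mdl i) P) ∧
          ∑ i ∈ Finset.Icc 1 t, ∫ ω, run.routingRegret mdl i ω ∂P ≤
            C * (d : ℝ) ^ (3 / 2 : ℝ) * √(t : ℝ) * (1 + Real.log t) ^ p ∧
          ∑ i ∈ Finset.Icc 1 t, ∫ ω, run.queueRegret mdl i ω ∂P ≤
            C * (d : ℝ) ^ (3 / 2 : ℝ) * √(t : ℝ) * (1 + Real.log t) ^ p := by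
  -- One logarithm suffices: the squared radius and the summed widths each carry one, and they occur
  -- in different summands.
  refine ⟨1, fun K κ lam₀ c₁ hK hκ hlam hc =>
    ⟨ACQB.regretConst K κ lam₀ c₁, ACQB.regretConst_pos hlam hc, ?_⟩⟩
  intro d N hd hKN X _ mdl hm Ω _ P _ enum run h t ht
  have hint : ∀ i ∈ Finset.Icc 1 t, Integrable (run.routingRegret mdl i) P ∧
      Integrable (run.queueRegret mdl i) P := fun i hi =>
    ⟨h.integrable_routingRegret hm (Finset.mem_Icc.1 hi).1,
      h.integrable_queueRegret hm (Finset.mem_Icc.1 hi).1⟩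
  have hqueue := h.sum_integral_queueRegret_le hm hK hKN hd hκ hlam hc ht
  rw [pow_one]
  refine ⟨hint, le_trans (Finset.sum_le_sum fun i hi => ?_) hqueue, hqueue⟩
  exact integral_mono (hint i hi).1 (hint i hi).2
    fun ω => h.routingRegret_le_queueRegret (Finset.mem_Icc.1 hi).1 ω
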